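/- Let $\mathbb D$ be the open unit disc and $\sigma$ the Lebesgue area measure on $\mathbb D$ normalized by $\sigma(\mathbb D)=1$. For $0<p<\infty$ let $A^p$ be the space of analytic functions $f$ in $\mathbb D$ with $\|f\|_{A^p}=\left(\int_{\mathbb D}|f|^p\,d\sigma\right)^{1/p}<\infty$, and for $0<p\le\infty$ let $H^p$ be the space of analytic functions in $\mathbb D$ whose integral means $M_p(r,f)=\left(\frac1{2\pi}\int_0^{2\pi}|f(re^{i\theta})|^p\,d\theta\right)^{1/p}$ (essential supremum over $\theta$ if $p=\infty$) are bounded for $0\le r<1$. Boundary values on the unit circle are radial limits, defined almost everywhere. For $0<\alpha\le1$ and $p<\infty$, let $\Lambda_{\alpha,p}$ be the class of $L^p$ functions $u$ on the unit circle with $$\sup_{0<h\le t}\left(\frac1{2\pi}\int_0^{2\pi}|u(e^{i(x+h)})-u(e^{ix})|^p\,dx\right)^{1/p}=O(t^\alpha)\qquad (t\to0^+),$$ and let $\Lambda_{\alpha,\infty}$ be the class of functions on the unit circle (after modification on a null set) with $|u(x)-u(y)|\le A|x-y|^\alpha$ for some constant $A$ and all $x,y$. **Corollary.** Let $n\ge1$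 be an integer, let $n+1\le p<\infty$, let $q$ be the conjugate exponent of $p$, let $p-1\le s\le\infty$, and let $0<\alpha<1$. Let $f\in A^p$ with $\|f\|_{A^p}=1$, and suppose that $f^{(n-1)}\in H^s$ has boundary values in $\Lambda_{\alpha,s}$. Let $k\in A^q$ be a function such that $f$ solves the extremal problem of maximizing $\operatorname{Re}\int_{\mathbb D}g\,\overline{k}\,d\sigma$ among all $g\in A^p$ with $\|g\|_{A^p}=1$. Then $k^{(n-1)}\in H^{s/(p-1)}$, and the boundary values of $k^{(n-1)}$ are in $\Lambda_{\alpha,s/(p-1)}$ (where $s/(p-1)=\infty$ if $s=\infty$). -/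

import Mathlib

open MeasureTheory Filter Topology Set
open scoped ENNReal NNReal

noncomputable section

namespace Bergman

/-- The open unit disc. -/
def disc : Set ℂ := Metric.ball 0 1

/-- Normalized Lebesgue area measure on the unit disc (total mass one). -/
def areaMeasure : Measure ℂ := (ENNReal.ofReal Real.pi)⁻¹ • volume.restrict disc

/-- Normalized arc length `dθ / 2π` in the angle `θ ∈ (0, 2π]`. -/
def angleMeasure : Measure ℝ :=
  (ENNReal.ofReal (2 * Real.pi))⁻¹ • volume.restrict (Ioc 0 (2 * Real.pi))

/-- The Bergman norm `‖f‖_{A^p}`, with values in `[0, ∞]`. -/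
def bergmanNorm (p : ℝ) (f : ℂ → ℂ) : ℝ≥0∞ := eLpNorm f (ENNReal.ofReal p) areaMeasure

/-- `f ∈ A^p`, for `0 < p < ∞`; only the values of `f` in the disc matter. -/
def MemBergman (p : ℝ) (f : ℂ → ℂ) : Prop :=
  DifferentiableOn ℂ f disc ∧ bergmanNorm p f < ∞

/-- The integral mean `M_p(r, f)`, `0 < p ≤ ∞`; an essential supremum when `p = ∞`. -/
def integralMean (p : ℝ≥0∞) (r : ℝ) (f : ℂ → ℂ) : ℝ≥0∞ :=
  eLpNorm (fun θ : ℝ => f (r * Complex.exp (θ * Complex.I))) p angleMeasure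

/-- `f ∈ H^p`, for `0 < p ≤ ∞`: analytic in the disc with bounded integral means. -/
def MemHardy (p : ℝ≥0∞) (f : ℂ → ℂ) : Prop :=
  DifferentiableOn ℂ f disc ∧ (⨆ r ∈ Ico (0 : ℝ) 1, integralMean p r f) < ∞

/-- `u`, a function on the unit circle, is the boundary function of `F`: the radial limit of `F`
is `u` at almost every point of the circle. -/
def IsBoundaryFunction (F : ℂ → ℂ) (u : Circle → ℂ) : Prop :=
  ∀ᵐ θ : ℝ, Tendsto (fun r : ℝ => F (r * Complex.exp (θ * Complex.I))) (𝓝[<] 1)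
    (𝓝 (u (Circle.exp θ)))

/-- The integral modulus of continuity of order `p`,
`ω_p(t, u) = sup_{0 < h ≤ t} ‖u(e^{i(x + h)}) - u(e^{ix})‖_{L^p(dx / 2π)}`. -/
def integralModulus (p : ℝ≥0∞) (t : ℝ) (u : Circle → ℂ) : ℝ≥0∞ :=
  ⨆ h ∈ Ioc (0 : ℝ) t,
    eLpNorm (fun x : ℝ => u (Circle.exp (x + h)) - u (Circle.exp x)) p angleMeasure

/-- `Λ_α`: functions on the unit circle that are Lipschitz of order `α`. -/
def MemLipschitz (α : ℝ) (u : Circle → ℂ) : Prop :=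
  ∃ A : ℝ, ∀ x y : Circle, ‖u x - u y‖ ≤ A * ‖(x : ℂ) - (y : ℂ)‖ ^ α

/-- The Lebesgue-Lipschitz class `Λ_{α,p}`: for `p = ∞` it is `Λ_α`, and for `p < ∞` it consists
of the `L^p` functions on the circle with `ω_p(t, u) = O(t^α)` as `t → 0+`. -/
def MemLebesgueLipschitz (α : ℝ) (p : ℝ≥0∞) (u : Circle → ℂ) : Prop :=
  (p = ∞ ∧ MemLipschitz α u) ∨
  (p ≠ ∞ ∧ MemLp (fun x : ℝ => u (Circle.exp x)) p angleMeasure ∧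
    ∃ C : ℝ≥0, ∀ᶠ t in 𝓝[>] (0 : ℝ), integralModulus p t u ≤ C * ENNReal.ofReal (t ^ α))

/-- The boundary values of `F` are in `Λ_{α,p}`. -/
def BoundaryValuesInLipschitz (α : ℝ) (p : ℝ≥0∞) (F : ℂ → ℂ) : Prop :=
  ∃ u : Circle → ℂ, IsBoundaryFunction F u ∧ MemLebesgueLipschitz α p u

/-- `f` solves the extremal problem of maximizing `Re ∫ g conj(k) dσ` among all `g` of unit
`A^p` norm. -/
def IsExtremal (p : ℝ) (k f : ℂ → ℂ) : Prop :=
  MemBergman p f ∧ bergmanNorm p f = 1 ∧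
  ∀ g : ℂ → ℂ, MemBergman p g → bergmanNorm p g = 1 →
    (∫ z, g z * (starRingEnd ℂ) (k z) ∂areaMeasure).re ≤
      (∫ z, f z * (starRingEnd ℂ) (k z) ∂areaMeasure).re

end Bergman

end

noncomputable section

namespace Bergman

/-! Write `L` for the extremal value Re ∫ f k̄ dσ. Varying f within the unit sphere of A^p shows
that k and L|f|^{p-2}f induce the same functional on A^p (`IsExtremal.integral_eq`). Testing on
powers then gives the Taylor coefficients of k (`IsExtremal.taylor_coeff_eq`): k is L times the
Bergman projection of |f|^{p-2}f.

Passing from k to z^n k^{(n)} multiplies the m-th coefficient by m(m-1)⋯(m-n+1). Against w̄^m on a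
circle, the operator -i∂_θ integrates by parts to multiplication by m, so this factor can be moved
onto the density. Hence z^n k^{(n)} is L times the Bergman integral of v, the falling factorial of
-i∂_θ applied to |f|^{p-2}f (`dualDeriv`, `IsExtremal.pow_mul_iteratedDeriv_eq`). The zeros of f,
where the density need not be smooth, meet only countably many circles and do no harm.

The assumption p ≥ n+1 prevents v from blowing up near those zeros: |v| is at most a constant times
(Σ_{j<n} |f^{(j)}|)^{p-2} Σ_{j≤n} |f^{(j)}|, with f^{(n)} entering linearly
(`exists_norm_dualDeriv_le`). The derivatives of order below n lie in H^s, and Hardy–Littlewood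
(`exists_integralMean_deriv_le`) gives M_s(ρ, f^{(n)}) = O((1-ρ)^{α-1}). Hölder's inequality turns
this into the same growth for the means of v of order s/(p-1) ≥ 1. Bergman integrals preserve that
growth (`exists_integralMean_bergmanIntegral_le`, by Minkowski and kernel estimates), the factor z^n
can be divided out, and the converse Hardy–Littlewood theorem
(`memHardy_and_lipschitz_of_integralMean_deriv_le`) yields the claim for k^{(n-1)}.

The direct Hardy–Littlewood theorem is available here only for s > 1. The remaining case s ≤ 1
forces p = 2 and n = 1, and then k = Lf on the disc (`IsExtremal.eqOn_const_mul`). -/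

/-! ### Normalized arc length: periodicity and translation invariance. -/

lemma ofReal_two_pi_ne_zero : ENNReal.ofReal (2 * Real.pi) ≠ 0 := by
  simp [Real.pi_pos]

instance isProbabilityMeasure_angleMeasure : IsProbabilityMeasure angleMeasure := by
  constructor
  simp only [angleMeasure, Measure.smul_apply, Measure.restrict_apply MeasurableSet.univ,
    univ_inter, Real.volume_Ioc, sub_zero, smul_eq_mul]
  exact ENNReal.inv_mul_cancel ofReal_two_pi_ne_zero ENNReal.ofReal_ne_top

lemma lintegral_angleMeasure (g : ℝ → ℝ≥0∞) :
    ∫⁻ θ, g θ ∂angleMeasure =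
      (ENNReal.ofReal (2 * Real.pi))⁻¹ * ∫⁻ θ in Ioc 0 (2 * Real.pi), g θ := by
  simp [angleMeasure, lintegral_smul_measure]

lemma integral_angleMeasure (g : ℝ → ℂ) :
    ∫ θ, g θ ∂angleMeasure = (2 * Real.pi : ℂ)⁻¹ * ∫ θ in (0)..(2 * Real.pi), g θ := by
  rw [intervalIntegral.integral_of_le (by positivity), angleMeasure, integral_smul_measure,
    ENNReal.toReal_inv, ENNReal.toReal_ofReal (by positivity), Complex.real_smul]
  simp

lemma setLIntegral_Ioc_periodic {g : ℝ → ℝ≥0∞} (hg : Function.Periodic g (2 * Real.pi))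
    (a b : ℝ) : ∫⁻ θ in Ioc a (a + 2 * Real.pi), g θ = ∫⁻ θ in Ioc b (b + 2 * Real.pi), g θ := by
  refine (isAddFundamentalDomain_Ioc Real.two_pi_pos a).setLIntegral_eq
    (isAddFundamentalDomain_Ioc Real.two_pi_pos b) g ?_
  rintro ⟨x, hx⟩ y
  obtain ⟨m, rfl⟩ := AddSubgroup.mem_zmultiples_iff.1 hx
  change g (m • (2 * Real.pi) + y) = g y
  rw [add_comm]
  exact hg.zsmul m y

lemma setLIntegral_Ioc_add_right (g : ℝ → ℝ≥0∞) (a b h : ℝ) :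
    ∫⁻ θ in Ioc a b, g (θ + h) = ∫⁻ θ in Ioc (a + h) (b + h), g θ := by
  have := (measurePreserving_add_right (volume : Measure ℝ) h).setLIntegral_comp_preimage_emb
    (measurableEmbedding_addRight h) g (Ioc (a + h) (b + h))
  rw [← this]
  simp

lemma lintegral_angleMeasure_add {g : ℝ → ℝ≥0∞} (hg : Function.Periodic g (2 * Real.pi)) (h : ℝ) :
    ∫⁻ θ, g (θ + h) ∂angleMeasure = ∫⁻ θ, g θ ∂angleMeasure := by
  rw [lintegral_angleMeasure, lintegral_angleMeasure, setLIntegral_Ioc_add_right,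
    show 2 * Real.pi + h = (0 + h) + 2 * Real.pi by ring,
    setLIntegral_Ioc_periodic hg (0 + h) 0]
  simp

lemma lintegral_angleMeasure_eq_symm {g : ℝ → ℝ≥0∞} (hg : Function.Periodic g (2 * Real.pi)) :
    ∫⁻ θ, g θ ∂angleMeasure =
      (ENNReal.ofReal (2 * Real.pi))⁻¹ * ∫⁻ θ in Ioc (-Real.pi) Real.pi, g θ := by
  rw [lintegral_angleMeasure]
  have := setLIntegral_Ioc_periodic hg (-Real.pi) 0
  rw [show -Real.pi + 2 * Real.pi = Real.pi by ring, zero_add] at this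
  rw [this]

/-- Every angle has a translate by a multiple of 2π in (0, 2π], and countably many translates of a
null set are null. -/
lemma ae_angleMeasure_iff {P : ℝ → Prop} (hP : ∀ θ, P (θ + 2 * Real.pi) ↔ P θ) :
    (∀ᵐ θ ∂angleMeasure, P θ) ↔ ∀ᵐ θ : ℝ, P θ := by
  have h0 : (∀ᵐ θ ∂angleMeasure, P θ) ↔ ∀ᵐ θ ∂(volume.restrict (Ioc 0 (2 * Real.pi))), P θ := by
    rw [angleMeasure]
    exact Measure.ae_ennreal_smul_measure_iff (ENNReal.inv_ne_zero.2 ENNReal.ofReal_ne_top)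
  rw [h0]
  constructor
  · intro h
    have hz : ∀ (m : ℤ) θ, P (θ + m * (2 * Real.pi)) ↔ P θ := by
      intro m θ
      have : Function.Periodic (fun θ => P θ) (2 * Real.pi) := fun θ => propext (hP θ)
      exact iff_of_eq (this.int_mul m θ)
    rw [ae_restrict_iff' measurableSet_Ioc] at h
    have h' : ∀ m : ℤ, ∀ᵐ θ : ℝ, θ + m * (2 * Real.pi) ∈ Ioc 0 (2 * Real.pi) →
        P (θ + m * (2 * Real.pi)) := fun m =>
      (measurePreserving_add_right (volume : Measure ℝ) (m * (2 * Real.pi))).quasiMeasurePreserving.ae h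
    filter_upwards [ae_all_iff.2 h'] with θ hθ
    obtain ⟨m, hm⟩ := (existsUnique_add_zsmul_mem_Ioc Real.two_pi_pos θ 0).exists
    have := hθ m (by simpa using hm)
    exact (hz m θ).1 this
  · intro h
    exact ae_restrict_of_ae h

lemma ae_angleMeasure_add {P : ℝ → Prop} (hP : ∀ θ, P (θ + 2 * Real.pi) ↔ P θ) (h : ℝ) :
    (∀ᵐ θ ∂angleMeasure, P (θ + h)) ↔ ∀ᵐ θ ∂angleMeasure, P θ := by
  have key : ∀ {P : ℝ → Prop} (h : ℝ), (∀ᵐ θ : ℝ, P θ) → ∀ᵐ θ : ℝ, P (θ + h) := fun h hh =>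
    (measurePreserving_add_right (volume : Measure ℝ) h).quasiMeasurePreserving.ae hh
  rw [ae_angleMeasure_iff (P := fun θ => P (θ + h)), ae_angleMeasure_iff hP]
  · refine ⟨fun hh => ?_, key h⟩
    have := key (-h) hh
    simpa using this
  · intro θ
    rw [show θ + 2 * Real.pi + h = θ + h + 2 * Real.pi by ring, hP]

lemma eLpNorm_angleMeasure_add {G : ℝ → ℂ} (hG : Function.Periodic G (2 * Real.pi)) (p : ℝ≥0∞)
    (h : ℝ) : eLpNorm (fun θ => G (θ + h)) p angleMeasure = eLpNorm G p angleMeasure := by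
  rcases eq_or_ne p 0 with rfl | hp0
  · simp
  rcases eq_or_ne p ∞ with rfl | hp
  · simp only [eLpNorm_exponent_top, eLpNormEssSup, essSup, limsup_eq]
    congr 1
    ext a
    exact ae_angleMeasure_add (P := fun θ => ‖G θ‖ₑ ≤ a) (fun θ => by rw [hG θ]) h
  · simp only [eLpNorm_eq_lintegral_rpow_enorm_toReal hp0 hp]
    rw [lintegral_angleMeasure_add (g := fun θ => ‖G θ‖ₑ ^ p.toReal)]
    intro θ
    simp only [hG θ]

/-! ### Minkowski's integral inequality. -/

/-- For finite p, Hölder with weight N gives (∫|G| dν)^p ≤ (∫N)^{p-1} ∫ N^{1-p}|G|^p dν. Integrating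
in x and applying Tonelli, the bound on the slices turns the last integral into at most ∫N. Working
with a majorant N of the slice norms avoids any measurability question about those norms. For p = ∞
it is enough to exchange the two almost-everywhere quantifiers. -/
lemma eLpNorm_le_lintegral_of_measurable {X Y : Type*} [MeasurableSpace X] [MeasurableSpace Y]
    {μ : Measure X} {ν : Measure Y} [SFinite μ] [SFinite ν] {p : ℝ≥0∞} (hp : 1 ≤ p)
    {f : X → ℂ} {G : X → Y → ℂ} (hG : Measurable (Function.uncurry G))
    {N : Y → ℝ≥0∞} (hN : Measurable N) (hN0 : ∀ᵐ y ∂ν, N y ≠ 0)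
    (hGN : ∀ᵐ y ∂ν, eLpNorm (fun x => G x y) p μ ≤ N y)
    (hf : ∀ᵐ x ∂μ, ‖f x‖ₑ ≤ ∫⁻ y, ‖G x y‖ₑ ∂ν) :
    eLpNorm f p μ ≤ ∫⁻ y, N y ∂ν := by
  have hGm : Measurable fun z : X × Y => ‖G z.1 z.2‖ₑ := hG.enorm
  rcases eq_or_ne (∫⁻ y, N y ∂ν) ∞ with hI | hI
  · rw [hI]; exact le_top
  rcases eq_or_ne p ∞ with rfl | hptop
  · have h1 : ∀ᵐ y ∂ν, ∀ᵐ x ∂μ, ‖G x y‖ₑ ≤ N y := by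
      filter_upwards [hGN] with y hy
      rw [eLpNorm_exponent_top] at hy
      exact (ae_le_eLpNormEssSup (f := fun x => G x y)).mono fun x hx => hx.trans hy
    have h2 : ∀ᵐ x ∂μ, ∀ᵐ y ∂ν, ‖G x y‖ₑ ≤ N y :=
      (Measure.ae_ae_comm (p := fun x y => ‖G x y‖ₑ ≤ N y)
        (measurableSet_le hGm (hN.comp measurable_snd))).2 h1
    rw [eLpNorm_exponent_top]
    refine essSup_le_of_ae_le _ ?_
    filter_upwards [h2, hf] with x h2 hx
    exact hx.trans (lintegral_mono_ae h2)
  have hp0 : p ≠ 0 := (zero_lt_one.trans_le hp).ne'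
  set P := p.toReal with hP
  have hP1 : 1 ≤ P := by
    rw [hP, ← ENNReal.toReal_one]
    exact ENNReal.toReal_mono hptop hp
  have hP0 : 0 < P := by linarith
  have hNtop : ∀ᵐ y ∂ν, N y ≠ ∞ := (ae_lt_top hN hI).mono fun y hy => hy.ne
  have hx : ∀ᵐ x ∂μ, ‖f x‖ₑ ^ P ≤
      (∫⁻ y, N y ∂ν) ^ (P - 1) * ∫⁻ y, N y ^ (1 - P) * ‖G x y‖ₑ ^ P ∂ν := by
    filter_upwards [hf] with x hx
    have hGx : Measurable fun y => ‖G x y‖ₑ := hGm.comp measurable_prodMk_left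
    -- The powers of N are chosen to cancel: N^{1-1/P} · (N^{1-P})^{1/P} = 1. This is where N must
    -- be neither 0 nor ∞.
    have h1 := ENNReal.lintegral_mul_norm_pow_le (μ := ν) (f := N)
      (g := fun y => N y ^ (1 - P) * ‖G x y‖ₑ ^ P) hN.aemeasurable
      ((hN.pow_const _).mul (hGx.pow_const _)).aemeasurable (p := 1 - 1 / P) (q := 1 / P)
      (by rw [sub_nonneg, div_le_one hP0]; exact hP1) (by positivity) (by ring)
    have h2 : ∫⁻ y, ‖G x y‖ₑ ∂ν =
        ∫⁻ y, N y ^ (1 - 1 / P) * (N y ^ (1 - P) * ‖G x y‖ₑ ^ P) ^ (1 / P) ∂ν := by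
      refine lintegral_congr_ae ?_
      filter_upwards [hN0, hNtop] with y h0 htop
      rw [ENNReal.mul_rpow_of_nonneg _ _ (by positivity), ← ENNReal.rpow_mul, ← ENNReal.rpow_mul,
        ← mul_assoc, ← ENNReal.rpow_add _ _ h0 htop]
      have e1 : 1 - 1 / P + (1 - P) * (1 / P) = 0 := by field_simp; ring
      have e2 : P * (1 / P) = 1 := by field_simp
      rw [e1, e2]; simp
    calc ‖f x‖ₑ ^ P ≤ (∫⁻ y, ‖G x y‖ₑ ∂ν) ^ P := by gcongr
      _ ≤ ((∫⁻ y, N y ∂ν) ^ (1 - 1 / P) *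
          (∫⁻ y, N y ^ (1 - P) * ‖G x y‖ₑ ^ P ∂ν) ^ (1 / P)) ^ P := by
        rw [h2]; gcongr
      _ = _ := by
        rw [ENNReal.mul_rpow_of_nonneg _ _ hP0.le, ← ENNReal.rpow_mul, ← ENNReal.rpow_mul]
        have e1 : (1 - 1 / P) * P = P - 1 := by field_simp
        have e2 : 1 / P * P = 1 := by field_simp
        rw [e1, e2, ENNReal.rpow_one]
  have hswap : ∫⁻ x, ∫⁻ y, N y ^ (1 - P) * ‖G x y‖ₑ ^ P ∂ν ∂μ ≤ ∫⁻ y, N y ∂ν := by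
    rw [lintegral_lintegral_swap (((hN.comp measurable_snd).pow_const _).mul
      (hGm.pow_const _)).aemeasurable]
    refine lintegral_mono_ae ?_
    filter_upwards [hN0, hNtop, hGN] with y h0 htop hy
    have hGy : Measurable fun x => ‖G x y‖ₑ := hGm.comp measurable_prodMk_right
    rw [lintegral_const_mul _ (hGy.pow_const _)]
    rw [eLpNorm_eq_lintegral_rpow_enorm_toReal hp0 hptop] at hy
    have hy' : ∫⁻ x, ‖G x y‖ₑ ^ P ∂μ ≤ N y ^ P := by
      rw [one_div, ENNReal.rpow_inv_le_iff hP0] at hy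
      exact hy
    calc _ ≤ N y ^ (1 - P) * N y ^ P := by gcongr
      _ = N y := by rw [← ENNReal.rpow_add _ _ h0 htop]; simp
  rw [eLpNorm_eq_lintegral_rpow_enorm_toReal hp0 hptop, one_div, ENNReal.rpow_inv_le_iff hP0]
  calc ∫⁻ x, ‖f x‖ₑ ^ P ∂μ
      ≤ ∫⁻ x, (∫⁻ y, N y ∂ν) ^ (P - 1) * ∫⁻ y, N y ^ (1 - P) * ‖G x y‖ₑ ^ P ∂ν ∂μ :=
        lintegral_mono_ae hx
    _ = (∫⁻ y, N y ∂ν) ^ (P - 1) * ∫⁻ x, ∫⁻ y, N y ^ (1 - P) * ‖G x y‖ₑ ^ P ∂ν ∂μ := by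
        rw [lintegral_const_mul']
        exact ENNReal.rpow_ne_top_of_nonneg (by linarith) hI
    _ ≤ (∫⁻ y, N y ∂ν) ^ (P - 1) * (∫⁻ y, N y ∂ν) ^ (1 : ℝ) := by
        rw [ENNReal.rpow_one]; gcongr
    _ = (∫⁻ y, N y ∂ν) ^ P := by
        rw [← ENNReal.rpow_add_of_nonneg _ _ (by linarith) (by norm_num)]; simp

/-- A form of **Minkowski's integral inequality**. -/
lemma eLpNorm_le_lintegral {X Y : Type*} [MeasurableSpace X] [MeasurableSpace Y]
    {μ : Measure X} {ν : Measure Y} [SFinite μ] [SFinite ν] {p : ℝ≥0∞} (hp : 1 ≤ p)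
    {f : X → ℂ} {G : X → Y → ℂ} (hG : AEStronglyMeasurable (Function.uncurry G) (μ.prod ν))
    {N : Y → ℝ≥0∞} (hN : AEMeasurable N ν) (hN0 : ∀ᵐ y ∂ν, N y ≠ 0)
    (hGN : ∀ᵐ y ∂ν, eLpNorm (fun x => G x y) p μ ≤ N y)
    (hf : ∀ᵐ x ∂μ, ‖f x‖ₑ ≤ ∫⁻ y, ‖G x y‖ₑ ∂ν) :
    eLpNorm f p μ ≤ ∫⁻ y, N y ∂ν := by
  have h1 : ∀ᵐ x ∂μ, ∀ᵐ y ∂ν, G x y = hG.mk _ (x, y) := Measure.ae_ae_of_ae_prod hG.ae_eq_mk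
  have h2 : ∀ᵐ y ∂ν, ∀ᵐ x ∂μ, G x y = hG.mk _ (x, y) := by
    have : ∀ᵐ z ∂(ν.prod μ), G z.2 z.1 = hG.mk _ (z.2, z.1) :=
      (Measure.measurePreserving_swap (μ := ν) (ν := μ)).quasiMeasurePreserving.ae hG.ae_eq_mk
    exact Measure.ae_ae_of_ae_prod this
  rw [lintegral_congr_ae hN.ae_eq_mk]
  refine eLpNorm_le_lintegral_of_measurable hp (G := fun x y => hG.mk _ (x, y))
    (hG.stronglyMeasurable_mk.measurable) hN.measurable_mk ?_ ?_ ?_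
  · filter_upwards [hN0, hN.ae_eq_mk] with y h h'
    rwa [← h']
  · filter_upwards [hGN, hN.ae_eq_mk, h2] with y h h' h2
    rwa [← h', ← eLpNorm_congr_ae h2]
  · filter_upwards [hf, h1] with x hx h1
    refine hx.trans (le_of_eq (lintegral_congr_ae ?_))
    filter_upwards [h1] with y hy
    rw [hy]

/-! ### Estimates for the Cauchy and Bergman kernels. -/

/-- Use |1 - xe^{it}|² = (1-x)² + 2x(1 - cos t) together with 1 - cos t ≥ 2t²/π² for |t| ≤ π. When x
≤ 1/2 the first summand is at least 1/4, which already dominates t²/(2π)². -/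
lemma max_le_norm_one_sub {x t : ℝ} (hx0 : 0 ≤ x) (hx1 : x ≤ 1) (ht : |t| ≤ Real.pi) :
    max |t| (1 - x) ≤ 2 * Real.pi * ‖1 - x * Complex.exp (t * Complex.I)‖ := by
  have hpi := Real.pi_gt_three
  have hsq : ‖1 - x * Complex.exp (t * Complex.I)‖ ^ 2 =
      (1 - x) ^ 2 + 2 * x * (1 - Real.cos t) := by
    rw [← Complex.normSq_eq_norm_sq, Complex.normSq_apply]
    simp only [Complex.sub_re, Complex.one_re, Complex.mul_re, Complex.ofReal_re,
      Complex.exp_ofReal_mul_I_re, Complex.ofReal_im, Complex.exp_ofReal_mul_I_im, Complex.sub_im,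
      Complex.one_im, Complex.mul_im]
    nlinarith [Real.sin_sq_add_cos_sq t]
  have hcos := Real.cos_le_one_sub_mul_cos_sq ht
  have hn := norm_nonneg (1 - x * Complex.exp (t * Complex.I))
  have ht2 : t ^ 2 ≤ Real.pi ^ 2 := sq_le_sq' (by linarith [neg_abs_le t]) ((le_abs_self t).trans ht)
  have hc0 : 0 ≤ 1 - Real.cos t := by linarith [Real.cos_le_one t]
  refine max_le ?_ ?_
  · refine abs_le_of_sq_le_sq ?_ (by positivity)
    rw [mul_pow, hsq]
    rcases le_total x (1 / 2) with h | h
    · have : (1 / 4 : ℝ) ≤ (1 - x) ^ 2 := by nlinarith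
      have h3 : 0 ≤ 2 * x * (1 - Real.cos t) := by positivity
      nlinarith [sq_nonneg Real.pi]
    · have h3 : 2 / Real.pi ^ 2 * t ^ 2 ≤ 2 * x * (1 - Real.cos t) := by nlinarith
      have h4 : (2 * Real.pi) ^ 2 * (2 / Real.pi ^ 2 * t ^ 2) = 8 * t ^ 2 := by
        field_simp; ring
      have h5 : (2 * Real.pi) ^ 2 * (2 / Real.pi ^ 2 * t ^ 2) ≤
        (2 * Real.pi) ^ 2 * ((1 - x) ^ 2 + 2 * x * (1 - Real.cos t)) := by
        gcongr; nlinarith [sq_nonneg (1 - x)]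
      nlinarith [sq_nonneg t]
  · have h1 : 1 - x ≤ ‖1 - x * Complex.exp (t * Complex.I)‖ := by
      have := norm_sub_norm_le (1 : ℂ) (x * Complex.exp (t * Complex.I))
      simpa [Complex.norm_exp_ofReal_mul_I, abs_of_nonneg hx0] using this
    nlinarith

/-- Split at δ. Below it the integrand is x^a δ^{-b}, integrable because a > -1; above it, x^{a-b},
integrable because a - b < -1. Both pieces scale like δ^{a-b+1}. -/
lemma exists_setLIntegral_rpow_max_le {a b : ℝ} (ha : -1 < a) (hab : a - b < -1) :
    ∃ C : ℝ, 0 ≤ C ∧ ∀ δ : ℝ, 0 < δ →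
      ∫⁻ x in Ioi 0, ENNReal.ofReal (x ^ a * max x δ ^ (-b)) ≤
        ENNReal.ofReal (C * δ ^ (a - b + 1)) := by
  refine ⟨1 / (a + 1) + 1 / (-(a - b + 1)), add_nonneg (by apply div_nonneg <;> linarith)
    (by apply div_nonneg <;> linarith), fun δ hδ => ?_⟩
  rw [← Ioc_union_Ioi_eq_Ioi hδ.le, lintegral_union measurableSet_Ioi (by
    rw [Set.disjoint_left]; intro x hx hx'; exact not_lt.2 hx.2 hx'), add_mul,
    ENNReal.ofReal_add]
  rotate_left
  · have : 0 < a + 1 := by linarith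
    positivity
  · have : 0 < -(a - b + 1) := by linarith
    positivity
  refine add_le_add ?_ ?_
  · have h1 : ∫⁻ x in Ioc 0 δ, ENNReal.ofReal (x ^ a * max x δ ^ (-b)) =
        ∫⁻ x in Ioc 0 δ, ENNReal.ofReal (x ^ a * δ ^ (-b)) := by
      refine setLIntegral_congr_fun measurableSet_Ioc fun x hx => ?_
      simp only [max_eq_right hx.2]
    have hint : IntegrableOn (fun x : ℝ => x ^ a * δ ^ (-b)) (Ioc 0 δ) := by
      have := (intervalIntegral.intervalIntegrable_rpow' (a := 0) (b := δ) ha).1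
      exact this.mul_const _
    rw [h1, ← ofReal_integral_eq_lintegral_ofReal hint]
    · refine ENNReal.ofReal_le_ofReal (le_of_eq ?_)
      rw [integral_mul_const, ← intervalIntegral.integral_of_le hδ.le, integral_rpow (Or.inl ha),
        Real.zero_rpow (by linarith), sub_zero, show a - b + 1 = (a + 1) + -b by ring,
        Real.rpow_add hδ (a + 1)]
      ring
    · filter_upwards [ae_restrict_mem measurableSet_Ioc] with x hx
      have := hx.1
      simp only [Pi.zero_apply]; positivity
  · have h1 : ∫⁻ x in Ioi δ, ENNReal.ofReal (x ^ a * max x δ ^ (-b)) =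
        ∫⁻ x in Ioi δ, ENNReal.ofReal (x ^ (a - b)) := by
      refine setLIntegral_congr_fun measurableSet_Ioi fun x hx => ?_
      have hx' : δ < x := hx
      simp only [max_eq_left hx'.le]
      rw [← Real.rpow_add (hδ.trans hx'), sub_eq_add_neg]
    rw [h1, ← ofReal_integral_eq_lintegral_ofReal (integrableOn_Ioi_rpow_of_lt hab hδ)]
    · refine ENNReal.ofReal_le_ofReal (le_of_eq ?_)
      rw [integral_Ioi_rpow_of_lt hab hδ]
      have : a - b + 1 ≠ 0 := by linarith
      field_simp
    · filter_upwards [ae_restrict_mem measurableSet_Ioi] with x hx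
      have : 0 < x := hδ.trans hx
      simp only [Pi.zero_apply]; positivity

/-- After replacing |1 - xe^{it}| by max(|t|, 1-x), this is the previous bound with exponent b = 2.
The case β = α serves the Cauchy kernel against Lipschitz data, and β = 0 serves the Bergman kernel.
-/
lemma exists_setLIntegral_kernel_le {β : ℝ} (hβ0 : 0 ≤ β) (hβ1 : β < 1) :
    ∃ C : ℝ, 0 ≤ C ∧ ∀ x ∈ Ico (0 : ℝ) 1,
      ∫⁻ t in Ioc (-Real.pi) Real.pi,
          ENNReal.ofReal (|t| ^ β / ‖1 - x * Complex.exp (t * Complex.I)‖ ^ 2) ≤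
        ENNReal.ofReal (C * (1 - x) ^ (β - 1)) := by
  obtain ⟨C, hC0, hC⟩ := exists_setLIntegral_rpow_max_le (a := β) (b := 2) (by linarith)
    (by linarith)
  refine ⟨2 * ((2 * Real.pi) ^ 2 * C), by positivity, fun x hx => ?_⟩
  have hδ : 0 < 1 - x := by linarith [hx.2]
  set g : ℝ → ℝ≥0∞ := fun t => ENNReal.ofReal ((2 * Real.pi) ^ 2) *
    ENNReal.ofReal (|t| ^ β * max |t| (1 - x) ^ (-2 : ℝ)) with hg
  have hle : ∀ t ∈ Ioc (-Real.pi) Real.pi,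
      ENNReal.ofReal (|t| ^ β / ‖1 - x * Complex.exp (t * Complex.I)‖ ^ 2) ≤ g t := by
    intro t ht
    rw [hg]
    simp only
    rw [← ENNReal.ofReal_mul (by positivity)]
    refine ENNReal.ofReal_le_ofReal ?_
    have h := max_le_norm_one_sub hx.1 hx.2.le (abs_le.2 ⟨ht.1.le, ht.2⟩)
    have hm : 0 < max |t| (1 - x) := lt_max_of_lt_right hδ
    have hn : 0 < ‖1 - x * Complex.exp (t * Complex.I)‖ := by
      by_contra! hcon
      nlinarith [Real.pi_pos]
    rw [Real.rpow_neg hm.le, Real.rpow_two, div_le_iff₀ (by positivity)]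
    have h2 : 1 ≤ (2 * Real.pi) ^ 2 * (max |t| (1 - x) ^ 2)⁻¹ *
        ‖1 - x * Complex.exp (t * Complex.I)‖ ^ 2 := by
      rw [mul_comm, ← mul_assoc, ← div_eq_mul_inv, one_le_div (by positivity), ← mul_pow,
        mul_comm ‖_‖]
      gcongr
    calc |t| ^ β = |t| ^ β * 1 := by ring
      _ ≤ |t| ^ β * ((2 * Real.pi) ^ 2 * (max |t| (1 - x) ^ 2)⁻¹ *
        ‖1 - x * Complex.exp (t * Complex.I)‖ ^ 2) := by gcongr
      _ = _ := by ring
  have hpos : ∫⁻ t in Ioc 0 Real.pi, g t ≤ ENNReal.ofReal ((2 * Real.pi) ^ 2 * (C * (1 - x) ^ (β - 1))) := by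
    calc ∫⁻ t in Ioc 0 Real.pi, g t ≤ ∫⁻ t in Ioi 0, g t :=
          lintegral_mono_set Ioc_subset_Ioi_self
      _ = ENNReal.ofReal ((2 * Real.pi) ^ 2) *
          ∫⁻ t in Ioi 0, ENNReal.ofReal (t ^ β * max t (1 - x) ^ (-2 : ℝ)) := by
        rw [lintegral_const_mul' _ _ ENNReal.ofReal_ne_top]
        congr 1
        refine setLIntegral_congr_fun measurableSet_Ioi fun t ht => ?_
        simp only [abs_of_pos (show 0 < t from ht)]
      _ ≤ _ := by
        rw [ENNReal.ofReal_mul (by positivity)]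
        gcongr
        have := hC (1 - x) hδ
        rwa [show β - 2 + 1 = β - 1 by ring] at this
  have hneg : ∫⁻ t in Ioc (-Real.pi) 0, g t = ∫⁻ t in Ioc 0 Real.pi, g t := by
    have h1 := (Measure.measurePreserving_neg (volume : Measure ℝ)).setLIntegral_comp_preimage_emb
      (MeasurableEquiv.neg ℝ).measurableEmbedding g (Ico 0 Real.pi)
    have h2 : (Neg.neg : ℝ → ℝ) ⁻¹' (Ico 0 Real.pi) = Ioc (-Real.pi) 0 := by
      ext x; simp only [mem_preimage, mem_Ico, mem_Ioc]; constructor <;> rintro ⟨a, b⟩ <;>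
        constructor <;> linarith
    rw [h2, setLIntegral_congr (Ico_ae_eq_Ioc (a := (0 : ℝ)) (b := Real.pi))] at h1
    rw [← h1]
    simp only [hg, abs_neg]
  calc _ ≤ ∫⁻ t in Ioc (-Real.pi) Real.pi, g t := setLIntegral_mono' measurableSet_Ioc hle
    _ ≤ (∫⁻ t in Ioc (-Real.pi) 0, g t) + ∫⁻ t in Ioc 0 Real.pi, g t := by
      rw [← Ioc_union_Ioc_eq_Ioc (a := -Real.pi) (b := 0) (c := Real.pi)
        (by linarith [Real.pi_pos]) Real.pi_pos.le]
      exact lintegral_union_le _ _ _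
    _ ≤ _ := by
      rw [hneg, ← two_mul, mul_assoc, ENNReal.ofReal_mul (by norm_num), ENNReal.ofReal_ofNat,
        mul_assoc]
      gcongr

/-- Since 1 - ρr ≥ max(1-ρ, 1-r), the substitution x = 1 - ρ reduces this to
`exists_setLIntegral_rpow_max_le` with a = α - 1 and b = 1. The conditions there become exactly 0 <
α < 1. -/
lemma exists_setLIntegral_radial_le {α : ℝ} (hα0 : 0 < α) (hα1 : α < 1) :
    ∃ C : ℝ, 0 ≤ C ∧ ∀ r ∈ Ico (0 : ℝ) 1,
      ∫⁻ ρ in Ioo (0 : ℝ) 1, ENNReal.ofReal ((1 - ρ) ^ (α - 1) * (1 - ρ * r)⁻¹) ≤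
        ENNReal.ofReal (C * (1 - r) ^ (α - 1)) := by
  obtain ⟨C, hC0, hC⟩ := exists_setLIntegral_rpow_max_le (a := α - 1) (b := 1) (by linarith)
    (by linarith)
  refine ⟨C, hC0, fun r hr => ?_⟩
  set g : ℝ → ℝ≥0∞ := fun x => ENNReal.ofReal (x ^ (α - 1) * max x (1 - r) ^ (-1 : ℝ)) with hg
  have hδ : 0 < 1 - r := by linarith [hr.2]
  have h1 := (Measure.measurePreserving_sub_left (volume : Measure ℝ) 1).setLIntegral_comp_preimage_emb
      (MeasurableEquiv.subLeft (1 : ℝ)).measurableEmbedding g (Ioo 0 1)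
  have h2 : (fun x : ℝ => 1 - x) ⁻¹' (Ioo 0 1) = Ioo 0 1 := by
    ext x; simp only [mem_preimage, mem_Ioo]; constructor <;> rintro ⟨a, b⟩ <;>
      constructor <;> linarith
  rw [h2] at h1
  calc _ ≤ ∫⁻ ρ in Ioo (0 : ℝ) 1, g (1 - ρ) := by
        refine setLIntegral_mono' measurableSet_Ioo fun ρ hρ => ENNReal.ofReal_le_ofReal ?_
        have hρ1 := hρ.1
        have hρ2 : 0 < 1 - ρ := by linarith [hρ.2]
        rw [Real.rpow_neg_one]
        gcongr
        refine max_le ?_ ?_ <;> nlinarith [hr.1, hr.2, hρ.2]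
    _ = ∫⁻ x in Ioo 0 1, g x := h1
    _ ≤ ∫⁻ x in Ioi 0, g x := lintegral_mono_set Ioo_subset_Ioi_self
    _ ≤ _ := by
      have := hC (1 - r) hδ
      rwa [show α - 1 - 1 + 1 = α - 1 by ring] at this

/-! ### Analytic functions along radii and circles. -/

lemma norm_mul_exp {r : ℝ} (hr : 0 ≤ r) (θ : ℝ) : ‖(r : ℂ) * Complex.exp (θ * Complex.I)‖ = r := by
  simp [Complex.norm_exp_ofReal_mul_I, abs_of_nonneg hr]

lemma mul_exp_mem_disc {r : ℝ} (hr : 0 ≤ r) (hr1 : r < 1) (θ : ℝ) :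
    (r : ℂ) * Complex.exp (θ * Complex.I) ∈ disc := by
  rw [disc, mem_ball_zero_iff, norm_mul_exp hr]; exact hr1

lemma exp_periodic : Function.Periodic (fun θ : ℝ => Complex.exp (θ * Complex.I))
    (2 * Real.pi) := by
  intro θ
  simp only [Complex.ofReal_add, Complex.ofReal_mul, Complex.ofReal_ofNat]
  rw [add_mul, Complex.exp_add, Complex.exp_two_pi_mul_I, mul_one]

lemma comp_exp_periodic {E : Type*} (F : ℂ → E) (r : ℝ) :
    Function.Periodic (fun θ : ℝ => F (r * Complex.exp (θ * Complex.I))) (2 * Real.pi) := by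
  intro θ
  have := exp_periodic θ
  simp only at this
  simp only [this]

lemma continuousOn_comp_polar {H : ℂ → ℂ} (hH : ContinuousOn H disc) :
    ContinuousOn (fun z : ℝ × ℝ => H (z.2 * Complex.exp (z.1 * Complex.I)))
      (univ ×ˢ Ico 0 1) := by
  refine hH.comp (by fun_prop) ?_
  rintro ⟨θ, t⟩ ⟨-, ht⟩
  exact mul_exp_mem_disc ht.1 ht.2 θ

lemma aestronglyMeasurable_comp_polar {H : ℂ → ℂ} (hH : ContinuousOn H disc) {S : Set ℝ}
    (hS : MeasurableSet S) (hS1 : S ⊆ Ico 0 1) (μ : Measure ℝ) [SFinite μ] :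
    AEStronglyMeasurable (fun z : ℝ × ℝ => H (z.2 * Complex.exp (z.1 * Complex.I)))
      (μ.prod (volume.restrict S)) := by
  rw [← Measure.restrict_univ (μ := μ), Measure.prod_restrict]
  exact ((continuousOn_comp_polar hH).mono (prod_mono le_rfl hS1)).aestronglyMeasurable
    (MeasurableSet.univ.prod hS)

lemma continuous_comp_circle {H : ℂ → ℂ} (hH : ContinuousOn H disc) {r : ℝ} (hr : 0 ≤ r)
    (hr1 : r < 1) : Continuous fun θ : ℝ => H (r * Complex.exp (θ * Complex.I)) := by
  rw [← continuousOn_univ]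
  exact hH.comp (by fun_prop) fun θ _ => mul_exp_mem_disc hr hr1 θ

lemma continuousOn_comp_radius {H : ℂ → ℂ} (hH : ContinuousOn H disc) (θ : ℝ) :
    ContinuousOn (fun t : ℝ => H (t * Complex.exp (θ * Complex.I))) (Ico 0 1) :=
  hH.comp (by fun_prop) fun _ ht => mul_exp_mem_disc ht.1 ht.2 θ

lemma isOpen_disc : IsOpen disc := Metric.isOpen_ball

lemma differentiableOn_deriv_disc {G : ℂ → ℂ} (hG : DifferentiableOn ℂ G disc) :
    DifferentiableOn ℂ (deriv G) disc := hG.deriv isOpen_disc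

lemma hasDerivAt_radius {G : ℂ → ℂ} (hG : DifferentiableOn ℂ G disc) (θ : ℝ) {t : ℝ}
    (ht : t ∈ Ico (0 : ℝ) 1) :
    HasDerivAt (fun t : ℝ => G (t * Complex.exp (θ * Complex.I)))
      (deriv G (t * Complex.exp (θ * Complex.I)) * Complex.exp (θ * Complex.I)) t := by
  have h1 : HasDerivAt G (deriv G (t * Complex.exp (θ * Complex.I)))
      (t * Complex.exp (θ * Complex.I)) :=
    (hG.differentiableAt (isOpen_disc.mem_nhds (mul_exp_mem_disc ht.1 ht.2 θ))).hasDerivAt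
  have h2 : HasDerivAt (fun t : ℝ => (t : ℂ) * Complex.exp (θ * Complex.I))
      (Complex.exp (θ * Complex.I)) t := by
    simpa using (Complex.ofRealCLM.hasDerivAt (x := t)).mul_const (Complex.exp (θ * Complex.I))
  exact h1.comp t h2

lemma hasDerivAt_circle {G : ℂ → ℂ} (hG : DifferentiableOn ℂ G disc) {r : ℝ} (hr : 0 ≤ r)
    (hr1 : r < 1) (θ : ℝ) :
    HasDerivAt (fun θ : ℝ => G (r * Complex.exp (θ * Complex.I)))
      (deriv G (r * Complex.exp (θ * Complex.I)) *
        (r * Complex.exp (θ * Complex.I) * Complex.I)) θ := by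
  have h1 : HasDerivAt G (deriv G (r * Complex.exp (θ * Complex.I)))
      (r * Complex.exp (θ * Complex.I)) :=
    (hG.differentiableAt (isOpen_disc.mem_nhds (mul_exp_mem_disc hr hr1 θ))).hasDerivAt
  have h2 : HasDerivAt (fun θ : ℝ => (r : ℂ) * Complex.exp (θ * Complex.I))
      (r * Complex.exp (θ * Complex.I) * Complex.I) θ := by
    have h3 := ((Complex.ofRealCLM.hasDerivAt (x := θ)).mul_const Complex.I).cexp.const_mul (r : ℂ)
    simpa [mul_assoc] using h3
  exact h1.comp θ h2

lemma enorm_radial_sub_le {G : ℂ → ℂ} (hG : DifferentiableOn ℂ G disc) (θ : ℝ) {ρ r : ℝ}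
    (hρ : 0 ≤ ρ) (hρr : ρ ≤ r) (hr : r < 1) :
    ‖G (r * Complex.exp (θ * Complex.I)) - G (ρ * Complex.exp (θ * Complex.I))‖ₑ ≤
      ∫⁻ t in Ioc ρ r, ‖deriv G (t * Complex.exp (θ * Complex.I))‖ₑ := by
  have hsub : uIcc ρ r ⊆ Ico 0 1 := by
    rw [uIcc_of_le hρr]; exact fun t ht => ⟨hρ.trans ht.1, ht.2.trans_lt hr⟩
  have hc : ContinuousOn (fun t : ℝ => deriv G (t * Complex.exp (θ * Complex.I)) *
      Complex.exp (θ * Complex.I)) (uIcc ρ r) :=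
    ((continuousOn_comp_radius (differentiableOn_deriv_disc hG).continuousOn θ).mono hsub).mul
      continuousOn_const
  rw [← intervalIntegral.integral_eq_sub_of_hasDerivAt
    (fun t ht => hasDerivAt_radius hG θ (hsub ht)) hc.intervalIntegrable,
    intervalIntegral.integral_of_le hρr]
  refine (enorm_integral_le_lintegral_enorm _).trans (le_of_eq ?_)
  refine lintegral_congr fun t => ?_
  rw [enorm_mul, ← ofReal_norm (Complex.exp _), Complex.norm_exp_ofReal_mul_I]
  simp

lemma enorm_circle_sub_le {G : ℂ → ℂ} (hG : DifferentiableOn ℂ G disc) {r : ℝ} (hr : 0 ≤ r)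
    (hr1 : r < 1) (θ : ℝ) {h : ℝ} (hh : 0 ≤ h) :
    ‖G (r * Complex.exp ((θ + h : ℝ) * Complex.I)) - G (r * Complex.exp (θ * Complex.I))‖ₑ ≤
      ∫⁻ τ in Ioc 0 h, ‖deriv G (r * Complex.exp ((θ + τ : ℝ) * Complex.I))‖ₑ := by
  have hc : Continuous (fun τ : ℝ => deriv G (r * Complex.exp ((θ + τ : ℝ) * Complex.I)) *
      (r * Complex.exp ((θ + τ : ℝ) * Complex.I) * Complex.I)) :=
    ((continuous_comp_circle (differentiableOn_deriv_disc hG).continuousOn hr hr1).comp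
      (continuous_const.add continuous_id)).mul (by fun_prop)
  have hd : ∀ τ : ℝ, HasDerivAt (fun τ : ℝ => G (r * Complex.exp ((θ + τ : ℝ) * Complex.I)))
      (deriv G (r * Complex.exp ((θ + τ : ℝ) * Complex.I)) *
      (r * Complex.exp ((θ + τ : ℝ) * Complex.I) * Complex.I)) τ := fun τ =>
    (hasDerivAt_circle hG hr hr1 (θ + τ)).comp_const_add θ τ
  have := intervalIntegral.integral_eq_sub_of_hasDerivAt (a := 0) (b := h)
    (fun t _ => hd t) (hc.intervalIntegrable _ _)
  simp only [add_zero] at this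
  rw [← this, intervalIntegral.integral_of_le hh]
  refine (enorm_integral_le_lintegral_enorm _).trans (lintegral_mono fun t => ?_)
  rw [enorm_mul]
  refine mul_le_of_le_one_right' ?_
  rw [← ofReal_norm, norm_mul, norm_mul_exp hr]
  simpa using hr1.le

/-! ### Hardy–Littlewood: from growth of the derivative to Lipschitz boundary values. -/

/-- Minkowski applied to the integral of the derivative along radii. The function `v` is left free
so that the bound covers both an interior circle and the boundary function. -/
lemma eLpNorm_radial_sub_le {s : ℝ≥0∞} (hs : 1 ≤ s) {G : ℂ → ℂ} (hG : DifferentiableOn ℂ G disc)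
    {N : ℝ → ℝ≥0∞} (hN : Measurable N) (hN0 : ∀ t ∈ Ico (0 : ℝ) 1, N t ≠ 0)
    (hGN : ∀ t ∈ Ico (0 : ℝ) 1, integralMean s t (deriv G) ≤ N t) {ρ : ℝ} (hρ : 0 ≤ ρ)
    {v : ℝ → ℂ}
    (hv : ∀ᵐ θ ∂angleMeasure, ‖v θ - G (ρ * Complex.exp (θ * Complex.I))‖ₑ ≤
      ∫⁻ t in Ico ρ 1, ‖deriv G (t * Complex.exp (θ * Complex.I))‖ₑ) :
    eLpNorm (fun θ : ℝ => v θ - G (ρ * Complex.exp (θ * Complex.I))) s angleMeasure ≤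
      ∫⁻ t in Ico ρ 1, N t := by
  have hsub : Ico ρ 1 ⊆ Ico 0 1 := Ico_subset_Ico_left hρ
  refine eLpNorm_le_lintegral hs
    (G := fun θ t : ℝ => deriv G (t * Complex.exp (θ * Complex.I)))
    (aestronglyMeasurable_comp_polar (differentiableOn_deriv_disc hG).continuousOn
      measurableSet_Ico hsub _) hN.aemeasurable ?_ ?_ hv
  · filter_upwards [ae_restrict_mem measurableSet_Ico] with t ht using hN0 t (hsub ht)
  · filter_upwards [ae_restrict_mem measurableSet_Ico] with t ht using hGN t (hsub ht)

lemma integralMean_const (s : ℝ≥0∞) (hs : s ≠ 0) (c : ℂ) :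
    eLpNorm (fun _ : ℝ => c) s angleMeasure = ‖c‖ₑ := by
  rw [eLpNorm_const _ hs (IsProbabilityMeasure.ne_zero _)]
  simp

/-- An analytic function whose derivative has integrable integral means is in the Hardy space. -/
lemma memHardy_of_integralMean_deriv_le {s : ℝ≥0∞} (hs : 1 ≤ s) {G : ℂ → ℂ}
    (hG : DifferentiableOn ℂ G disc) {N : ℝ → ℝ≥0∞} (hN : Measurable N)
    (hN0 : ∀ t ∈ Ico (0 : ℝ) 1, N t ≠ 0)
    (hGN : ∀ t ∈ Ico (0 : ℝ) 1, integralMean s t (deriv G) ≤ N t)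
    (hfin : ∫⁻ t in Ico (0 : ℝ) 1, N t ≠ ∞) : MemHardy s G := by
  refine ⟨hG, lt_of_le_of_lt (b := (∫⁻ t in Ico (0 : ℝ) 1, N t) + ‖G 0‖ₑ) ?_
    (ENNReal.add_lt_top.2 ⟨hfin.lt_top, by simp⟩)⟩
  refine iSup₂_le fun r hr => ?_
  have h1 : eLpNorm (fun θ : ℝ => G (r * Complex.exp (θ * Complex.I)) -
      G ((0 : ℝ) * Complex.exp (θ * Complex.I))) s angleMeasure ≤ ∫⁻ t in Ico (0 : ℝ) 1, N t := by
    refine eLpNorm_radial_sub_le hs hG hN hN0 hGN le_rfl (v := fun θ : ℝ => G (r * Complex.exp (θ * Complex.I))) (ae_of_all _ fun θ => ?_)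
    refine (enorm_radial_sub_le hG θ le_rfl hr.1 hr.2).trans (lintegral_mono_set ?_)
    exact fun t ht => ⟨ht.1.le, ht.2.trans_lt hr.2⟩
  have h2 : integralMean s r G = eLpNorm ((fun θ : ℝ => G (r * Complex.exp (θ * Complex.I)) -
      G ((0 : ℝ) * Complex.exp (θ * Complex.I))) + fun _ => G 0) s angleMeasure := by
    unfold integralMean
    congr 1
    ext θ
    simp
  rw [h2]
  refine (eLpNorm_add_le ?_ aestronglyMeasurable_const hs).trans ?_
  · exact ((continuous_comp_circle hG.continuousOn hr.1 hr.2).sub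
      (continuous_comp_circle hG.continuousOn le_rfl zero_lt_one)).aestronglyMeasurable
  · rw [integralMean_const s (zero_lt_one.trans_le hs).ne']
    gcongr

/-- A derivative absolutely integrable along the radius has a primitive continuous up to the
endpoint 1. -/
lemma exists_radial_limit {G : ℂ → ℂ} (hG : DifferentiableOn ℂ G disc) {θ : ℝ}
    (hfin : ∫⁻ t in Ico (0 : ℝ) 1, ‖deriv G (t * Complex.exp (θ * Complex.I))‖ₑ ≠ ∞) :
    ∃ l : ℂ, Tendsto (fun r : ℝ => G (r * Complex.exp (θ * Complex.I))) (𝓝[<] 1) (𝓝 l) := by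
  have hc := continuousOn_comp_radius (differentiableOn_deriv_disc hG).continuousOn θ
  have hint : IntegrableOn (fun t : ℝ => deriv G (t * Complex.exp (θ * Complex.I)) *
      Complex.exp (θ * Complex.I)) (Icc 0 1) := by
    rw [integrableOn_Icc_iff_integrableOn_Ico]
    refine Integrable.mul_const ⟨hc.aestronglyMeasurable measurableSet_Ico, ?_⟩ _
    rw [hasFiniteIntegral_iff_enorm]
    exact hfin.lt_top
  have hprim := intervalIntegral.continuousOn_primitive hint
  have h1 := (hprim 1 (right_mem_Icc.2 zero_le_one)).tendsto
  refine ⟨G 0 + ∫ t in Ioc (0 : ℝ) 1, deriv G (t * Complex.exp (θ * Complex.I)) *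
      Complex.exp (θ * Complex.I), ?_⟩
  have h2 : Tendsto (fun r : ℝ => G 0 + ∫ t in Ioc 0 r, deriv G (t * Complex.exp (θ * Complex.I)) *
      Complex.exp (θ * Complex.I)) (𝓝[<] 1) (𝓝 (G 0 + ∫ t in Ioc (0 : ℝ) 1,
        deriv G (t * Complex.exp (θ * Complex.I)) * Complex.exp (θ * Complex.I))) := by
    refine Tendsto.const_add _ (h1.mono_left ?_)
    rw [← nhdsWithin_Ioo_eq_nhdsLT (show (0 : ℝ) < 1 by norm_num)]
    exact nhdsWithin_mono _ Ioo_subset_Icc_self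
  refine h2.congr' ?_
  filter_upwards [Ioo_mem_nhdsLT (show (0 : ℝ) < 1 by norm_num)] with r hr
  have hsub : uIcc 0 r ⊆ Ico 0 1 := by
    rw [uIcc_of_le hr.1.le]; exact fun t ht => ⟨ht.1, ht.2.trans_lt hr.2⟩
  have := intervalIntegral.integral_eq_sub_of_hasDerivAt (a := 0) (b := r)
    (fun t ht => hasDerivAt_radius hG θ (hsub ht))
    (((hc.mono hsub).mul continuousOn_const).intervalIntegrable)
  rw [← intervalIntegral.integral_of_le hr.1.le, this]
  simp

/-- The radial limit function of `G`. -/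
def radialLimit (G : ℂ → ℂ) (ζ : Circle) : ℂ := limUnder (𝓝[<] (1 : ℝ)) fun r : ℝ => G (r * ζ)

lemma tendsto_radialLimit {G : ℂ → ℂ} (hG : DifferentiableOn ℂ G disc) {θ : ℝ}
    (hfin : ∫⁻ t in Ico (0 : ℝ) 1, ‖deriv G (t * Complex.exp (θ * Complex.I))‖ₑ ≠ ∞) :
    Tendsto (fun r : ℝ => G (r * Complex.exp (θ * Complex.I))) (𝓝[<] 1)
      (𝓝 (radialLimit G (Circle.exp θ))) := by
  have := tendsto_nhds_limUnder (exists_radial_limit hG hfin)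
  simpa [radialLimit, Circle.coe_exp] using this

lemma enorm_radialLimit_sub_le {G : ℂ → ℂ} (hG : DifferentiableOn ℂ G disc) {θ : ℝ}
    (hfin : ∫⁻ t in Ico (0 : ℝ) 1, ‖deriv G (t * Complex.exp (θ * Complex.I))‖ₑ ≠ ∞) {ρ : ℝ}
    (hρ : 0 ≤ ρ) (hρ1 : ρ < 1) :
    ‖radialLimit G (Circle.exp θ) - G (ρ * Complex.exp (θ * Complex.I))‖ₑ ≤
      ∫⁻ t in Ico ρ 1, ‖deriv G (t * Complex.exp (θ * Complex.I))‖ₑ := by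
  refine le_of_tendsto (((tendsto_radialLimit hG hfin).sub_const _).enorm) ?_
  filter_upwards [Ioo_mem_nhdsLT hρ1] with r hr
  refine (enorm_radial_sub_le hG θ hρ hr.1.le hr.2).trans (lintegral_mono_set ?_)
  exact fun t ht => ⟨ht.1.le, ht.2.trans_lt hr.2⟩

/-- By Tonelli the angular average of the radial integrals is the integral of the L¹ means, and on a
probability space these are dominated by the means of order s. -/
lemma ae_lintegral_deriv_ne_top {s : ℝ≥0∞} (hs : 1 ≤ s) {G : ℂ → ℂ}
    (hG : DifferentiableOn ℂ G disc) {N : ℝ → ℝ≥0∞}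
    (hGN : ∀ t ∈ Ico (0 : ℝ) 1, integralMean s t (deriv G) ≤ N t)
    (hfin : ∫⁻ t in Ico (0 : ℝ) 1, N t ≠ ∞) :
    ∀ᵐ θ : ℝ ∂angleMeasure,
      ∫⁻ t in Ico (0 : ℝ) 1, ‖deriv G (t * Complex.exp (θ * Complex.I))‖ₑ ≠ ∞ := by
  have hG' := (differentiableOn_deriv_disc hG).continuousOn
  have hm := (aestronglyMeasurable_comp_polar hG' measurableSet_Ico le_rfl angleMeasure).enorm
  have key : ∫⁻ θ : ℝ, (∫⁻ t in Ico (0 : ℝ) 1, ‖deriv G (t * Complex.exp (θ * Complex.I))‖ₑ)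
      ∂angleMeasure ≤ ∫⁻ t in Ico (0 : ℝ) 1, N t := by
    rw [lintegral_lintegral_swap hm]
    refine setLIntegral_mono' measurableSet_Ico fun t ht => ?_
    refine le_trans ?_ (hGN t ht)
    rw [← eLpNorm_one_eq_lintegral_enorm]
    exact eLpNorm_le_eLpNorm_of_exponent_le hs
      (continuous_comp_circle hG' ht.1 ht.2).aestronglyMeasurable
  exact (ae_lt_top' hm.lintegral_prod_right' (key.trans_lt hfin.lt_top).ne).mono
    fun θ h => h.ne

/-- By periodicity the bound holds almost everywhere on the line, hence on a dense set; by
continuity that set is closed. For s = ∞ the Lipschitz condition concerns every point, so an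
almost-everywhere bound would not be enough. -/
lemma enorm_le_of_eLpNorm_top_le {g : ℝ → ℂ} (hg : Continuous g)
    (hper : Function.Periodic g (2 * Real.pi)) {c : ℝ≥0∞} (hc : eLpNorm g ∞ angleMeasure ≤ c)
    (θ : ℝ) : ‖g θ‖ₑ ≤ c := by
  rw [eLpNorm_exponent_top] at hc
  have h1 : ∀ᵐ θ ∂angleMeasure, ‖g θ‖ₑ ≤ c :=
    (ae_le_eLpNormEssSup (f := g)).mono fun x hx => hx.trans hc
  rw [ae_angleMeasure_iff (fun θ => by rw [hper θ])] at h1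
  have hd : Dense {θ | ‖g θ‖ₑ ≤ c} := Measure.dense_of_ae h1
  have hcl : IsClosed {θ | ‖g θ‖ₑ ≤ c} := isClosed_le hg.enorm continuous_const
  have := hcl.closure_eq ▸ hd.closure_eq
  exact (this.symm ▸ mem_univ θ : θ ∈ {θ | ‖g θ‖ₑ ≤ c})

lemma setLIntegral_tail_le {α : ℝ} (hα0 : 0 < α) {C : ℝ} (hC : 0 ≤ C) {h : ℝ} (hh : 0 ≤ h) :
    ∫⁻ t in Ico (1 - h) 1, ENNReal.ofReal (C * (1 - t) ^ (α - 1)) ≤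
      ENNReal.ofReal (C * h ^ α / α) := by
  have hi : IntervalIntegrable (fun x : ℝ => x ^ (α - 1)) volume 0 h :=
    intervalIntegral.intervalIntegrable_rpow' (by linarith)
  have hi2 := (hi.comp_sub_left 1).const_mul C
  simp only [sub_zero] at hi2
  have hi3 : IntegrableOn (fun t : ℝ => C * (1 - t) ^ (α - 1)) (Ico (1 - h) 1) := by
    rw [← integrableOn_Icc_iff_integrableOn_Ico, integrableOn_Icc_iff_integrableOn_Ioc]
    exact hi2.symm.1
  rw [← ofReal_integral_eq_lintegral_ofReal hi3]
  · refine ENNReal.ofReal_le_ofReal (le_of_eq ?_)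
    rw [← integral_Icc_eq_integral_Ico, integral_Icc_eq_integral_Ioc,
      ← intervalIntegral.integral_of_le (by linarith),
      intervalIntegral.integral_const_mul,
      intervalIntegral.integral_comp_sub_left (fun x : ℝ => x ^ (α - 1)) 1,
      integral_rpow (Or.inl (by linarith))]
    simp only [sub_self, sub_sub_cancel, sub_add_cancel]
    rw [Real.zero_rpow hα0.ne']; ring
  · filter_upwards [ae_restrict_mem measurableSet_Ico] with t ht
    have : 0 ≤ 1 - t := by linarith [ht.2]
    simp only [Pi.zero_apply]; positivity

lemma angleMeasure_absolutelyContinuous : angleMeasure ≪ volume :=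
  (Measure.smul_absolutelyContinuous).trans Measure.restrict_le_self.absolutelyContinuous

lemma ae_angleMeasure_of_ae {P : ℝ → Prop} (h : ∀ᵐ θ : ℝ, P θ) : ∀ᵐ θ ∂angleMeasure, P θ :=
  angleMeasure_absolutelyContinuous.ae_le h

lemma comp_circleExp_periodic {E : Type*} (u : Circle → E) :
    Function.Periodic (fun θ : ℝ => u (Circle.exp θ)) (2 * Real.pi) := by
  intro θ
  simp only [Circle.periodic_exp θ]

lemma IsBoundaryFunction.aestronglyMeasurable {F : ℂ → ℂ} (hF : ContinuousOn F disc)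
    {u : Circle → ℂ} (hu : IsBoundaryFunction F u) :
    AEStronglyMeasurable (fun θ : ℝ => u (Circle.exp θ)) := by
  have ht : Tendsto (fun n : ℕ => 1 - 1 / ((n : ℝ) + 1)) atTop (𝓝[<] 1) := by
    refine tendsto_nhdsWithin_iff.2 ⟨?_, Eventually.of_forall fun n => ?_⟩
    · simpa using (tendsto_one_div_add_atTop_nhds_zero_nat (𝕜 := ℝ)).const_sub 1
    · have : 0 < 1 / ((n : ℝ) + 1) := by positivity
      simp only [mem_Iio]; linarith
  refine aestronglyMeasurable_of_tendsto_ae atTop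
    (f := fun (n : ℕ) (θ : ℝ) => F ((1 - 1 / ((n : ℝ) + 1) : ℝ) * Complex.exp (θ * Complex.I)))
    (fun n => ?_) ?_
  · have h1 : 0 < 1 / ((n : ℝ) + 1) := by positivity
    have h2 : 1 / ((n : ℝ) + 1) ≤ 1 := by
      rw [div_le_one (by positivity)]; linarith [n.cast_nonneg (α := ℝ)]
    exact (continuous_comp_circle hF (by linarith) (by linarith)).aestronglyMeasurable
  · filter_upwards [hu] with θ hθ using hθ.comp ht

lemma eLpNorm_circle_sub_le {s : ℝ≥0∞} (hs : 1 ≤ s) {G : ℂ → ℂ} (hG : DifferentiableOn ℂ G disc)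
    {r : ℝ} (hr : 0 ≤ r) (hr1 : r < 1) {h : ℝ} (hh : 0 ≤ h) {N : ℝ≥0∞} (hN : N ≠ 0)
    (hGN : integralMean s r (deriv G) ≤ N) :
    eLpNorm (fun θ : ℝ => G (r * Complex.exp ((θ + h : ℝ) * Complex.I)) -
      G (r * Complex.exp (θ * Complex.I))) s angleMeasure ≤ N * ENNReal.ofReal h := by
  have hG' := (differentiableOn_deriv_disc hG).continuousOn
  have hc := continuous_comp_circle hG' hr hr1
  have key := eLpNorm_le_lintegral hs (μ := angleMeasure) (ν := volume.restrict (Ioc 0 h))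
    (f := fun θ : ℝ => G (r * Complex.exp ((θ + h : ℝ) * Complex.I)) -
      G (r * Complex.exp (θ * Complex.I)))
    (G := fun θ τ : ℝ => deriv G (r * Complex.exp ((θ + τ : ℝ) * Complex.I)))
    (N := fun _ => N) (hc.comp (continuous_fst.add continuous_snd)).aestronglyMeasurable
    aemeasurable_const (ae_of_all _ fun _ => hN) (ae_of_all _ fun τ => ?_)
    (ae_of_all _ fun θ => enorm_circle_sub_le hG hr hr1 θ hh)
  · simpa using key
  · rw [eLpNorm_angleMeasure_add (G := fun θ : ℝ => deriv G (r * Complex.exp (θ * Complex.I)))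
      (comp_exp_periodic _ _)]
    exact hGN

/-- Arc length is at most 2π times the chord (`max_le_norm_one_sub` at x = 1), and any two points of
the circle are joined by an arc of length at most π. Angular steps h ≥ 1 lie outside the hypothesis
and are absorbed by the sup bound M. -/
lemma memLipschitz_of_angle {α : ℝ} (hα0 : 0 < α) {u : Circle → ℂ} {K M : ℝ} (hK : 0 ≤ K)
    (hM : ∀ θ : ℝ, ‖u (Circle.exp θ)‖ ≤ M)
    (hu : ∀ θ h : ℝ, 0 < h → h < 1 →
      ‖u (Circle.exp (θ + h)) - u (Circle.exp θ)‖ ≤ K * h ^ α) : MemLipschitz α u := by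
  have hM0 : 0 ≤ M := (norm_nonneg _).trans (hM 0)
  have key : ∀ θ δ : ℝ, 0 ≤ δ → δ ≤ Real.pi → ‖u (Circle.exp (θ + δ)) - u (Circle.exp θ)‖ ≤
      (K + 2 * M) * (2 * Real.pi) ^ α *
        ‖(Circle.exp (θ + δ) : ℂ) - (Circle.exp θ : ℂ)‖ ^ α := by
    intro θ δ h0 hpi
    have h1 : ‖u (Circle.exp (θ + δ)) - u (Circle.exp θ)‖ ≤ (K + 2 * M) * δ ^ α := by
      rcases h0.eq_or_lt with rfl | h0
      · simp [Real.zero_rpow hα0.ne']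
      rcases lt_or_ge δ 1 with h | h
      · refine (hu θ δ h0 h).trans ?_
        gcongr; linarith
      · have h2 : 1 ≤ δ ^ α := Real.one_le_rpow h hα0.le
        have h3 := norm_sub_le (u (Circle.exp (θ + δ))) (u (Circle.exp θ))
        have h4 := hM (θ + δ)
        have h5 := hM θ
        nlinarith
    have h2 : δ ≤ 2 * Real.pi * ‖(Circle.exp (θ + δ) : ℂ) - (Circle.exp θ : ℂ)‖ := by
      have h3 := max_le_norm_one_sub (x := 1) (t := δ) zero_le_one le_rfl
        (by rwa [abs_of_nonneg h0])
      have h4 : ‖(Circle.exp (θ + δ) : ℂ) - (Circle.exp θ : ℂ)‖ =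
          ‖1 - ((1 : ℝ) : ℂ) * Complex.exp (δ * Complex.I)‖ := by
        rw [Circle.exp_add, Circle.coe_mul, Circle.coe_exp δ, norm_sub_rev]
        rw [show ((Circle.exp θ : ℂ)) - Circle.exp θ * Complex.exp (δ * Complex.I) =
          Circle.exp θ * (1 - ((1 : ℝ) : ℂ) * Complex.exp (δ * Complex.I)) by push_cast; ring,
          norm_mul, Circle.norm_coe, one_mul]
      rw [h4]
      exact (le_abs_self δ).trans ((le_max_left _ _).trans h3)
    refine h1.trans ?_
    rw [mul_assoc, ← Real.mul_rpow (by positivity) (norm_nonneg _)]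
    gcongr
  refine ⟨(K + 2 * M) * (2 * Real.pi) ^ α, fun x y => ?_⟩
  have hex : ∀ z : Circle, Circle.exp (Complex.arg z) = z := Circle.exp_arg
  set δ := Complex.arg ((y / x : Circle) : ℂ) with hδ
  have hy : y = Circle.exp (Complex.arg x + δ) := by
    rw [Circle.exp_add, hex, hex]; exact (mul_div_cancel x y).symm
  rcases le_total 0 δ with h | h
  · have := key (Complex.arg x) δ h (Complex.arg_le_pi _)
    rw [← hy, hex] at this
    rwa [norm_sub_rev, norm_sub_rev (x : ℂ)]
  · have := key (Complex.arg x + δ) (-δ) (by linarith)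
      (by linarith [Complex.neg_pi_lt_arg ((y / x : Circle) : ℂ)])
    rwa [add_neg_cancel_right, ← hy, hex] at this

/-- **Hardy–Littlewood**: growth of the integral means of the derivative gives Lipschitz boundary
values. -/
theorem memHardy_and_lipschitz_of_integralMean_deriv_le {α : ℝ} (hα0 : 0 < α) {s : ℝ≥0∞}
    (hs : 1 ≤ s) {G : ℂ → ℂ} (hG : DifferentiableOn ℂ G disc) {C : ℝ} (hC : 0 < C)
    (hGN : ∀ t ∈ Ico (0 : ℝ) 1,
      integralMean s t (deriv G) ≤ ENNReal.ofReal (C * (1 - t) ^ (α - 1))) :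
    MemHardy s G ∧ BoundaryValuesInLipschitz α s G := by
  set N : ℝ → ℝ≥0∞ := fun t => ENNReal.ofReal (C * (1 - t) ^ (α - 1)) with hNdef
  have hN : Measurable N := by fun_prop
  have hN0 : ∀ t ∈ Ico (0 : ℝ) 1, N t ≠ 0 := by
    intro t ht
    have : 0 < 1 - t := by linarith [ht.2]
    exact (ENNReal.ofReal_pos.2 (by positivity)).ne'
  have hfin : ∫⁻ t in Ico (0 : ℝ) 1, N t ≠ ∞ := by
    have := setLIntegral_tail_le hα0 hC.le zero_le_one
    rw [sub_self] at this
    exact (this.trans_lt ENNReal.ofReal_lt_top).ne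
  have hG' := (differentiableOn_deriv_disc hG).continuousOn
  have hae := ae_lintegral_deriv_ne_top hs hG hGN hfin
  have hbd : IsBoundaryFunction G (radialLimit G) := by
    have h := hae
    rw [ae_angleMeasure_iff] at h
    · filter_upwards [h] with θ hθ using tendsto_radialLimit hG hθ
    · intro θ
      have : ∀ t : ℝ, deriv G (t * Complex.exp ((θ + 2 * Real.pi : ℝ) * Complex.I)) =
        deriv G (t * Complex.exp (θ * Complex.I)) := fun t => comp_exp_periodic (deriv G) t θ
      simp only [this]
  refine ⟨memHardy_of_integralMean_deriv_le hs hG hN hN0 hGN hfin, radialLimit G, hbd, ?_⟩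
  rcases eq_or_ne s ∞ with rfl | hsfin
  · refine Or.inl ⟨rfl, ?_⟩
    have hpt : ∀ t ∈ Ico (0 : ℝ) 1, ∀ θ : ℝ, ‖deriv G (t * Complex.exp (θ * Complex.I))‖ₑ ≤ N t :=
      fun t ht θ => enorm_le_of_eLpNorm_top_le (continuous_comp_circle hG' ht.1 ht.2)
        (comp_exp_periodic _ _) (hGN t ht) θ
    have hle : ∀ ρ : ℝ, 0 ≤ ρ → ∀ θ : ℝ,
        ∫⁻ t in Ico ρ 1, ‖deriv G (t * Complex.exp (θ * Complex.I))‖ₑ ≤ ∫⁻ t in Ico ρ 1, N t :=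
      fun ρ hρ θ => setLIntegral_mono hN fun t ht => hpt t ⟨hρ.trans ht.1, ht.2⟩ θ
    have hfinθ : ∀ θ : ℝ, ∫⁻ t in Ico (0 : ℝ) 1, ‖deriv G (t * Complex.exp (θ * Complex.I))‖ₑ ≠ ∞ :=
      fun θ => ((hle 0 le_rfl θ).trans_lt hfin.lt_top).ne
    -- Compare the boundary values at θ and θ + h along a three-leg path: in to radius 1 - h, along
    -- that circle through the angle h, and back out. Each leg costs O(h^α).
    have hA : ∀ h : ℝ, 0 < h → h ≤ 1 → ∀ θ : ℝ, ‖radialLimit G (Circle.exp θ) -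
        G ((1 - h : ℝ) * Complex.exp (θ * Complex.I))‖ ≤ C * h ^ α / α := by
      intro h h0 h1 θ
      have := (enorm_radialLimit_sub_le hG (hfinθ θ) (ρ := 1 - h) (by linarith) (by linarith)).trans
        ((hle (1 - h) (by linarith) θ).trans (setLIntegral_tail_le hα0 hC.le h0.le))
      rwa [← ofReal_norm, ENNReal.ofReal_le_ofReal_iff (by positivity)] at this
    have hB : ∀ h : ℝ, 0 < h → h ≤ 1 → ∀ θ : ℝ,
        ‖G ((1 - h : ℝ) * Complex.exp ((θ + h : ℝ) * Complex.I)) -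
        G ((1 - h : ℝ) * Complex.exp (θ * Complex.I))‖ ≤ C * h ^ α := by
      intro h h0 h1 θ
      have h2 := enorm_circle_sub_le hG (r := 1 - h) (by linarith) (by linarith) θ h0.le
      have h3 : ∫⁻ τ in Ioc 0 h, ‖deriv G ((1 - h : ℝ) * Complex.exp ((θ + τ : ℝ) * Complex.I))‖ₑ ≤
          ENNReal.ofReal (C * h ^ α) := by
        calc _ ≤ ∫⁻ τ in Ioc 0 h, N (1 - h) :=
              lintegral_mono fun τ => hpt (1 - h) ⟨by linarith, by linarith⟩ _
          _ = N (1 - h) * ENNReal.ofReal h := by simp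
          _ = ENNReal.ofReal (C * h ^ α) := by
              rw [hNdef]; simp only
              rw [sub_sub_cancel, ← ENNReal.ofReal_mul (by positivity), mul_assoc,
                Real.rpow_sub_one h0.ne', div_mul_cancel₀ _ h0.ne']
      have h4 := h2.trans h3
      rwa [← ofReal_norm, ENNReal.ofReal_le_ofReal_iff (by positivity)] at h4
    refine memLipschitz_of_angle hα0 (K := 2 * (C / α) + C) (M := C / α + ‖G 0‖)
      (by positivity) (fun θ => ?_) fun θ h h0 h1 => ?_
    -- Taking h = 1 compares the boundary value with G(0) and bounds it uniformly.
    · have h1 := hA 1 one_pos le_rfl θ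
      simp only [sub_self, Complex.ofReal_zero, zero_mul, Real.one_rpow, mul_one] at h1
      have h2 := norm_le_norm_add_norm_sub (G 0) (radialLimit G (Circle.exp θ))
      rw [norm_sub_rev] at h2
      linarith
    · have e1 := hA h h0 h1.le (θ + h)
      have e2 := hA h h0 h1.le θ
      have e3 := hB h h0 h1.le θ
      rw [norm_sub_rev] at e2
      have e4 := norm_add₃_le (a := radialLimit G (Circle.exp (θ + h)) -
        G ((1 - h : ℝ) * Complex.exp ((θ + h : ℝ) * Complex.I)))
        (b := G ((1 - h : ℝ) * Complex.exp ((θ + h : ℝ) * Complex.I)) -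
        G ((1 - h : ℝ) * Complex.exp (θ * Complex.I)))
        (c := G ((1 - h : ℝ) * Complex.exp (θ * Complex.I)) - radialLimit G (Circle.exp θ))
      rw [sub_add_sub_cancel, sub_add_sub_cancel] at e4
      refine e4.trans (le_trans (add_le_add (add_le_add e1 e3) e2) (le_of_eq ?_))
      ring
  · refine Or.inr ⟨hsfin, ?_⟩
    have hum := hbd.aestronglyMeasurable hG.continuousOn
    have humμ := hum.mono_ac angleMeasure_absolutelyContinuous
    have hA : ∀ h : ℝ, 0 < h → h ≤ 1 → eLpNorm (fun θ : ℝ => radialLimit G (Circle.exp θ) -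
        G ((1 - h : ℝ) * Complex.exp (θ * Complex.I))) s angleMeasure ≤
        ENNReal.ofReal (C * h ^ α / α) := by
      intro h h0 h1
      refine le_trans (eLpNorm_radial_sub_le hs hG hN hN0 hGN (by linarith)
        (v := fun θ => radialLimit G (Circle.exp θ)) ?_) (setLIntegral_tail_le hα0 hC.le h0.le)
      filter_upwards [hae] with θ hθ
      exact enorm_radialLimit_sub_le hG hθ (by linarith) (by linarith)
    refine ⟨⟨humμ, ?_⟩, (2 * (C / α) + C).toNNReal, ?_⟩
    · have h1 := hA 1 one_pos le_rfl
      have h2 : (fun θ : ℝ => radialLimit G (Circle.exp θ)) =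
          (fun θ : ℝ => radialLimit G (Circle.exp θ) -
            G ((1 - 1 : ℝ) * Complex.exp (θ * Complex.I))) + fun _ => G 0 := by
        ext θ; simp
      rw [h2]
      refine (eLpNorm_add_le ?_ aestronglyMeasurable_const hs).trans_lt ?_
      · have h3 : AEStronglyMeasurable (fun θ : ℝ => radialLimit G (Circle.exp θ) - G 0)
            angleMeasure := humμ.sub aestronglyMeasurable_const
        simpa using h3
      · rw [integralMean_const s (zero_lt_one.trans_le hs).ne']
        exact ENNReal.add_lt_top.2 ⟨by simpa using h1.trans_lt ENNReal.ofReal_lt_top, by simp⟩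
    · filter_upwards [Ioo_mem_nhdsGT (show (0 : ℝ) < 1 by norm_num)] with t ht
      refine iSup₂_le fun h hh => ?_
      have h1 : h < 1 := hh.2.trans_lt ht.2
      have h0 : 0 < h := hh.1
      have hr0 : 0 ≤ 1 - h := by linarith
      have hr1 : 1 - h < 1 := by linarith
      have hcr := continuous_comp_circle hG.continuousOn hr0 hr1
      set A : ℝ → ℂ := fun θ => radialLimit G (Circle.exp θ) -
        G ((1 - h : ℝ) * Complex.exp (θ * Complex.I)) with hAdef
      have hAper : Function.Periodic A (2 * Real.pi) := by
        intro θ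
        simp only [hAdef]
        exact congrArg₂ (· - ·) (comp_circleExp_periodic (radialLimit G) θ)
          (comp_exp_periodic G (1 - h) θ)
      have hAm : AEStronglyMeasurable A := hum.sub hcr.aestronglyMeasurable
      have hAm' : AEStronglyMeasurable (fun θ => A (θ + h)) :=
        hAm.comp_measurePreserving (measurePreserving_add_right volume h)
      set B : ℝ → ℂ := fun θ => G ((1 - h : ℝ) * Complex.exp ((θ + h : ℝ) * Complex.I)) -
        G ((1 - h : ℝ) * Complex.exp (θ * Complex.I)) with hBdef
      have hBm : AEStronglyMeasurable B :=
        ((hcr.comp (continuous_add_const h)).sub hcr).aestronglyMeasurable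
      have hBle : eLpNorm B s angleMeasure ≤ ENNReal.ofReal (C * h ^ α) := by
        refine (eLpNorm_circle_sub_le hs hG hr0 hr1 h0.le (hN0 _ ⟨hr0, hr1⟩)
          (hGN _ ⟨hr0, hr1⟩)).trans (le_of_eq ?_)
        simp only [hNdef]
        rw [sub_sub_cancel, ← ENNReal.ofReal_mul (by positivity), mul_assoc,
          Real.rpow_sub_one h0.ne', div_mul_cancel₀ _ h0.ne']
      -- The same three legs in L^s. The two radial legs have equal norm by translation invariance.
      have heq : (fun x : ℝ => radialLimit G (Circle.exp (x + h)) - radialLimit G (Circle.exp x)) =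
          ((fun θ => A (θ + h)) + B) - A := by
        ext θ
        simp only [hAdef, hBdef, Pi.add_apply, Pi.sub_apply]
        ring
      have hac := angleMeasure_absolutelyContinuous
      rw [heq]
      have hA1 : eLpNorm A s angleMeasure ≤ ENNReal.ofReal (C * h ^ α / α) := hA h h0 h1.le
      calc _ ≤ eLpNorm ((fun θ => A (θ + h)) + B) s angleMeasure + eLpNorm A s angleMeasure :=
            eLpNorm_sub_le ((hAm'.mono_ac hac).add (hBm.mono_ac hac)) (hAm.mono_ac hac) hs
        _ ≤ eLpNorm (fun θ => A (θ + h)) s angleMeasure + eLpNorm B s angleMeasure +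
              eLpNorm A s angleMeasure := by
            gcongr
            exact eLpNorm_add_le (hAm'.mono_ac hac) (hBm.mono_ac hac) hs
        _ ≤ ENNReal.ofReal (C * h ^ α / α) + ENNReal.ofReal (C * h ^ α) +
              ENNReal.ofReal (C * h ^ α / α) := by
            rw [eLpNorm_angleMeasure_add hAper]
            gcongr
        _ = ENNReal.ofReal ((2 * (C / α) + C) * h ^ α) := by
            rw [← ENNReal.ofReal_add (by positivity) (by positivity),
              ← ENNReal.ofReal_add (by positivity) (by positivity)]
            congr 1; ring
        _ ≤ ENNReal.ofReal ((2 * (C / α) + C) * t ^ α) := by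
            gcongr; exact hh.2
        _ = _ := by
            rw [ENNReal.ofReal_mul (by positivity)]; rfl

/-! ### Hardy–Littlewood: from Lipschitz boundary values to growth of the derivative. -/

/-- Hölder on a set E bounds the L¹ norm there by M μ(E)^{1-1/s}, and s > 1 makes the exponent
positive. -/
lemma unifIntegrable_one_of_eLpNorm_le {X : Type*} [MeasurableSpace X] {μ : Measure X} {s : ℝ≥0∞}
    (hs : 1 < s) {g : ℕ → X → ℂ} (hg : ∀ n, AEStronglyMeasurable (g n) μ) {M : ℝ≥0∞}
    (hM : M ≠ ∞) (hgM : ∀ n, eLpNorm (g n) s μ ≤ M) : UnifIntegrable g 1 μ := by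
  -- For s = ∞ the conventions `∞.toReal = 0` and `1 / 0 = 0` make this exponent 1, as it should be.
  have he : 0 < 1 - 1 / s.toReal := by
    rcases eq_or_ne s ∞ with rfl | htop
    · simp
    · have : 1 < s.toReal := by
        rw [← ENNReal.toReal_one]
        exact (ENNReal.toReal_lt_toReal ENNReal.one_ne_top htop).2 hs
      rw [sub_pos, div_lt_one (by linarith)]
      exact this
  intro ε hε
  set e := 1 - 1 / s.toReal with hedef
  have hM1 : 0 < M.toReal + 1 := by positivity
  refine ⟨(ε / (M.toReal + 1)) ^ (1 / e), by positivity, fun n E hE hEδ => ?_⟩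
  rw [eLpNorm_indicator_eq_eLpNorm_restrict hE]
  have h1 := eLpNorm_le_eLpNorm_mul_rpow_measure_univ (μ := μ.restrict E) hs.le (hg n).restrict
  rw [Measure.restrict_apply_univ, ENNReal.toReal_one, div_one, ← hedef] at h1
  calc _ ≤ _ := h1
    _ ≤ M * (ENNReal.ofReal ((ε / (M.toReal + 1)) ^ (1 / e))) ^ e := by
      gcongr
      exact (eLpNorm_restrict_le _ _ _ _).trans (hgM n)
    _ = ENNReal.ofReal (M.toReal * (ε / (M.toReal + 1))) := by
      rw [ENNReal.ofReal_rpow_of_nonneg (by positivity) he.le, ← Real.rpow_mul (by positivity),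
        one_div_mul_cancel he.ne', Real.rpow_one, ENNReal.ofReal_mul (by positivity),
        ENNReal.ofReal_toReal hM]
    _ ≤ ENNReal.ofReal ε := by
      refine ENNReal.ofReal_le_ofReal ?_
      rw [← mul_div_assoc, div_le_iff₀ hM1]
      nlinarith

/-- Fatou puts the limit in L¹; Vitali's theorem then gives L¹ convergence. This replaces dominated
convergence when passing to the boundary in Cauchy's formula. -/
lemma integrable_and_tendsto_integral_of_eLpNorm_le {X : Type*} [MeasurableSpace X]
    {μ : Measure X} [IsProbabilityMeasure μ] {s : ℝ≥0∞} (hs : 1 < s) {g : ℕ → X → ℂ} {g' : X → ℂ}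
    (hg : ∀ n, AEStronglyMeasurable (g n) μ) {M : ℝ≥0∞} (hM : M ≠ ∞)
    (hgM : ∀ n, eLpNorm (g n) s μ ≤ M)
    (hlim : ∀ᵐ x ∂μ, Tendsto (fun n => g n x) atTop (𝓝 (g' x))) :
    Integrable g' μ ∧ Tendsto (fun n => ∫ x, g n x ∂μ) atTop (𝓝 (∫ x, g' x ∂μ)) := by
  have hg1 : ∀ n, eLpNorm (g n) 1 μ ≤ M := fun n =>
    (eLpNorm_le_eLpNorm_of_exponent_le hs.le (hg n)).trans (hgM n)
  have hg' : MemLp g' 1 μ := by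
    refine ⟨aestronglyMeasurable_of_tendsto_ae _ hg hlim, ?_⟩
    refine (Lp.eLpNorm_lim_le_liminf_eLpNorm hg g' hlim).trans_lt (lt_of_le_of_lt ?_ hM.lt_top)
    refine (liminf_le_liminf (Eventually.of_forall hg1)).trans ?_
    simp
  have hgi : ∀ n, Integrable (g n) μ := fun n =>
    memLp_one_iff_integrable.1 ⟨hg n, (hg1 n).trans_lt hM.lt_top⟩
  refine ⟨memLp_one_iff_integrable.1 hg', ?_⟩
  have h1 := tendsto_Lp_finite_of_tendsto_ae le_rfl ENNReal.one_ne_top hg hg'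
    (unifIntegrable_one_of_eLpNorm_le hs hg hM hgM) hlim
  refine tendsto_integral_of_L1 g' (memLp_one_iff_integrable.1 hg').aestronglyMeasurable
    (Eventually.of_forall hgi) ?_
  simpa only [eLpNorm_one_eq_lintegral_enorm, Pi.sub_apply] using h1

lemma deriv_eq_integral_circle {F : ℂ → ℂ} (hF : DifferentiableOn ℂ F disc) {z : ℂ} {R : ℝ}
    (hzR : ‖z‖ < R) (hR : R < 1) :
    deriv F z = ∫ θ : ℝ, R * Complex.exp (θ * Complex.I) /
      (R * Complex.exp (θ * Complex.I) - z) ^ 2 * F (R * Complex.exp (θ * Complex.I))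
        ∂angleMeasure := by
  have hsub : Metric.closedBall (0 : ℂ) R ⊆ disc := Metric.closedBall_subset_ball hR
  rw [← Complex.two_pi_I_inv_smul_circleIntegral_sub_sq_inv_smul_of_differentiable isOpen_disc
    hsub hF (by simpa using hzR), circleIntegral_def_Icc, integral_angleMeasure,
    integral_Icc_eq_integral_Ioc, ← intervalIntegral.integral_of_le (by positivity), smul_eq_mul,
    ← intervalIntegral.integral_const_mul, ← intervalIntegral.integral_const_mul]
  refine intervalIntegral.integral_congr fun θ _ => ?_
  simp only [deriv_circleMap, circleMap, zero_add, smul_eq_mul]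
  have : (Real.pi : ℂ) ≠ 0 := by exact_mod_cast Real.pi_ne_zero
  field_simp

/-- The function (w - z)^{-2} has a single-valued primitive. The vanishing allows a constant to be
subtracted from the boundary values under the Cauchy integral. -/
lemma integral_cauchyKernel_sq {z : ℂ} :
    ∫ θ : ℝ, Complex.exp (θ * Complex.I) / (Complex.exp (θ * Complex.I) - z) ^ 2
        ∂angleMeasure = 0 := by
  have h := circleIntegral.integral_sub_zpow_of_ne (n := -2) (by norm_num) 0 z 1
  rw [circleIntegral_def_Icc, integral_Icc_eq_integral_Ioc,
    ← intervalIntegral.integral_of_le (by positivity)] at h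
  rw [integral_angleMeasure]
  have h2 : ∫ θ in (0)..(2 * Real.pi), deriv (circleMap 0 1) θ • (circleMap 0 1 θ - z) ^ (-2 : ℤ) =
      Complex.I * ∫ θ in (0)..(2 * Real.pi),
        Complex.exp (θ * Complex.I) / (Complex.exp (θ * Complex.I) - z) ^ 2 := by
    rw [← intervalIntegral.integral_const_mul]
    refine intervalIntegral.integral_congr fun θ _ => ?_
    simp only [deriv_circleMap, circleMap, zero_add, smul_eq_mul, Complex.ofReal_one, one_mul]
    rw [zpow_neg]
    norm_cast
    rw [div_eq_mul_inv]
    ring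
  rw [h2] at h
  have := (mul_eq_zero.1 h).resolve_left Complex.I_ne_zero
  rw [this, mul_zero]

/-- The derivative of a function in `H^s`, `s > 1`, is the Cauchy integral of its boundary values
against the derivative of the Cauchy kernel. -/
lemma deriv_eq_integral_boundary {s : ℝ≥0∞} (hs : 1 < s) {F : ℂ → ℂ} (hF : MemHardy s F)
    {u : Circle → ℂ} (hu : IsBoundaryFunction F u) {z : ℂ} (hz : ‖z‖ < 1) :
    Integrable (fun θ : ℝ => Complex.exp (θ * Complex.I) / (Complex.exp (θ * Complex.I) - z) ^ 2 *
      u (Circle.exp θ)) angleMeasure ∧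
    deriv F z = ∫ θ : ℝ, Complex.exp (θ * Complex.I) / (Complex.exp (θ * Complex.I) - z) ^ 2 *
      u (Circle.exp θ) ∂angleMeasure := by
  obtain ⟨hFd, hFM⟩ := hF
  set M := ⨆ r ∈ Ico (0 : ℝ) 1, integralMean s r F with hMdef
  set d := 1 - ‖z‖ with hd
  have hd0 : 0 < d := by linarith
  have hd1 : d ≤ 1 := by linarith [norm_nonneg z]
  -- The denominator n + 2 gives R n ≥ ‖z‖ + d/2 already at n = 0, so all these circles stay at
  -- distance at least d/2 from z and the kernel is uniformly bounded.
  set R : ℕ → ℝ := fun n => 1 - d / ((n : ℝ) + 2) with hRdef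
  have hR1 : ∀ n, R n < 1 := fun n => by
    have : 0 < d / ((n : ℝ) + 2) := by positivity
    simp only [hRdef]; linarith
  have hR2 : ∀ n, ‖z‖ + d / 2 ≤ R n := fun n => by
    have : d / ((n : ℝ) + 2) ≤ d / 2 := by gcongr; linarith [n.cast_nonneg (α := ℝ)]
    simp only [hRdef]; linarith
  have hR0 : ∀ n, 0 ≤ R n := fun n => by linarith [hR2 n, norm_nonneg z]
  have hRlim : Tendsto R atTop (𝓝 1) := by
    have : Tendsto (fun n : ℕ => d / ((n : ℝ) + 2)) atTop (𝓝 0) :=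
      tendsto_const_nhds.div_atTop (tendsto_natCast_atTop_atTop.atTop_add tendsto_const_nhds)
    simpa using this.const_sub 1
  have hRlim' : Tendsto R atTop (𝓝[<] 1) :=
    tendsto_nhdsWithin_iff.2 ⟨hRlim, Eventually.of_forall hR1⟩
  have hlow : ∀ n (θ : ℝ), d / 2 ≤ ‖R n * Complex.exp (θ * Complex.I) - z‖ := fun n θ => by
    have := norm_sub_norm_le (R n * Complex.exp (θ * Complex.I)) z
    rw [norm_mul_exp (hR0 n)] at this
    linarith [hR2 n]
  have hne : ∀ n (θ : ℝ), R n * Complex.exp (θ * Complex.I) - z ≠ 0 := fun n θ =>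
    norm_pos_iff.1 ((half_pos hd0).trans_le (hlow n θ))
  have hne1 : ∀ θ : ℝ, Complex.exp (θ * Complex.I) - z ≠ 0 := fun θ => by
    have := norm_sub_norm_le (Complex.exp (θ * Complex.I)) z
    rw [Complex.norm_exp_ofReal_mul_I] at this
    exact norm_pos_iff.1 (by linarith)
  set g : ℕ → ℝ → ℂ := fun n θ => R n * Complex.exp (θ * Complex.I) /
      (R n * Complex.exp (θ * Complex.I) - z) ^ 2 * F (R n * Complex.exp (θ * Complex.I)) with hg
  have hgm : ∀ n, AEStronglyMeasurable (g n) angleMeasure := fun n => by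
    refine Continuous.aestronglyMeasurable (Continuous.mul ?_
      (continuous_comp_circle hFd.continuousOn (hR0 n) (hR1 n)))
    exact Continuous.div (by fun_prop) (by fun_prop) fun θ => pow_ne_zero _ (hne n θ)
  have hgM : ∀ n, eLpNorm (g n) s angleMeasure ≤ ENNReal.ofReal (1 / (d / 2) ^ 2) * M := fun n => by
    have h1 : eLpNorm (g n) s angleMeasure ≤
        ENNReal.ofReal (1 / (d / 2) ^ 2) * integralMean s (R n) F := by
      refine eLpNorm_le_mul_eLpNorm_of_ae_le_mul (ae_of_all _ fun θ => ?_) _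
      simp only [hg]
      rw [norm_mul, norm_div, norm_mul_exp (hR0 n), norm_pow]
      gcongr
      · exact (hR1 n).le
      · exact hlow n θ
    refine h1.trans ?_
    gcongr
    exact le_iSup₂_of_le (R n) ⟨hR0 n, hR1 n⟩ le_rfl
  have hlim : ∀ᵐ θ : ℝ ∂angleMeasure, Tendsto (fun n => g n θ) atTop
      (𝓝 (Complex.exp (θ * Complex.I) / (Complex.exp (θ * Complex.I) - z) ^ 2 *
        u (Circle.exp θ))) := by
    filter_upwards [ae_angleMeasure_of_ae hu] with θ hθ
    refine Tendsto.mul ?_ (hθ.comp hRlim')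
    have h1 : Tendsto (fun n => (R n : ℂ) * Complex.exp (θ * Complex.I)) atTop
        (𝓝 (Complex.exp (θ * Complex.I))) := by
      have := ((Complex.continuous_ofReal.tendsto 1).comp hRlim).mul_const
        (Complex.exp (θ * Complex.I))
      simpa using this
    exact h1.div ((h1.sub_const z).pow 2) (pow_ne_zero _ (hne1 θ))
  obtain ⟨hi, ht⟩ := integrable_and_tendsto_integral_of_eLpNorm_le hs hgm
    (ENNReal.mul_ne_top ENNReal.ofReal_ne_top hFM.ne) hgM hlim
  refine ⟨hi, tendsto_nhds_unique (tendsto_const_nhds.congr fun n => ?_) ht⟩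
  exact deriv_eq_integral_circle hFd (by linarith [hR2 n]) (hR1 n)

lemma norm_exp_sub_mul_exp (r φ t : ℝ) :
    ‖Complex.exp ((t + φ : ℝ) * Complex.I) - r * Complex.exp (φ * Complex.I)‖ =
      ‖1 - r * Complex.exp (t * Complex.I)‖ := by
  have h1 : Complex.exp ((t + φ : ℝ) * Complex.I) - r * Complex.exp (φ * Complex.I) =
      Complex.exp ((t + φ : ℝ) * Complex.I) * (1 - r * Complex.exp (-(t * Complex.I))) := by
    rw [mul_sub, mul_one, mul_left_comm, ← Complex.exp_add]
    push_cast
    ring_nf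
  rw [h1, norm_mul, Complex.norm_exp_ofReal_mul_I, one_mul, ← Complex.norm_conj]
  congr 1
  simp [← Complex.exp_conj]

/-- Subtract the constant u(e^{iφ}) in Cauchy's formula and rotate by φ: the modulus of the kernel
then depends only on t, and the data enter through their increments. The factor 1/(2π) ≤ 1 is
discarded. -/
lemma enorm_deriv_le_lintegral_boundary {s : ℝ≥0∞} (hs : 1 < s) {F : ℂ → ℂ} (hF : MemHardy s F)
    {u : Circle → ℂ} (hu : IsBoundaryFunction F u) {r : ℝ} (hr : r ∈ Ico (0 : ℝ) 1) (φ : ℝ) :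
    ‖deriv F (r * Complex.exp (φ * Complex.I))‖ₑ ≤ ∫⁻ t in Ioc (-Real.pi) Real.pi,
      ‖(u (Circle.exp (φ + t)) - u (Circle.exp φ)) *
        ((1 - r * Complex.exp (t * Complex.I)) ^ 2)⁻¹‖ₑ := by
  set z := (r : ℂ) * Complex.exp (φ * Complex.I) with hzdef
  have hz : ‖z‖ < 1 := by rw [hzdef, norm_mul_exp hr.1]; exact hr.2
  obtain ⟨hi, he⟩ := deriv_eq_integral_boundary hs hF hu hz
  have hne1 : ∀ θ : ℝ, Complex.exp (θ * Complex.I) - z ≠ 0 := fun θ => by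
    have := norm_sub_norm_le (Complex.exp (θ * Complex.I)) z
    rw [Complex.norm_exp_ofReal_mul_I] at this
    exact norm_pos_iff.1 (by linarith)
  have hκ : Continuous fun θ : ℝ => Complex.exp (θ * Complex.I) /
      (Complex.exp (θ * Complex.I) - z) ^ 2 :=
    Continuous.div (by fun_prop) (by fun_prop) fun θ => pow_ne_zero _ (hne1 θ)
  have hκi : Integrable (fun θ : ℝ => Complex.exp (θ * Complex.I) /
      (Complex.exp (θ * Complex.I) - z) ^ 2) angleMeasure := by
    refine Integrable.of_bound hκ.aestronglyMeasurable (1 / (1 - ‖z‖) ^ 2) (ae_of_all _ fun θ => ?_)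
    have := norm_sub_norm_le (Complex.exp (θ * Complex.I)) z
    rw [Complex.norm_exp_ofReal_mul_I] at this
    rw [norm_div, Complex.norm_exp_ofReal_mul_I, norm_pow]
    have : 0 < 1 - ‖z‖ := by linarith
    gcongr
  have h1 : deriv F z = ∫ θ : ℝ, Complex.exp (θ * Complex.I) /
      (Complex.exp (θ * Complex.I) - z) ^ 2 * (u (Circle.exp θ) - u (Circle.exp φ))
        ∂angleMeasure := by
    simp only [mul_sub]
    rw [integral_sub hi (hκi.mul_const _), integral_mul_const, integral_cauchyKernel_sq, zero_mul,
      sub_zero, he]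
  rw [h1]
  refine (enorm_integral_le_lintegral_enorm _).trans ?_
  have hper : Function.Periodic (fun θ : ℝ => ‖Complex.exp (θ * Complex.I) /
      (Complex.exp (θ * Complex.I) - z) ^ 2 * (u (Circle.exp θ) - u (Circle.exp φ))‖ₑ)
      (2 * Real.pi) := by
    intro θ
    have e1 := exp_periodic θ
    simp only at e1
    simp only [e1, Circle.periodic_exp θ]
  rw [← lintegral_angleMeasure_add hper φ, lintegral_angleMeasure_eq_symm]
  · have hle : (ENNReal.ofReal (2 * Real.pi))⁻¹ ≤ 1 := by
      rw [ENNReal.inv_le_one, ENNReal.one_le_ofReal]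
      linarith [Real.pi_gt_three]
    refine (mul_le_of_le_one_left' hle).trans (lintegral_mono fun t => le_of_eq ?_)
    simp only [enorm_eq_iff_norm_eq]
    rw [norm_mul, norm_mul, norm_div, Complex.norm_exp_ofReal_mul_I, norm_pow, norm_inv, norm_pow,
      hzdef, norm_exp_sub_mul_exp, add_comm t φ]
    ring
  · intro θ
    have h2 := hper (θ + φ)
    simp only at h2 ⊢
    rw [show θ + 2 * Real.pi + φ = (θ + φ) + 2 * Real.pi by ring]
    exact h2

/-- The definition controls only small positive increments when s < ∞. For t ≥ t₀ the triangle
inequality gives 2‖u‖_s ≤ (2‖u‖_s / t₀^α) t^α, and negative t follows by translation invariance. For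
s = ∞ a chord is no longer than its arc. -/
lemma MemLebesgueLipschitz.exists_eLpNorm_sub_le {α : ℝ} (hα0 : 0 < α) {s : ℝ≥0∞} (hs : 1 ≤ s)
    {u : Circle → ℂ} (hu : MemLebesgueLipschitz α s u)
    (hum : AEStronglyMeasurable fun θ : ℝ => u (Circle.exp θ)) :
    ∃ K : ℝ, 0 < K ∧ ∀ t : ℝ,
      eLpNorm (fun x : ℝ => u (Circle.exp (x + t)) - u (Circle.exp x)) s angleMeasure ≤
        ENNReal.ofReal (K * |t| ^ α) := by
  have hac := angleMeasure_absolutelyContinuous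
  have hshift : ∀ t : ℝ, AEStronglyMeasurable fun θ : ℝ => u (Circle.exp (θ + t)) := fun t =>
    hum.comp_measurePreserving (measurePreserving_add_right volume t)
  rcases hu with ⟨rfl, A, hA⟩ | ⟨htop, huL, C, hC⟩
  · refine ⟨|A| + 1, by positivity, fun t => ?_⟩
    rw [eLpNorm_exponent_top]
    refine eLpNormEssSup_le_of_ae_bound (ae_of_all _ fun x => ?_)
    refine (hA _ _).trans ?_
    have h1 : ‖(Circle.exp (x + t) : ℂ) - Circle.exp x‖ ≤ |t| := by
      have := Real.norm_exp_I_mul_ofReal_sub_one_le (x := t)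
      rw [Circle.exp_add, Circle.coe_mul, Circle.coe_exp t,
        show (Circle.exp x : ℂ) * Complex.exp (t * Complex.I) - Circle.exp x =
          Circle.exp x * (Complex.exp (Complex.I * t) - 1) by rw [mul_comm Complex.I]; ring,
        norm_mul, Circle.norm_coe, one_mul]
      exact this
    calc A * ‖(Circle.exp (x + t) : ℂ) - Circle.exp x‖ ^ α
        ≤ (|A| + 1) * ‖(Circle.exp (x + t) : ℂ) - Circle.exp x‖ ^ α := by
          gcongr; linarith [le_abs_self A]
      _ ≤ _ := by gcongr
  · obtain ⟨t₀, ht₀, hsub⟩ := mem_nhdsGT_iff_exists_Ioo_subset.1 hC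
    have ht₀' : 0 < t₀ := ht₀
    set L := (eLpNorm (fun x : ℝ => u (Circle.exp x)) s angleMeasure).toReal with hL
    have hLn : eLpNorm (fun x : ℝ => u (Circle.exp x)) s angleMeasure = ENNReal.ofReal L :=
      (ENNReal.ofReal_toReal huL.2.ne).symm
    have hL0 : 0 ≤ L := ENNReal.toReal_nonneg
    have hpos : ∀ t : ℝ, 0 < t →
        eLpNorm (fun x : ℝ => u (Circle.exp (x + t)) - u (Circle.exp x)) s angleMeasure ≤
        ENNReal.ofReal ((C + 2 * L / t₀ ^ α + 1) * t ^ α) := by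
      intro t ht
      rcases lt_or_ge t t₀ with h | h
      · have h1 : integralModulus s t u ≤ C * ENNReal.ofReal (t ^ α) := hsub ⟨ht, h⟩
        refine (le_iSup₂_of_le t ⟨ht, le_rfl⟩ le_rfl).trans (h1.trans ?_)
        rw [← ENNReal.ofReal_coe_nnreal, ← ENNReal.ofReal_mul (by positivity)]
        refine ENNReal.ofReal_le_ofReal ?_
        gcongr
        have : 0 ≤ 2 * L / t₀ ^ α := by positivity
        linarith
      · refine (eLpNorm_sub_le (f := fun x : ℝ => u (Circle.exp (x + t)))
          (g := fun x : ℝ => u (Circle.exp x)) ((hshift t).mono_ac hac) (hum.mono_ac hac)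
          hs).trans ?_
        rw [eLpNorm_angleMeasure_add (comp_circleExp_periodic u), hLn,
          ← ENNReal.ofReal_add hL0 hL0]
        refine ENNReal.ofReal_le_ofReal ?_
        have h1 : t₀ ^ α ≤ t ^ α := by gcongr
        have h0 : 0 < t₀ ^ α := by positivity
        calc L + L = 2 * L / t₀ ^ α * t₀ ^ α := by field_simp; ring
          _ ≤ 2 * L / t₀ ^ α * t ^ α := by gcongr
          _ ≤ _ := by gcongr; linarith [C.coe_nonneg]
    refine ⟨C + 2 * L / t₀ ^ α + 1, by positivity, fun t => ?_⟩
    rcases lt_trichotomy t 0 with h | rfl | h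
    · rw [abs_of_neg h]
      refine le_trans (le_of_eq ?_) (hpos (-t) (by linarith))
      rw [← eLpNorm_angleMeasure_add (G := fun x : ℝ => u (Circle.exp (x + -t)) -
        u (Circle.exp x)) _ _ t]
      · simp only [add_neg_cancel_right]
        rw [← eLpNorm_neg]
        congr 1
        ext x
        simp
      · intro x
        simp only [show x + 2 * Real.pi + -t = (x + -t) + 2 * Real.pi by ring,
          Circle.periodic_exp _]
    · simp
    · rw [abs_of_pos h]
      exact hpos t h

/-- **Hardy–Littlewood**: Lipschitz boundary values control the growth of the integral means of
the derivative. -/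
theorem exists_integralMean_deriv_le {α : ℝ} (hα0 : 0 < α) (hα1 : α < 1) {s : ℝ≥0∞} (hs : 1 < s)
    {F : ℂ → ℂ} (hF : MemHardy s F) (hb : BoundaryValuesInLipschitz α s F) :
    ∃ C : ℝ, 0 < C ∧ ∀ r ∈ Ico (0 : ℝ) 1,
      integralMean s r (deriv F) ≤ ENNReal.ofReal (C * (1 - r) ^ (α - 1)) := by
  obtain ⟨u, hu, huL⟩ := hb
  have hum := hu.aestronglyMeasurable hF.1.continuousOn
  obtain ⟨K, hK0, hK⟩ := huL.exists_eLpNorm_sub_le hα0 hs.le hum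
  obtain ⟨C, hC0, hC⟩ := exists_setLIntegral_kernel_le hα0.le hα1
  -- The constant C may be 0; adding 1 secures positivity.
  refine ⟨K * C + 1, by positivity, fun r hr => ?_⟩
  have hr1 : 0 < 1 - r := by linarith [hr.2]
  have hne : ∀ t : ℝ, 1 - r * Complex.exp (t * Complex.I) ≠ 0 := fun t => by
    have h1 := norm_sub_norm_le (1 : ℂ) (r * Complex.exp (t * Complex.I))
    rw [norm_mul_exp hr.1, norm_one] at h1
    exact norm_pos_iff.1 (by linarith)
  have hkc : Continuous fun t : ℝ => ((1 - r * Complex.exp (t * Complex.I)) ^ 2)⁻¹ :=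
    Continuous.inv₀ (by fun_prop) fun t => pow_ne_zero _ (hne t)
  have hac : (angleMeasure.prod (volume.restrict (Ioc (-Real.pi) Real.pi))) ≪
      (volume : Measure ℝ).prod volume :=
    angleMeasure_absolutelyContinuous.prod Measure.restrict_le_self.absolutelyContinuous
  have hq : Measure.QuasiMeasurePreserving (fun z : ℝ × ℝ => z.1 + z.2)
      ((volume : Measure ℝ).prod volume) volume :=
    Measure.quasiMeasurePreserving_snd.comp
      (measurePreserving_prod_add (volume : Measure ℝ) volume).quasiMeasurePreserving
  refine (eLpNorm_le_lintegral hs.le (ν := volume.restrict (Ioc (-Real.pi) Real.pi))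
    (G := fun φ t : ℝ => (u (Circle.exp (φ + t)) - u (Circle.exp φ)) *
        ((1 - r * Complex.exp (t * Complex.I)) ^ 2)⁻¹)
    (N := fun t => ENNReal.ofReal K *
      ENNReal.ofReal (|t| ^ α / ‖1 - r * Complex.exp (t * Complex.I)‖ ^ 2)) ?_ ?_ ?_ ?_
    (ae_of_all _ fun φ => enorm_deriv_le_lintegral_boundary hs hF hu hr φ)).trans ?_
  · refine AEStronglyMeasurable.mul (AEStronglyMeasurable.mono_ac hac ?_)
      (hkc.comp continuous_snd).aestronglyMeasurable
    exact (hum.comp_quasiMeasurePreserving hq).sub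
      (hum.comp_quasiMeasurePreserving Measure.quasiMeasurePreserving_fst)
  · fun_prop
  -- The majorant vanishes only at t = 0, a null set.
  · refine ae_restrict_of_ae ?_
    filter_upwards [Measure.ae_ne volume 0] with t ht
    have h1 : 0 < |t| := abs_pos.2 ht
    have h2 := norm_pos_iff.2 (hne t)
    exact mul_ne_zero (ENNReal.ofReal_pos.2 hK0).ne' (ENNReal.ofReal_pos.2 (by positivity)).ne'
  · refine ae_of_all _ fun t => ?_
    have h1 : (fun φ : ℝ => (u (Circle.exp (φ + t)) - u (Circle.exp φ)) *
        ((1 - r * Complex.exp (t * Complex.I)) ^ 2)⁻¹) =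
        ((1 - r * Complex.exp (t * Complex.I)) ^ 2)⁻¹ •
          fun φ : ℝ => u (Circle.exp (φ + t)) - u (Circle.exp φ) := by
      ext φ; simp [mul_comm]
    rw [h1, eLpNorm_const_smul]
    calc _ ≤ ‖((1 - r * Complex.exp (t * Complex.I)) ^ 2)⁻¹‖ₑ *
          ENNReal.ofReal (K * |t| ^ α) := by gcongr; exact hK t
      _ = _ := by
        rw [← ofReal_norm, norm_inv, norm_pow, ← ENNReal.ofReal_mul (by positivity),
          ← ENNReal.ofReal_mul hK0.le]
        congr 1
        ring
  · rw [lintegral_const_mul' _ _ ENNReal.ofReal_ne_top]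
    calc _ ≤ ENNReal.ofReal K * ENNReal.ofReal (C * (1 - r) ^ (α - 1)) := by
          gcongr; exact hC r hr
      _ ≤ _ := by
        rw [← ENNReal.ofReal_mul hK0.le, ← mul_assoc]
        refine ENNReal.ofReal_le_ofReal ?_
        gcongr
        linarith

/-! ### Area measure in polar coordinates. -/

/-- The measure `2ρ dρ` on `(0, 1)`. -/
def radialMeasure : Measure ℝ :=
  (volume.restrict (Ioo (0 : ℝ) 1)).withDensity fun ρ => ENNReal.ofReal (2 * ρ)

instance sFinite_radialMeasure : SFinite radialMeasure := by
  unfold radialMeasure; infer_instance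

lemma lintegral_radialMeasure (g : ℝ → ℝ≥0∞) :
    ∫⁻ ρ, g ρ ∂radialMeasure = ∫⁻ ρ in Ioo (0 : ℝ) 1, ENNReal.ofReal (2 * ρ) * g ρ := by
  rw [radialMeasure, lintegral_withDensity_eq_lintegral_mul_non_measurable _ (by fun_prop)
    (ae_of_all _ fun _ => ENNReal.ofReal_lt_top)]
  rfl

lemma ae_radialMeasure_mem : ∀ᵐ ρ ∂radialMeasure, ρ ∈ Ioo (0 : ℝ) 1 :=
  (withDensity_absolutelyContinuous _ _).ae_le (ae_restrict_mem measurableSet_Ioo)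

/-- The normalizations match because ρ dρ dθ / π = 2ρ dρ · dθ/(2π). -/
lemma lintegral_areaMeasure_polar {g : ℂ → ℝ≥0∞} (hg : Measurable g) :
    ∫⁻ w, g w ∂areaMeasure = ∫⁻ ρ, ∫⁻ θ : ℝ, g (ρ * Complex.exp (θ * Complex.I)) ∂angleMeasure
      ∂radialMeasure := by
  have hpi := Real.pi_pos
  have hgi : Measurable (disc.indicator g) := hg.indicator isOpen_disc.measurableSet
  have hm : Measurable fun z : ℝ × ℝ => (z.1 : ℂ) * Complex.exp (z.2 * Complex.I) := by fun_prop
  rw [areaMeasure, lintegral_smul_measure, ← lintegral_indicator isOpen_disc.measurableSet,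
    ← Complex.lintegral_comp_polarCoord_symm]
  have e1 : ∀ z : ℝ × ℝ, (Complex.polarCoord.symm z : ℂ) = z.1 * Complex.exp (z.2 * Complex.I) := by
    intro z
    rw [Complex.polarCoord_symm_apply, Complex.exp_mul_I]
    push_cast
    rfl
  simp only [e1]
  have htarget : polarCoord.target = Ioi (0 : ℝ) ×ˢ Ioo (-Real.pi) Real.pi := rfl
  rw [htarget, Measure.volume_eq_prod, ← Measure.prod_restrict, lintegral_prod]
  swap
  · exact ((ENNReal.measurable_ofReal.comp measurable_fst).smul (hgi.comp hm)).aemeasurable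
  rw [lintegral_radialMeasure, smul_eq_mul,
    ← lintegral_const_mul' _ _ (ENNReal.inv_ne_top.2 (ENNReal.ofReal_pos.2 hpi).ne'),
    ← Ioo_union_Ici_eq_Ioi (zero_lt_one' ℝ), lintegral_union measurableSet_Ici
      (by rw [Set.disjoint_left]; intro x hx hx'; exact not_lt.2 hx' hx.2)]
  have h0 : ∫⁻ ρ in Ici (1 : ℝ), (ENNReal.ofReal Real.pi)⁻¹ * ∫⁻ θ in Ioo (-Real.pi) Real.pi,
      ENNReal.ofReal ρ • disc.indicator g (ρ * Complex.exp (θ * Complex.I)) = 0 := by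
    rw [setLIntegral_congr_fun (g := fun _ => 0) measurableSet_Ici]
    · simp
    · intro ρ hρ
      have hρ' : (1 : ℝ) ≤ ρ := hρ
      have : ∀ θ : ℝ, disc.indicator g (ρ * Complex.exp (θ * Complex.I)) = 0 := fun θ => by
        refine indicator_of_notMem ?_ _
        rw [disc, mem_ball_zero_iff, norm_mul_exp (by linarith)]
        linarith
      simp [this]
  rw [h0, add_zero]
  refine setLIntegral_congr_fun measurableSet_Ioo fun ρ hρ => ?_
  have hi : ∀ θ : ℝ, disc.indicator g (ρ * Complex.exp (θ * Complex.I)) =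
      g (ρ * Complex.exp (θ * Complex.I)) := fun θ =>
    indicator_of_mem (mul_exp_mem_disc hρ.1.le hρ.2 θ) _
  simp only [hi, smul_eq_mul]
  rw [lintegral_const_mul' _ _ ENNReal.ofReal_ne_top,
    setLIntegral_congr (Ioo_ae_eq_Ioc (a := -Real.pi) (b := Real.pi)),
    lintegral_angleMeasure_eq_symm (g := fun θ : ℝ => g (ρ * Complex.exp (θ * Complex.I)))
      (comp_exp_periodic g ρ), ← mul_assoc, ← mul_assoc]
  congr 1
  rw [← ENNReal.ofReal_inv_of_pos hpi, ← ENNReal.ofReal_inv_of_pos (by positivity),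
    ← ENNReal.ofReal_mul (by positivity), ← ENNReal.ofReal_mul (by linarith [hρ.1])]
  congr 1
  field_simp

lemma areaMeasure_eq_map : areaMeasure = (radialMeasure.prod angleMeasure).map
    fun z : ℝ × ℝ => (z.1 : ℂ) * Complex.exp (z.2 * Complex.I) := by
  have hm : Measurable fun z : ℝ × ℝ => (z.1 : ℂ) * Complex.exp (z.2 * Complex.I) := by fun_prop
  refine Measure.ext_of_lintegral _ fun g hg => ?_
  rw [lintegral_areaMeasure_polar hg, lintegral_map hg hm, lintegral_prod]
  exact (hg.comp hm).aemeasurable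

lemma measurePreserving_polar : MeasurePreserving
    (fun z : ℝ × ℝ => (z.1 : ℂ) * Complex.exp (z.2 * Complex.I))
    (radialMeasure.prod angleMeasure) areaMeasure :=
  ⟨by fun_prop, areaMeasure_eq_map.symm⟩

lemma integral_areaMeasure_polar {g : ℂ → ℂ} (hg : Integrable g areaMeasure) :
    ∫ w, g w ∂areaMeasure =
      ∫ ρ : ℝ, (∫ θ : ℝ, g (ρ * Complex.exp (θ * Complex.I)) ∂angleMeasure) ∂radialMeasure := by
  have hg' := hg
  rw [areaMeasure_eq_map] at hg'
  have h2 := (measurePreserving_polar.integrable_comp hg.aestronglyMeasurable).2 hg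
  rw [areaMeasure_eq_map, integral_map measurePreserving_polar.aemeasurable
    hg'.aestronglyMeasurable]
  exact integral_prod _ h2

lemma integral_radialMeasure (g : ℝ → ℂ) :
    ∫ ρ, g ρ ∂radialMeasure = ∫ ρ in (0 : ℝ)..1, (2 * ρ : ℂ) * g ρ := by
  rw [radialMeasure, integral_withDensity_eq_integral_toReal_smul (by fun_prop)
    (ae_of_all _ fun _ => ENNReal.ofReal_lt_top), intervalIntegral.integral_of_le zero_le_one,
    integral_Ioc_eq_integral_Ioo]
  refine setIntegral_congr_fun measurableSet_Ioo fun ρ hρ => ?_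
  rw [ENNReal.toReal_ofReal (by linarith [hρ.1]), Complex.real_smul]
  simp

instance isFiniteMeasure_areaMeasure : IsFiniteMeasure areaMeasure := by
  constructor
  rw [areaMeasure, Measure.smul_apply, Measure.restrict_apply_univ, smul_eq_mul]
  exact ENNReal.mul_lt_top (ENNReal.inv_lt_top.2 (ENNReal.ofReal_pos.2 Real.pi_pos))
    measure_ball_lt_top

lemma ae_areaMeasure_mem_disc : ∀ᵐ w ∂areaMeasure, w ∈ disc :=
  Measure.smul_absolutelyContinuous.ae_le (ae_restrict_mem isOpen_disc.measurableSet)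

lemma aestronglyMeasurable_areaMeasure {E : Type*} [TopologicalSpace E]
    [TopologicalSpace.PseudoMetrizableSpace E] {g : ℂ → E} [SecondCountableTopologyEither ℂ E]
    (hg : ContinuousOn g disc) : AEStronglyMeasurable g areaMeasure :=
  (hg.aestronglyMeasurable isOpen_disc.measurableSet).smul_measure _

lemma MemBergman.memLp {p : ℝ} {f : ℂ → ℂ} (hf : MemBergman p f) :
    MemLp f (ENNReal.ofReal p) areaMeasure :=
  ⟨aestronglyMeasurable_areaMeasure hf.1.continuousOn, hf.2⟩

lemma memBergman_pow (p : ℝ) (m : ℕ) : MemBergman p fun w => w ^ m := by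
  have hd : DifferentiableOn ℂ (fun w : ℂ => w ^ m) disc := by fun_prop
  refine ⟨hd, (MemLp.of_bound (aestronglyMeasurable_areaMeasure hd.continuousOn) 1 ?_).2⟩
  filter_upwards [ae_areaMeasure_mem_disc] with w hw
  rw [norm_pow]
  exact pow_le_one₀ (norm_nonneg _) (mem_ball_zero_iff.1 hw).le

/-! ### The variational identity for extremal functions. -/

lemma hasDerivAt_norm_add_mul_rpow {p : ℝ} (hp : 1 < p) (a b : ℂ) (t : ℝ) :
    HasDerivAt (fun t : ℝ => ‖a + t * b‖ ^ p)
      (p * ‖a + t * b‖ ^ (p - 2) * ((starRingEnd ℂ) (a + t * b) * b).re) t := by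
  have h1 : HasDerivAt (fun t : ℝ => a + t * b) b t := by
    simpa using ((Complex.ofRealCLM.hasDerivAt (x := t)).mul_const b).const_add a
  have h2 := (hasFDerivAt_norm_rpow (a + t * b) hp).comp_hasDerivAt t h1
  refine h2.congr_deriv ?_
  rw [smul_apply, innerSL_apply_apply, smul_eq_mul, Complex.inner, mul_comm b]

/-- Differentiation under the integral sign: for |t| < 1 the derivative is dominated by the
integrable function p(|f| + |g|)^p. -/
lemma hasDerivAt_integral_norm_add_mul_rpow {p : ℝ} (hp : 1 < p) {f g : ℂ → ℂ}
    (hf : MemLp f (ENNReal.ofReal p) areaMeasure) (hg : MemLp g (ENNReal.ofReal p) areaMeasure) :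
    HasDerivAt (fun t : ℝ => ∫ w, ‖f w + t * g w‖ ^ p ∂areaMeasure)
      (∫ w, p * ‖f w‖ ^ (p - 2) * ((starRingEnd ℂ) (f w) * g w).re ∂areaMeasure) 0 := by
  have hp0 : 0 < p := by linarith
  have hpe : ENNReal.ofReal p ≠ 0 := (ENNReal.ofReal_pos.2 hp0).ne'
  have hpr : (ENNReal.ofReal p).toReal = p := ENNReal.toReal_ofReal hp0.le
  have hft : ∀ t : ℝ, AEStronglyMeasurable (fun w => f w + t * g w) areaMeasure := fun t =>
    hf.1.add (hg.1.const_mul _)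
  have hbi : Integrable (fun w => p * (‖f w‖ + ‖g w‖) ^ p) areaMeasure := by
    have h := (hf.norm.add hg.norm).integrable_norm_rpow hpe ENNReal.ofReal_ne_top
    rw [hpr] at h
    refine (h.const_mul p).congr (ae_of_all _ fun w => ?_)
    simp only [Pi.add_apply]
    rw [Real.norm_of_nonneg (by positivity)]
  have hfi : Integrable (fun w => ‖f w + (0 : ℝ) * g w‖ ^ p) areaMeasure := by
    have h := hf.integrable_norm_rpow hpe ENNReal.ofReal_ne_top
    rw [hpr] at h
    simpa using h
  have key := hasDerivAt_integral_of_dominated_loc_of_deriv_le (μ := areaMeasure) (𝕜 := ℝ)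
    (F := fun (t : ℝ) w => ‖f w + t * g w‖ ^ p)
    (F' := fun (t : ℝ) w => p * ‖f w + t * g w‖ ^ (p - 2) *
      ((starRingEnd ℂ) (f w + t * g w) * g w).re)
    (x₀ := 0) (s := Metric.ball 0 1) (bound := fun w => p * (‖f w‖ + ‖g w‖) ^ p)
    (Metric.ball_mem_nhds _ one_pos)
    (Eventually.of_forall fun t => ((hft t).norm.aemeasurable.pow_const _).aestronglyMeasurable)
    hfi ?_ (ae_of_all _ fun w t ht => ?_) hbi
    (ae_of_all _ fun w t _ => hasDerivAt_norm_add_mul_rpow hp (f w) (g w) t)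
  · simpa using key.2
  · refine AEStronglyMeasurable.mul (((hft 0).norm.aemeasurable.pow_const _).const_mul
      _).aestronglyMeasurable ?_
    exact Complex.continuous_re.comp_aestronglyMeasurable
      ((Complex.continuous_conj.comp_aestronglyMeasurable (hft 0)).mul hg.1)
  · have ht1 : |t| ≤ 1 := by
      have := mem_ball_zero_iff.1 ht
      exact (Real.norm_eq_abs t ▸ this).le
    have h1 : ‖f w + t * g w‖ ≤ ‖f w‖ + ‖g w‖ := by
      refine (norm_add_le _ _).trans ?_
      rw [norm_mul, Complex.norm_real, Real.norm_eq_abs]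
      gcongr
      exact mul_le_of_le_one_left (norm_nonneg _) ht1
    have h2 : |((starRingEnd ℂ) (f w + t * g w) * g w).re| ≤ ‖f w + t * g w‖ * ‖g w‖ := by
      refine (Complex.abs_re_le_norm _).trans (le_of_eq ?_)
      rw [norm_mul, Complex.norm_conj]
    rcases eq_or_ne (f w + t * g w) 0 with h0 | h0
    · simp only [h0, map_zero, zero_mul, Complex.zero_re, mul_zero, norm_zero]
      positivity
    have hpos : 0 < ‖f w + t * g w‖ := norm_pos_iff.2 h0
    rw [norm_mul, norm_mul, Real.norm_of_nonneg hp0.le, Real.norm_of_nonneg (by positivity),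
      Real.norm_eq_abs, mul_assoc]
    have h3 : ‖f w + t * g w‖ ^ (p - 2) * (‖f w + t * g w‖ * ‖g w‖) ≤ (‖f w‖ + ‖g w‖) ^ p := by
      have hs : 0 < ‖f w‖ + ‖g w‖ := hpos.trans_le h1
      calc _ = ‖f w + t * g w‖ ^ (p - 1) * ‖g w‖ := by
            rw [← mul_assoc, ← Real.rpow_add_one hpos.ne']; ring_nf
        _ ≤ (‖f w‖ + ‖g w‖) ^ (p - 1) * (‖f w‖ + ‖g w‖) := by
            gcongr
            linarith [norm_nonneg (f w)]
        _ = _ := by rw [← Real.rpow_add_one hs.ne']; ring_nf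
    gcongr
    refine le_trans ?_ h3
    gcongr

lemma bergmanNorm_eq_ofReal {p : ℝ} (hp : 0 < p) {f : ℂ → ℂ} (hf : MemBergman p f) :
    bergmanNorm p f = ENNReal.ofReal ((∫ w, ‖f w‖ ^ p ∂areaMeasure) ^ (1 / p)) := by
  have := hf.memLp.eLpNorm_eq_integral_rpow_norm (ENNReal.ofReal_pos.2 hp).ne'
    ENNReal.ofReal_ne_top
  rw [ENNReal.toReal_ofReal hp.le] at this
  rw [bergmanNorm, this, one_div]

/-- The nonlinear dual function `|f|^{p-2} f` of `f`. -/
def dualFunction (p : ℝ) (z : ℂ) : ℂ := (‖z‖ ^ (p - 2) : ℝ) * z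

lemma integrable_mul_conj {p q : ℝ} (hpq : p.HolderConjugate q) {g k : ℂ → ℂ}
    (hg : MemBergman p g) (hk : MemBergman q k) :
    Integrable (fun z => g z * (starRingEnd ℂ) (k z)) areaMeasure := by
  have := hpq.ennrealOfReal
  have hk' : MemLp (fun z => (starRingEnd ℂ) (k z)) (ENNReal.ofReal q) areaMeasure := by
    refine hk.memLp.congr_norm ?_ (ae_of_all _ fun z => (Complex.norm_conj _).symm)
    exact Complex.continuous_conj.comp_aestronglyMeasurable hk.memLp.1
  exact hg.memLp.integrable_mul hk'

/-- A Lagrange multiplier argument: f + tg, divided by its norm, competes with f for every small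
real t of either sign, so the first variation vanishes. -/
lemma IsExtremal.re_integral_eq {p q : ℝ} (hpq : p.HolderConjugate q) {k f g : ℂ → ℂ}
    (hk : MemBergman q k) (hext : IsExtremal p k f) (hg : MemBergman p g) :
    (∫ z, g z * (starRingEnd ℂ) (k z) ∂areaMeasure).re =
      (∫ z, f z * (starRingEnd ℂ) (k z) ∂areaMeasure).re *
        ∫ w, ‖f w‖ ^ (p - 2) * ((starRingEnd ℂ) (f w) * g w).re ∂areaMeasure := by
  obtain ⟨hf, hf1, hmax⟩ := hext
  have hp0 : 0 < p := hpq.pos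
  set Λ := (∫ z, f z * (starRingEnd ℂ) (k z) ∂areaMeasure).re with hΛ
  set B := (∫ z, g z * (starRingEnd ℂ) (k z) ∂areaMeasure).re with hB
  set J : ℝ → ℝ := fun t => ∫ w, ‖f w + t * g w‖ ^ p ∂areaMeasure with hJ
  have hft : ∀ t : ℝ, MemBergman p fun w => f w + t * g w := fun t =>
    ⟨hf.1.add (hg.1.const_mul _), (hf.memLp.add (hg.memLp.const_mul (t : ℂ))).2⟩
  have hJ0 : J 0 = 1 := by
    have h1 := bergmanNorm_eq_ofReal hp0 hf
    rw [hf1] at h1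
    have h2 : (∫ w, ‖f w‖ ^ p ∂areaMeasure) ^ (1 / p) = 1 := by
      have := congrArg ENNReal.toReal h1
      rw [ENNReal.toReal_ofReal (by positivity)] at this
      simpa using this.symm
    have h3 : 0 ≤ ∫ w, ‖f w‖ ^ p ∂areaMeasure := by positivity
    have h4 : ∫ w, ‖f w‖ ^ p ∂areaMeasure = 1 := by
      have := congrArg (· ^ p) h2
      simp only [Real.one_rpow] at this
      rwa [← Real.rpow_mul h3, one_div_mul_cancel hp0.ne', Real.rpow_one] at this
    simpa [hJ] using h4
  have hJd := hasDerivAt_integral_norm_add_mul_rpow hpq.lt hf.memLp hg.memLp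
  have hJpos : ∀ᶠ t in 𝓝 (0 : ℝ), 0 < J t := by
    have h0 : 0 < J 0 := by rw [hJ0]; exact one_pos
    exact hJd.continuousAt.eventually (lt_mem_nhds h0)
  -- With N = ‖f + tg‖, extremality reads (Λ + tB)/N ≤ Λ. Equality holds at t = 0, so the right-hand
  -- side here has a local minimum there.
  have hineq : ∀ᶠ t in 𝓝 (0 : ℝ), 0 ≤ J t ^ (1 / p) * Λ - Λ - t * B := by
    filter_upwards [hJpos] with t ht
    set N := J t ^ (1 / p) with hN
    have hNpos : 0 < N := by positivity
    have hnorm : bergmanNorm p (fun w => f w + t * g w) = ENNReal.ofReal N :=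
      bergmanNorm_eq_ofReal hp0 (hft t)
    have hcomp : MemBergman p fun w => (N⁻¹ : ℂ) * (f w + t * g w) :=
      ⟨(hft t).1.const_mul _, ((hft t).memLp.const_mul (N⁻¹ : ℂ)).2⟩
    have h1 : bergmanNorm p (fun w => (N⁻¹ : ℂ) * (f w + t * g w)) = 1 := by
      have := eLpNorm_const_smul (N⁻¹ : ℂ) (fun w => f w + t * g w) (ENNReal.ofReal p) areaMeasure
      change bergmanNorm p (fun w => (N⁻¹ : ℂ) * (f w + t * g w)) = _ at this
      change _ = _ * bergmanNorm p (fun w => f w + t * g w) at this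
      rw [this, hnorm, ← ofReal_norm, ← ENNReal.ofReal_mul (norm_nonneg _)]
      rw [norm_inv, Complex.norm_real, Real.norm_of_nonneg hNpos.le, inv_mul_cancel₀ hNpos.ne']
      simp
    have h2 := hmax _ hcomp h1
    have h3 : ∫ z, (N⁻¹ : ℂ) * (f z + t * g z) * (starRingEnd ℂ) (k z) ∂areaMeasure =
        ((N⁻¹ : ℝ) : ℂ) * ((∫ z, f z * (starRingEnd ℂ) (k z) ∂areaMeasure) +
          t * ∫ z, g z * (starRingEnd ℂ) (k z) ∂areaMeasure) := by
      rw [← integral_const_mul, ← integral_add (integrable_mul_conj hpq hf hk)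
        ((integrable_mul_conj hpq hg hk).const_mul _), ← integral_const_mul]
      refine integral_congr_ae (ae_of_all _ fun z => ?_)
      push_cast
      ring
    rw [h3, Complex.re_ofReal_mul, Complex.add_re, Complex.re_ofReal_mul, ← hΛ, ← hB,
      inv_mul_le_iff₀ hNpos] at h2
    linarith
  have hder : HasDerivAt (fun t => J t ^ (1 / p) * Λ - Λ - t * B)
      ((∫ w, p * ‖f w‖ ^ (p - 2) * ((starRingEnd ℂ) (f w) * g w).re ∂areaMeasure) * (1 / p) *
        J 0 ^ (1 / p - 1) * Λ - B) 0 := by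
    have h1 := (hJd.rpow_const (p := 1 / p) (Or.inl (by change J 0 ≠ 0; rw [hJ0]; exact one_ne_zero)))
    have h2 := ((h1.mul_const Λ).sub_const Λ).sub ((hasDerivAt_id (0 : ℝ)).mul_const B)
    exact h2.congr_deriv (by rw [one_mul])
  have hmin : IsLocalMin (fun t => J t ^ (1 / p) * Λ - Λ - t * B) 0 := by
    filter_upwards [hineq] with t ht
    simpa [hJ0] using ht
  have h0 := hmin.hasDerivAt_eq_zero hder
  have h1 : ∫ w, p * ‖f w‖ ^ (p - 2) * ((starRingEnd ℂ) (f w) * g w).re ∂areaMeasure =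
      p * ∫ w, ‖f w‖ ^ (p - 2) * ((starRingEnd ℂ) (f w) * g w).re ∂areaMeasure := by
    rw [← integral_const_mul]
    simp only [mul_assoc]
  rw [hJ0, Real.one_rpow, h1] at h0
  field_simp at h0
  linarith

/-- The modulus is |f|^{p-1}, and q = p/(p-1). -/
lemma memLp_dualFunction {p q : ℝ} (hpq : p.HolderConjugate q) {f : ℂ → ℂ} (hf : MemBergman p f) :
    MemLp (fun w => dualFunction p (f w)) (ENNReal.ofReal q) areaMeasure := by
  have hp0 : 0 < p := hpq.pos
  have hq0 : 0 < q := hpq.symm.pos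
  have hm : AEStronglyMeasurable (fun w => dualFunction p (f w)) areaMeasure := by
    refine AEStronglyMeasurable.mul ?_ hf.memLp.1
    exact Complex.continuous_ofReal.comp_aestronglyMeasurable
      (hf.memLp.1.norm.aemeasurable.pow_const _).aestronglyMeasurable
  have h := hf.memLp.norm_rpow_div (ENNReal.ofReal (p - 1))
  rw [ENNReal.toReal_ofReal (by linarith [hpq.lt]), ← ENNReal.ofReal_div_of_pos
    (by linarith [hpq.lt]), ← hpq.conjugate_eq] at h
  refine h.congr_norm hm (ae_of_all _ fun w => ?_)
  rw [dualFunction, norm_mul, Complex.norm_real, Real.norm_of_nonneg (by positivity),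
    Real.norm_of_nonneg (by positivity)]
  rcases eq_or_ne (f w) 0 with h0 | h0
  · simp [h0, Real.zero_rpow (show p - 1 ≠ 0 by linarith [hpq.lt])]
  · rw [← Real.rpow_add_one (norm_ne_zero_iff.2 h0)]
    ring_nf

lemma IsExtremal.integral_eq {p q : ℝ} (hpq : p.HolderConjugate q) {k f g : ℂ → ℂ}
    (hk : MemBergman q k) (hext : IsExtremal p k f) (hg : MemBergman p g) :
    ∫ z, g z * (starRingEnd ℂ) (k z) ∂areaMeasure =
      ((∫ z, f z * (starRingEnd ℂ) (k z) ∂areaMeasure).re : ℂ) *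
        ∫ z, g z * (starRingEnd ℂ) (dualFunction p (f z)) ∂areaMeasure := by
  have hi : ∀ g : ℂ → ℂ, MemBergman p g → Integrable
      (fun z => g z * (starRingEnd ℂ) (dualFunction p (f z))) areaMeasure := fun g hg => by
    have := hpq.ennrealOfReal
    have hu := memLp_dualFunction hpq hext.1
    have hu' : MemLp (fun z => (starRingEnd ℂ) (dualFunction p (f z))) (ENNReal.ofReal q)
        areaMeasure := by
      refine hu.congr_norm ?_ (ae_of_all _ fun z => (Complex.norm_conj _).symm)
      exact Complex.continuous_conj.comp_aestronglyMeasurable hu.1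
    exact hg.memLp.integrable_mul hu'
  have key : ∀ g : ℂ → ℂ, MemBergman p g →
      (∫ z, g z * (starRingEnd ℂ) (k z) ∂areaMeasure).re =
        (∫ z, f z * (starRingEnd ℂ) (k z) ∂areaMeasure).re *
          (∫ z, g z * (starRingEnd ℂ) (dualFunction p (f z)) ∂areaMeasure).re := by
    intro g hg
    rw [hext.re_integral_eq hpq hk hg]
    congr 1
    have h1 := Complex.reCLM.integral_comp_comm (hi g hg)
    simp only [Complex.reCLM_apply] at h1
    rw [← h1]
    refine integral_congr_ae (ae_of_all _ fun z => ?_)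
    simp only [dualFunction, map_mul, Complex.conj_ofReal]
    rw [mul_left_comm, Complex.re_ofReal_mul, mul_comm (g z)]
  -- Replacing g by ig converts the identity of real parts into one of imaginary parts.
  have hIg : MemBergman p fun z => Complex.I * g z :=
    ⟨hg.1.const_mul _, (hg.memLp.const_mul Complex.I).2⟩
  have h2 := key _ hIg
  simp only [mul_assoc] at h2
  rw [integral_const_mul, integral_const_mul, Complex.I_mul_re, Complex.I_mul_re] at h2
  apply Complex.ext
  · rw [Complex.re_ofReal_mul]; exact key g hg
  · rw [Complex.im_ofReal_mul]; linarith

/-! ### Taylor coefficients as moments. -/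

lemma integral_exp_int (j m : ℕ) :
    ∫ θ : ℝ, Complex.exp (θ * Complex.I) ^ j * (starRingEnd ℂ) (Complex.exp (θ * Complex.I)) ^ m
      ∂angleMeasure = if j = m then 1 else 0 := by
  have h1 : ∀ θ : ℝ, Complex.exp (θ * Complex.I) ^ j *
      (starRingEnd ℂ) (Complex.exp (θ * Complex.I)) ^ m =
      Complex.exp ((((j : ℂ) - m) * Complex.I) * θ) := by
    intro θ
    rw [← Complex.exp_conj, ← Complex.exp_nat_mul, ← Complex.exp_nat_mul, ← Complex.exp_add]
    congr 1
    simp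
    ring
  simp only [h1]
  split_ifs with h
  · subst h; simp
  · have hc : ((j : ℂ) - m) * Complex.I ≠ 0 := by
      refine mul_ne_zero (sub_ne_zero.2 ?_) Complex.I_ne_zero
      exact_mod_cast h
    rw [integral_angleMeasure, integral_exp_mul_complex hc]
    have : Complex.exp (((j : ℂ) - m) * Complex.I * (2 * Real.pi : ℝ)) = 1 := by
      rw [Complex.exp_eq_one_iff]
      exact ⟨(j : ℤ) - m, by push_cast; ring⟩
    rw [this]
    simp

/-- Taylor coefficients of an integrable analytic function in the disc are given by moments. -/
lemma integral_conj_pow_mul {k : ℂ → ℂ} (hk : DifferentiableOn ℂ k disc)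
    (hki : Integrable k areaMeasure) (m : ℕ) :
    ∫ w, (starRingEnd ℂ) w ^ m * k w ∂areaMeasure =
      ((m.factorial : ℂ)⁻¹ * iteratedDeriv m k 0) / (m + 1) := by
  have hint : Integrable (fun w => (starRingEnd ℂ) w ^ m * k w) areaMeasure := by
    refine hki.bdd_mul (c := 1)
      (Complex.continuous_conj.pow m).aestronglyMeasurable ?_
    filter_upwards [ae_areaMeasure_mem_disc] with w hw
    rw [norm_pow, Complex.norm_conj]
    exact pow_le_one₀ (norm_nonneg _) (mem_ball_zero_iff.1 hw).le
  set a : ℕ → ℂ := fun j => (j.factorial : ℂ)⁻¹ * iteratedDeriv j k 0 with ha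
  -- On each circle orthogonality leaves only the term j = m; the radial integral ∫ 2ρ^{2m+1} dρ
  -- then supplies 1/(m+1).
  have hinner : ∀ ρ ∈ Ioo (0 : ℝ) 1, ∫ θ : ℝ, (starRingEnd ℂ) (ρ * Complex.exp (θ * Complex.I)) ^ m *
      k (ρ * Complex.exp (θ * Complex.I)) ∂angleMeasure = ρ ^ (2 * m) * a m := by
    intro ρ hρ
    have hsum : ∀ θ : ℝ, HasSum (fun j => a j * (ρ * Complex.exp (θ * Complex.I)) ^ j)
        (k (ρ * Complex.exp (θ * Complex.I))) := by
      intro θ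
      have h := Complex.hasSum_taylorSeries_on_ball hk (mul_exp_mem_disc hρ.1.le hρ.2 θ)
      refine h.congr_fun ?_
      intro j
      simp only [ha, smul_eq_mul, sub_zero]
      ring
    have hsn : Summable fun j => ‖a j‖ * ρ ^ j := by
      have := (hsum 0).summable.norm
      simpa [abs_of_pos hρ.1] using this
    set F : ℕ → ℝ → ℂ := fun j θ => (a j * ρ ^ j * ρ ^ m) * (Complex.exp (θ * Complex.I) ^ j *
      (starRingEnd ℂ) (Complex.exp (θ * Complex.I)) ^ m) with hF
    have hFc : ∀ j, Continuous (F j) := fun j => by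
      have : Continuous fun θ : ℝ => (starRingEnd ℂ) (Complex.exp (θ * Complex.I)) :=
        Complex.continuous_conj.comp (by fun_prop)
      simp only [hF]
      fun_prop
    have hFn : ∀ j θ, ‖F j θ‖ = ‖a j‖ * ρ ^ j * ρ ^ m := fun j θ => by
      simp only [hF, norm_mul, norm_pow, Complex.norm_exp_ofReal_mul_I, Complex.norm_conj,
        Complex.norm_real, Real.norm_of_nonneg hρ.1.le, one_pow, mul_one]
    have hFi : ∀ j, Integrable (F j) angleMeasure := fun j =>
      Integrable.of_bound (hFc j).aestronglyMeasurable _ (ae_of_all _ fun θ => (hFn j θ).le)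
    have hS := hasSum_integral_of_summable_integral_norm hFi (by
      simp only [hFn, integral_const, probReal_univ, one_smul]
      exact hsn.mul_right _)
    have hts : ∀ θ : ℝ, ∑' j, F j θ = (starRingEnd ℂ) (ρ * Complex.exp (θ * Complex.I)) ^ m *
      k (ρ * Complex.exp (θ * Complex.I)) := by
      intro θ
      have := (hsum θ).mul_left ((starRingEnd ℂ) (ρ * Complex.exp (θ * Complex.I)) ^ m)
      rw [← this.tsum_eq]
      refine tsum_congr fun j => ?_
      simp only [hF, map_mul, Complex.conj_ofReal]
      ring
    simp only [hts] at hS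
    refine hS.unique ?_
    have hterm : ∀ j, ∫ θ, F j θ ∂angleMeasure = if j = m then ρ ^ (2 * m) * a m else 0 := by
      intro j
      simp only [hF]
      rw [integral_const_mul, integral_exp_int]
      split_ifs with h
      · subst h; ring
      · simp
    simp only [hterm]
    exact hasSum_ite_eq m _
  rw [integral_areaMeasure_polar hint]
  have h1 : ∫ ρ : ℝ, (∫ θ : ℝ, (starRingEnd ℂ) (ρ * Complex.exp (θ * Complex.I)) ^ m *
      k (ρ * Complex.exp (θ * Complex.I)) ∂angleMeasure) ∂radialMeasure =
      ∫ ρ : ℝ, (ρ : ℂ) ^ (2 * m) * a m ∂radialMeasure := by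
    refine integral_congr_ae ?_
    filter_upwards [ae_radialMeasure_mem] with ρ hρ using hinner ρ hρ
  rw [h1, integral_mul_const, integral_radialMeasure]
  have h2 : ∫ ρ in (0 : ℝ)..1, (2 * ρ : ℂ) * (ρ : ℂ) ^ (2 * m) =
      ((∫ ρ in (0 : ℝ)..1, 2 * ρ ^ (2 * m + 1) : ℝ) : ℂ) := by
    rw [← intervalIntegral.integral_ofReal]
    refine intervalIntegral.integral_congr fun ρ _ => ?_
    push_cast
    ring
  rw [h2, intervalIntegral.integral_const_mul, integral_pow]
  have : (m : ℂ) + 1 ≠ 0 := by exact_mod_cast m.succ_ne_zero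
  push_cast
  simp
  field_simp
  rw [show (2 : ℂ) * m + 1 + 1 = 2 * (m + 1) by ring]
  simp only [ha]
  field_simp

/-- Taylor coefficients of an extremal kernel. -/
lemma IsExtremal.taylor_coeff_eq {p q : ℝ} (hpq : p.HolderConjugate q) {k f : ℂ → ℂ}
    (hk : MemBergman q k) (hext : IsExtremal p k f) (m : ℕ) :
    (m.factorial : ℂ)⁻¹ * iteratedDeriv m k 0 =
      ((∫ z, f z * (starRingEnd ℂ) (k z) ∂areaMeasure).re : ℂ) * ((m + 1) *
        ∫ w, (starRingEnd ℂ) w ^ m * dualFunction p (f w) ∂areaMeasure) := by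
  have hki : Integrable k areaMeasure :=
    hk.memLp.integrable (by rw [ENNReal.one_le_ofReal]; exact hpq.symm.lt.le)
  -- Test the duality identity on w^m and conjugate.
  have h1 := congrArg (starRingEnd ℂ) (hext.integral_eq hpq hk (memBergman_pow p m))
  rw [map_mul, Complex.conj_ofReal, ← integral_conj, ← integral_conj] at h1
  simp only [map_mul, map_pow, Complex.conj_conj] at h1
  rw [integral_conj_pow_mul hk.1 hki] at h1
  have : (m : ℂ) + 1 ≠ 0 := by exact_mod_cast m.succ_ne_zero
  rw [div_eq_iff this] at h1
  rw [h1]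
  ring

/-! ### Zeros of f, and integration by parts along circles. -/

lemma countable_zeros {f : ℂ → ℂ} (hf : DifferentiableOn ℂ f disc) (hne : ∃ w ∈ disc, f w ≠ 0) :
    {w ∈ disc | f w = 0}.Countable := by
  obtain ⟨w₀, hw₀, hfw₀⟩ := hne
  have han : AnalyticOnNhd ℂ f disc := hf.analyticOnNhd isOpen_disc
  have hdisc : DiscreteTopology {w ∈ disc | f w = 0} := by
    rw [discreteTopology_subtype_iff]
    intro z hz
    have hev : ∀ᶠ w in 𝓝[≠] z, f w ≠ 0 := by
      by_contra hcon
      have hfr : ∃ᶠ w in 𝓝[≠] z, f w = 0 := by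
        rw [Filter.Frequently]; exact hcon
      exact hfw₀ (han.eqOn_zero_of_preconnected_of_frequently_eq_zero
        (convex_ball 0 1).isPreconnected hz.1 hfr hw₀)
    rw [← disjoint_iff, disjoint_principal_right]
    filter_upwards [hev] with w hw h using hw h.2
  exact countable_coe_iff.1 countable_of_Lindelof_of_discrete

/-- The moduli of the zeros form a countable set, so almost every circle avoids them all. On such a
circle |f|^{p-2}f is smooth and can be integrated by parts with no boundary terms. -/
lemma ae_radialMeasure_ne_zero {f : ℂ → ℂ} (hf : DifferentiableOn ℂ f disc)
    (hne : ∃ w ∈ disc, f w ≠ 0) :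
    ∀ᵐ ρ ∂radialMeasure, ρ ∈ Ioo (0 : ℝ) 1 ∧
      ∀ θ : ℝ, f (ρ * Complex.exp (θ * Complex.I)) ≠ 0 := by
  have hc : ((fun w : ℂ => ‖w‖) '' {w ∈ disc | f w = 0}).Countable := (countable_zeros hf hne).image _
  have h1 : ∀ᵐ ρ : ℝ, ρ ∉ (fun w : ℂ => ‖w‖) '' {w ∈ disc | f w = 0} := hc.ae_notMem _
  have h2 : ∀ᵐ ρ ∂radialMeasure, ρ ∉ (fun w : ℂ => ‖w‖) '' {w ∈ disc | f w = 0} :=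
    (withDensity_absolutelyContinuous _ _).ae_le (ae_restrict_of_ae h1)
  filter_upwards [ae_radialMeasure_mem, h2] with ρ hρ h2
  refine ⟨hρ, fun θ h => h2 ⟨ρ * Complex.exp (θ * Complex.I),
    ⟨mul_exp_mem_disc hρ.1.le hρ.2 θ, h⟩, norm_mul_exp hρ.1.le θ⟩⟩

/-- The derivative along the rotation field. -/
def rotDeriv (g : ℂ → ℂ) (w : ℂ) : ℂ := fderiv ℝ g w (Complex.I * w)

lemma contDiffOn_rotDeriv_iterate {g : ℂ → ℂ} {Ω : Set ℂ} (hΩ : IsOpen Ω)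
    (hg : ContDiffOn ℝ (⊤ : ℕ∞) g Ω) (i : ℕ) : ContDiffOn ℝ (⊤ : ℕ∞) (rotDeriv^[i] g) Ω := by
  induction i with
  | zero => simpa using hg
  | succ i ih =>
    rw [Function.iterate_succ_apply']
    exact (ih.fderiv_of_isOpen hΩ (by simp)).clm_apply (by fun_prop)

lemma hasDerivAt_rotDeriv {g : ℂ → ℂ} {Ω : Set ℂ} (hΩ : IsOpen Ω)
    (hg : ContDiffOn ℝ (⊤ : ℕ∞) g Ω) {ρ θ : ℝ} (h : (ρ : ℂ) * Complex.exp (θ * Complex.I) ∈ Ω) :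
    HasDerivAt (fun θ : ℝ => g (ρ * Complex.exp (θ * Complex.I)))
      (rotDeriv g (ρ * Complex.exp (θ * Complex.I))) θ := by
  have h1 := ((hg.differentiableOn (by simp)).differentiableAt (hΩ.mem_nhds h)).hasFDerivAt
  have h2 : HasDerivAt (fun θ : ℝ => (ρ : ℂ) * Complex.exp (θ * Complex.I))
      (Complex.I * (ρ * Complex.exp (θ * Complex.I))) θ := by
    have h3 := ((Complex.ofRealCLM.hasDerivAt (x := θ)).mul_const Complex.I).cexp.const_mul (ρ : ℂ)
    refine h3.congr_deriv ?_
    simp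
    ring
  exact h1.comp_hasDerivAt θ h2

lemma iteratedDeriv_comp_circle {g : ℂ → ℂ} {Ω : Set ℂ} (hΩ : IsOpen Ω)
    (hg : ContDiffOn ℝ (⊤ : ℕ∞) g Ω) {ρ : ℝ}
    (h : ∀ θ : ℝ, (ρ : ℂ) * Complex.exp (θ * Complex.I) ∈ Ω) (i : ℕ) :
    iteratedDeriv i (fun θ : ℝ => g (ρ * Complex.exp (θ * Complex.I))) =
      fun θ : ℝ => rotDeriv^[i] g (ρ * Complex.exp (θ * Complex.I)) := by
  induction i with
  | zero => simp
  | succ i ih =>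
    rw [iteratedDeriv_succ, ih]
    ext θ
    rw [Function.iterate_succ_apply']
    exact (hasDerivAt_rotDeriv hΩ (contDiffOn_rotDeriv_iterate hΩ hg i) (h θ)).deriv

/-- Integration by parts for the Fourier coefficients of a smooth function on a circle. -/
lemma integral_conj_pow_mul_rotDeriv {g : ℂ → ℂ} {Ω : Set ℂ} (hΩ : IsOpen Ω)
    (hg : ContDiffOn ℝ (⊤ : ℕ∞) g Ω) {ρ : ℝ}
    (h : ∀ θ : ℝ, (ρ : ℂ) * Complex.exp (θ * Complex.I) ∈ Ω) (m : ℕ) :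
    ∫ θ : ℝ, (starRingEnd ℂ) (ρ * Complex.exp (θ * Complex.I)) ^ m *
        rotDeriv g (ρ * Complex.exp (θ * Complex.I)) ∂angleMeasure =
      (m * Complex.I) * ∫ θ : ℝ, (starRingEnd ℂ) (ρ * Complex.exp (θ * Complex.I)) ^ m *
        g (ρ * Complex.exp (θ * Complex.I)) ∂angleMeasure := by
  have hcirc : Continuous fun θ : ℝ => (ρ : ℂ) * Complex.exp (θ * Complex.I) := by fun_prop
  have hgc : Continuous fun θ : ℝ => g (ρ * Complex.exp (θ * Complex.I)) := by
    rw [← continuousOn_univ]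
    exact hg.continuousOn.comp hcirc.continuousOn fun θ _ => h θ
  have hrc : Continuous fun θ : ℝ => rotDeriv g (ρ * Complex.exp (θ * Complex.I)) := by
    rw [← continuousOn_univ]
    exact (contDiffOn_rotDeriv_iterate hΩ hg 1).continuousOn.comp hcirc.continuousOn fun θ _ => h θ
  set e : ℝ → ℂ := fun θ => (starRingEnd ℂ) (ρ * Complex.exp (θ * Complex.I)) ^ m with he
  have heq : e = fun θ : ℝ => (ρ : ℂ) ^ m * Complex.exp (θ * (-(m * Complex.I))) := by
    ext θ
    simp only [he, map_mul, Complex.conj_ofReal, mul_pow, ← Complex.exp_conj,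
      ← Complex.exp_nat_mul, Complex.conj_I]
    ring_nf
  have hed : ∀ θ, HasDerivAt e (-(m * Complex.I) * e θ) θ := by
    intro θ
    rw [heq]
    have h3 := ((Complex.ofRealCLM.hasDerivAt (x := θ)).mul_const
      (-(m * Complex.I))).cexp.const_mul ((ρ : ℂ) ^ m)
    refine h3.congr_deriv ?_
    simp
    ring
  have hec : Continuous e := by rw [heq]; fun_prop
  have hibp := intervalIntegral.integral_mul_deriv_eq_deriv_mul (a := 0) (b := 2 * Real.pi)
    (u := e) (v := fun θ : ℝ => g (ρ * Complex.exp (θ * Complex.I)))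
    (fun θ _ => hed θ) (fun θ _ => hasDerivAt_rotDeriv hΩ hg (h θ))
    ((continuous_const.mul hec).intervalIntegrable _ _) (hrc.intervalIntegrable _ _)
  have hper1 : e (2 * Real.pi) = e 0 := by
    simp [he]
  have hper2 : g (ρ * Complex.exp ((2 * Real.pi : ℝ) * Complex.I)) =
      g (ρ * Complex.exp ((0 : ℝ) * Complex.I)) := by
    simp
  rw [hper1, hper2, sub_self, zero_sub] at hibp
  have hneg : -∫ θ in (0)..(2 * Real.pi), -(m * Complex.I) * e θ *
      g (ρ * Complex.exp (θ * Complex.I)) = (m * Complex.I) *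
        ∫ θ in (0)..(2 * Real.pi), e θ * g (ρ * Complex.exp (θ * Complex.I)) := by
    rw [← intervalIntegral.integral_neg, ← intervalIntegral.integral_const_mul]
    refine intervalIntegral.integral_congr fun θ _ => ?_
    ring
  rw [integral_angleMeasure, integral_angleMeasure, hibp, hneg]
  ring

lemma integral_conj_pow_mul_rotDeriv_iterate {g : ℂ → ℂ} {Ω : Set ℂ} (hΩ : IsOpen Ω)
    (hg : ContDiffOn ℝ (⊤ : ℕ∞) g Ω) {ρ : ℝ}
    (h : ∀ θ : ℝ, (ρ : ℂ) * Complex.exp (θ * Complex.I) ∈ Ω) (m i : ℕ) :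
    ∫ θ : ℝ, (starRingEnd ℂ) (ρ * Complex.exp (θ * Complex.I)) ^ m *
        rotDeriv^[i] g (ρ * Complex.exp (θ * Complex.I)) ∂angleMeasure =
      (m * Complex.I) ^ i * ∫ θ : ℝ, (starRingEnd ℂ) (ρ * Complex.exp (θ * Complex.I)) ^ m *
        g (ρ * Complex.exp (θ * Complex.I)) ∂angleMeasure := by
  induction i with
  | zero => simp
  | succ i ih =>
    rw [Function.iterate_succ_apply', integral_conj_pow_mul_rotDeriv hΩ
      (contDiffOn_rotDeriv_iterate hΩ hg i) h, ih]
    ring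

/-- The differential operator along circles whose symbol is the falling factorial of order `n`. -/
def fallingRotDeriv (n : ℕ) (g : ℂ → ℂ) (w : ℂ) : ℂ :=
  ∑ i ∈ Finset.range (n + 1), ((descPochhammer ℂ n).coeff i * (-Complex.I) ^ i) * rotDeriv^[i] g w

/-- Against w̄^m, each -i∂_θ becomes multiplication by m, so the polynomial in this operator is
evaluated at m. -/
lemma integral_conj_pow_mul_fallingRotDeriv {g : ℂ → ℂ} {Ω : Set ℂ} (hΩ : IsOpen Ω)
    (hg : ContDiffOn ℝ (⊤ : ℕ∞) g Ω) {ρ : ℝ}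
    (h : ∀ θ : ℝ, (ρ : ℂ) * Complex.exp (θ * Complex.I) ∈ Ω) (m n : ℕ) :
    ∫ θ : ℝ, (starRingEnd ℂ) (ρ * Complex.exp (θ * Complex.I)) ^ m *
        fallingRotDeriv n g (ρ * Complex.exp (θ * Complex.I)) ∂angleMeasure =
      m.descFactorial n * ∫ θ : ℝ, (starRingEnd ℂ) (ρ * Complex.exp (θ * Complex.I)) ^ m *
        g (ρ * Complex.exp (θ * Complex.I)) ∂angleMeasure := by
  have hcirc : Continuous fun θ : ℝ => (ρ : ℂ) * Complex.exp (θ * Complex.I) := by fun_prop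
  have hec : Continuous fun θ : ℝ => (starRingEnd ℂ) (ρ * Complex.exp (θ * Complex.I)) ^ m :=
    (Complex.continuous_conj.comp hcirc).pow m
  have hci : ∀ i, Integrable (fun θ : ℝ => (starRingEnd ℂ) (ρ * Complex.exp (θ * Complex.I)) ^ m *
      rotDeriv^[i] g (ρ * Complex.exp (θ * Complex.I))) angleMeasure := by
    intro i
    have hrc : Continuous fun θ : ℝ => rotDeriv^[i] g (ρ * Complex.exp (θ * Complex.I)) := by
      rw [← continuousOn_univ]
      exact (contDiffOn_rotDeriv_iterate hΩ hg i).continuousOn.comp hcirc.continuousOn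
        fun θ _ => h θ
    have h1 := (hec.mul hrc).integrableOn_Icc (a := 0) (b := 2 * Real.pi) (μ := volume)
    have h2 := h1.mono_set Ioc_subset_Icc_self
    exact Integrable.smul_measure h2 (ENNReal.inv_ne_top.2 ofReal_two_pi_ne_zero)
  have h1 : ∀ θ : ℝ, (starRingEnd ℂ) (ρ * Complex.exp (θ * Complex.I)) ^ m *
        fallingRotDeriv n g (ρ * Complex.exp (θ * Complex.I)) =
      ∑ i ∈ Finset.range (n + 1), ((descPochhammer ℂ n).coeff i * (-Complex.I) ^ i) *
        ((starRingEnd ℂ) (ρ * Complex.exp (θ * Complex.I)) ^ m *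
          rotDeriv^[i] g (ρ * Complex.exp (θ * Complex.I))) := by
    intro θ
    rw [fallingRotDeriv, Finset.mul_sum]
    refine Finset.sum_congr rfl fun i _ => ?_
    ring
  simp only [h1]
  rw [integral_finsetSum _ fun i _ => (hci i).const_mul _]
  simp only [integral_const_mul, integral_conj_pow_mul_rotDeriv_iterate hΩ hg h m]
  rw [← descPochhammer_eval_eq_descFactorial, Polynomial.eval_eq_sum_range,
    descPochhammer_natDegree, Finset.sum_mul]
  refine Finset.sum_congr rfl fun i _ => ?_
  have hI : (-Complex.I) ^ i * (m * Complex.I) ^ i = (m : ℂ) ^ i := by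
    rw [← mul_pow]
    congr 1
    linear_combination (-(m : ℂ)) * Complex.I_mul_I
  rw [← hI]
  ring

/-! ### Pointwise derivatives of |F|^{p-2}F. -/

lemma contDiffOn_dualFunction (p : ℝ) : ContDiffOn ℝ (⊤ : ℕ∞) (dualFunction p) {0}ᶜ := by
  intro z hz
  have hz' : z ≠ 0 := hz
  have h1 : ContDiffAt ℝ (⊤ : ℕ∞) (fun z : ℂ => ‖z‖ ^ (p - 2)) z :=
    (contDiffAt_norm ℝ hz').rpow_const_of_ne (norm_ne_zero_iff.2 hz')
  exact ((Complex.ofRealCLM.contDiff.contDiffAt.comp z h1).mul contDiffAt_id).contDiffWithinAt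

lemma dualFunction_smul {p : ℝ} {c : ℝ} (hc : 0 < c) (z : ℂ) :
    dualFunction p ((c : ℂ) * z) = ((c ^ (p - 1) : ℝ) : ℂ) * dualFunction p z := by
  rw [dualFunction, dualFunction, norm_mul, Complex.norm_real, Real.norm_of_nonneg hc.le,
    Real.mul_rpow hc.le (norm_nonneg _), show p - 1 = p - 2 + 1 by ring, Real.rpow_add_one hc.ne']
  push_cast
  ring

/-- A Faà di Bruno type estimate for `|F|^{p-2} F` that is linear in the top derivative of `F`. -/
lemma exists_norm_iteratedDeriv_dualFunction_comp_le {n : ℕ} (hn : 1 ≤ n) {p : ℝ}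
    (hp : (n : ℝ) + 1 ≤ p) :
    ∃ C : ℝ, 0 ≤ C ∧ ∀ F : ℝ → ℂ, ContDiff ℝ (⊤ : ℕ∞) F → (∀ θ, F θ ≠ 0) → ∀ θ A B : ℝ,
      (∀ j < n, ‖iteratedDeriv j F θ‖ ≤ A) → A ≤ B → ‖iteratedDeriv n F θ‖ ≤ B →
      ∀ i ≤ n, ‖iteratedDeriv i (fun θ => dualFunction p (F θ)) θ‖ ≤ C * (A ^ (p - 2) * B) := by
  have hopen : IsOpen ({0}ᶜ : Set ℂ) := isOpen_compl_singleton
  have hu : UniqueDiffOn ℝ ({0}ᶜ : Set ℂ) := hopen.uniqueDiffOn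
  have hn1 : (1 : ℝ) ≤ n := by exact_mod_cast hn
  -- The dual function is singular at 0 but homogeneous of degree p - 1. After dividing F by c = |F
  -- θ|, its derivatives are needed only on the compact unit circle.
  have hK : ∃ K : ℝ, 0 ≤ K ∧ ∀ j ≤ n, ∀ z : ℂ, ‖z‖ = 1 →
      ‖iteratedFDerivWithin ℝ j (dualFunction p) {0}ᶜ z‖ ≤ K := by
    have h1 : ∀ j : ℕ, ∃ K : ℝ, ∀ z ∈ Metric.sphere (0 : ℂ) 1,
        ‖iteratedFDerivWithin ℝ j (dualFunction p) {0}ᶜ z‖ ≤ K := fun j => by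
      refine (isCompact_sphere (0 : ℂ) 1).exists_bound_of_continuousOn ?_
      refine ((contDiffOn_dualFunction p).continuousOn_iteratedFDerivWithin
        (by exact_mod_cast le_top) hu).mono fun z hz => ?_
      rw [mem_sphere_zero_iff_norm] at hz
      exact norm_ne_zero_iff.1 (by rw [hz]; exact one_ne_zero)
    choose K hK using h1
    refine ⟨∑ j ∈ Finset.range (n + 1), |K j|, by positivity, fun j hj z hz => ?_⟩
    refine (hK j z (mem_sphere_zero_iff_norm.2 hz)).trans ((le_abs_self _).trans ?_)
    exact Finset.single_le_sum (f := fun j => |K j|) (fun _ _ => abs_nonneg _)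
      (Finset.mem_range.2 (by omega))
  obtain ⟨K, hK0, hK⟩ := hK
  refine ⟨n.factorial * K * 2, by positivity, fun F hF hF0 θ A B hA hAB hB i hi => ?_⟩
  set c := ‖F θ‖ with hcdef
  have hc : 0 < c := norm_pos_iff.2 (hF0 θ)
  have hcA : c ≤ A := by simpa using hA 0 (by omega)
  have hA0 : 0 < A := hc.trans_le hcA
  have hB0 : 0 < B := hA0.trans_le hAB
  set G : ℝ → ℂ := fun θ => (c⁻¹ : ℂ) * F θ with hG
  have hGd : ContDiff ℝ (⊤ : ℕ∞) G := contDiff_const.mul hF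
  have hGj : ∀ j, ‖iteratedDeriv j G θ‖ = ‖iteratedDeriv j F θ‖ / c := fun j => by
    rw [hG, iteratedDeriv_const_mul_field, norm_mul, norm_inv, Complex.norm_real,
      Real.norm_of_nonneg hc.le]
    ring
  have hGθ : ‖G θ‖ = 1 := by
    simp only [hG]
    rw [norm_mul, norm_inv, Complex.norm_real, Real.norm_of_nonneg hc.le, inv_mul_cancel₀ hc.ne']
  -- The composition bound needs the j-th derivative to be at most D^j. The first entry handles j <
  -- n since D ≥ 1. The second handles j = n and keeps D^n ≤ (A/c)^n + B/c linear in B.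
  set D : ℝ := max (A / c) ((B / c) ^ (1 / (n : ℝ))) with hD
  have hac : 1 ≤ A / c := by rwa [one_le_div hc]
  have hD1 : 1 ≤ D := hac.trans (le_max_left _ _)
  have hn0 : (n : ℝ) ≠ 0 := by positivity
  have hDn : B / c ≤ D ^ n := by
    calc B / c = ((B / c) ^ (1 / (n : ℝ))) ^ n := by
          rw [← Real.rpow_natCast, ← Real.rpow_mul (by positivity), one_div_mul_cancel hn0,
            Real.rpow_one]
      _ ≤ D ^ n := by gcongr; exact le_max_right _ _
  have hDn' : D ^ n ≤ (A / c) ^ n + B / c := by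
    rcases max_cases (A / c) ((B / c) ^ (1 / (n : ℝ))) with ⟨h, -⟩ | ⟨h, -⟩
    · rw [hD, h]
      have : 0 ≤ B / c := by positivity
      linarith
    · rw [hD, h, ← Real.rpow_natCast, ← Real.rpow_mul (by positivity), one_div_mul_cancel hn0,
        Real.rpow_one]
      have : 0 ≤ (A / c) ^ n := by positivity
      linarith
  have hcomp : ‖iteratedDeriv i (fun θ => dualFunction p (G θ)) θ‖ ≤ i.factorial * K * D ^ i := by
    have h1 := norm_iteratedFDerivWithin_comp_le (𝕜 := ℝ) (g := dualFunction p) (f := G) (n := i)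
      (s := univ) (t := {0}ᶜ) (x := θ) (contDiffOn_dualFunction p) hGd.contDiffOn
      (by exact_mod_cast le_top) hu uniqueDiffOn_univ
      (fun x _ => mul_ne_zero (inv_ne_zero (by exact_mod_cast hc.ne')) (hF0 x)) (mem_univ _)
      (C := K) (D := D) (fun j hj => hK j (hj.trans hi) _ hGθ) ?_
    · rw [iteratedFDerivWithin_univ, norm_iteratedFDeriv_eq_norm_iteratedDeriv] at h1
      exact h1
    · intro j hj1 hji
      rw [iteratedFDerivWithin_univ, norm_iteratedFDeriv_eq_norm_iteratedDeriv, hGj]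
      rcases (hji.trans hi).lt_or_eq with hjn | rfl
      · calc _ ≤ A / c := by gcongr; exact hA j hjn
          _ ≤ D := le_max_left _ _
          _ ≤ D ^ j := le_self_pow₀ hD1 (by omega)
      · refine le_trans ?_ hDn
        gcongr
  have hscale : (fun θ => dualFunction p (F θ)) =
      fun θ => ((c ^ (p - 1) : ℝ) : ℂ) * dualFunction p (G θ) := by
    ext θ
    rw [← dualFunction_smul hc, hG]
    have : (c : ℂ) ≠ 0 := by exact_mod_cast hc.ne'
    congr 1
    field_simp
  rw [hscale, iteratedDeriv_const_mul_field, norm_mul, Complex.norm_real,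
    Real.norm_of_nonneg (by positivity)]
  have hfac : (i.factorial : ℝ) ≤ n.factorial := by exact_mod_cast Nat.factorial_le hi
  -- This is where p ≥ n + 1 enters: the exponent p - 1 - n is nonnegative, so c^{p-1-n} can be
  -- replaced by A^{p-1-n} however small c is.
  have hmain : c ^ (p - 1) * ((A / c) ^ n + B / c) ≤ 2 * (A ^ (p - 2) * B) := by
    have e1 : c ^ (p - 1) * (A / c) ^ n = c ^ (p - 1 - n) * A ^ n := by
      rw [div_pow, Real.rpow_sub_natCast hc.ne']
      ring
    have e2 : c ^ (p - 1) * (B / c) = c ^ (p - 2) * B := by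
      rw [show p - 1 = p - 2 + 1 by ring, Real.rpow_add_one hc.ne']
      field_simp
    have e3 : c ^ (p - 1 - n) * A ^ n ≤ A ^ (p - 2) * B := by
      calc c ^ (p - 1 - n) * A ^ n ≤ A ^ (p - 1 - n) * A ^ n := by
            gcongr; linarith
        _ = A ^ (p - 2) * A := by
            rw [← Real.rpow_natCast A n, ← Real.rpow_add hA0, ← Real.rpow_add_one hA0.ne']
            ring_nf
        _ ≤ _ := by gcongr
    have e4 : c ^ (p - 2) * B ≤ A ^ (p - 2) * B := by
      gcongr; linarith
    rw [mul_add, e1, e2]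
    linarith
  calc c ^ (p - 1) * ‖iteratedDeriv i (fun θ => dualFunction p (G θ)) θ‖
      ≤ c ^ (p - 1) * (n.factorial * K * ((A / c) ^ n + B / c)) := by
        gcongr
        refine hcomp.trans ?_
        gcongr
        exact (pow_le_pow_right₀ hD1 hi).trans hDn'
    _ = n.factorial * K * (c ^ (p - 1) * ((A / c) ^ n + B / c)) := by ring
    _ ≤ n.factorial * K * (2 * (A ^ (p - 2) * B)) := by gcongr
    _ = _ := by ring

/-! ### Angular versus complex derivatives, and the means of the jet of f. -/

lemma differentiableOn_iteratedDeriv {f : ℂ → ℂ} (hf : DifferentiableOn ℂ f disc) (j : ℕ) :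
    DifferentiableOn ℂ (iteratedDeriv j f) disc := by
  induction j with
  | zero => simpa using hf
  | succ j ih => rw [iteratedDeriv_succ]; exact differentiableOn_deriv_disc ih

/-- On analytic functions ∂_θ acts as i z d/dz, and expanding its powers produces i-powers times
Stirling numbers of the second kind. The coefficients do not depend on f, ρ or θ. -/
lemma exists_iteratedDeriv_circle_eq (i : ℕ) : ∃ c : ℕ → ℂ, ∀ f : ℂ → ℂ,
    DifferentiableOn ℂ f disc → ∀ ρ ∈ Ico (0 : ℝ) 1, ∀ θ : ℝ,
      iteratedDeriv i (fun θ : ℝ => f (ρ * Complex.exp (θ * Complex.I))) θ =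
        ∑ j ∈ Finset.range (i + 1), c j * ((ρ * Complex.exp (θ * Complex.I)) ^ j *
          iteratedDeriv j f (ρ * Complex.exp (θ * Complex.I))) := by
  -- The vanishing of c beyond i is added to the induction so that the two sums from the product
  -- rule can be extended to a common range.
  suffices h : ∃ c : ℕ → ℂ, (∀ j, i < j → c j = 0) ∧ ∀ f : ℂ → ℂ,
      DifferentiableOn ℂ f disc → ∀ ρ ∈ Ico (0 : ℝ) 1, ∀ θ : ℝ,
      iteratedDeriv i (fun θ : ℝ => f (ρ * Complex.exp (θ * Complex.I))) θ =
        ∑ j ∈ Finset.range (i + 1), c j * ((ρ * Complex.exp (θ * Complex.I)) ^ j *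
          iteratedDeriv j f (ρ * Complex.exp (θ * Complex.I))) by
    obtain ⟨c, -, hc⟩ := h
    exact ⟨c, hc⟩
  induction i with
  | zero => exact ⟨fun j => if j = 0 then 1 else 0, fun j hj => by simp; omega, by simp⟩
  | succ i ih =>
    obtain ⟨c, hc0, hc⟩ := ih
    refine ⟨fun j => Complex.I * (j * c j + if j = 0 then 0 else c (j - 1)), fun j hj => ?_,
      fun f hf ρ hρ θ => ?_⟩
    · simp only
      rw [hc0 j (by omega), hc0 (j - 1) (by omega)]
      simp
    · rw [iteratedDeriv_succ, funext fun θ => hc f hf ρ hρ θ]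
      set w : ℂ := ρ * Complex.exp (θ * Complex.I) with hw
      have hpow : ∀ j : ℕ, HasDerivAt (fun θ : ℝ => ((ρ : ℂ) * Complex.exp (θ * Complex.I)) ^ j)
          (Complex.I * (j * w ^ j)) θ := by
        intro j
        have h2 : HasDerivAt (fun θ : ℝ => (ρ : ℂ) * Complex.exp (θ * Complex.I))
            (w * Complex.I) θ := by
          have h3 := ((Complex.ofRealCLM.hasDerivAt (x := θ)).mul_const
            Complex.I).cexp.const_mul (ρ : ℂ)
          simpa [mul_assoc, hw] using h3
        refine (h2.pow j).congr_deriv ?_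
        rcases j with _ | j
        · simp
        · simp only [Nat.add_sub_cancel, ← hw]
          ring
      have hterm : ∀ j : ℕ, HasDerivAt (fun θ : ℝ => c j *
          (((ρ : ℂ) * Complex.exp (θ * Complex.I)) ^ j *
            iteratedDeriv j f (ρ * Complex.exp (θ * Complex.I))))
          (Complex.I * (j * c j) * (w ^ j * iteratedDeriv j f w) +
            Complex.I * c j * (w ^ (j + 1) * iteratedDeriv (j + 1) f w)) θ := by
        intro j
        have h1 := hasDerivAt_circle (differentiableOn_iteratedDeriv hf j) hρ.1 hρ.2 θ
        rw [← iteratedDeriv_succ] at h1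
        refine (((hpow j).mul h1).const_mul (c j)).congr_deriv ?_
        simp only [← hw]
        ring
      rw [(HasDerivAt.fun_sum fun j _ => hterm j).deriv, Finset.sum_add_distrib]
      have e1 : ∑ j ∈ Finset.range (i + 1), Complex.I * (j * c j) * (w ^ j * iteratedDeriv j f w) =
          ∑ j ∈ Finset.range (i + 1 + 1), Complex.I * (j * c j) * (w ^ j * iteratedDeriv j f w) := by
        rw [Finset.sum_range_succ _ (i + 1), hc0 (i + 1) (by omega)]
        simp
      have e2 : ∑ j ∈ Finset.range (i + 1),
            Complex.I * c j * (w ^ (j + 1) * iteratedDeriv (j + 1) f w) =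
          ∑ j ∈ Finset.range (i + 1 + 1), Complex.I * (if j = 0 then 0 else c (j - 1)) *
            (w ^ j * iteratedDeriv j f w) := by
        rw [Finset.sum_range_succ' _ (i + 1)]
        simp
      rw [e1, e2, ← Finset.sum_add_distrib]
      refine Finset.sum_congr rfl fun j _ => ?_
      ring

lemma memHardy_of_memHardy_deriv {s : ℝ≥0∞} (hs : 1 ≤ s) {G : ℂ → ℂ}
    (hG : DifferentiableOn ℂ G disc) (hG' : MemHardy s (deriv G)) : MemHardy s G := by
  -- The majorant is constant in t; the added 1 keeps it nonzero, as Minkowski's inequality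
  -- requires.
  refine memHardy_of_integralMean_deriv_le hs hG
    (N := fun _ => (⨆ r ∈ Ico (0 : ℝ) 1, integralMean s r (deriv G)) + 1) measurable_const
    (fun t _ => by simp) (fun t ht => ?_) ?_
  · exact (le_iSup₂_of_le (f := fun r (_ : r ∈ Ico (0 : ℝ) 1) => integralMean s r (deriv G))
      t ht le_rfl).trans le_self_add
  · simp only [lintegral_const, Measure.restrict_apply_univ, Real.volume_Ico, sub_zero,
      ENNReal.ofReal_one, mul_one]
    exact ENNReal.add_ne_top.2 ⟨hG'.2.ne, ENNReal.one_ne_top⟩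

lemma memHardy_iteratedDeriv_of_le {s : ℝ≥0∞} (hs : 1 ≤ s) {f : ℂ → ℂ}
    (hf : DifferentiableOn ℂ f disc) {j N : ℕ} (hj : j ≤ N)
    (h : MemHardy s (iteratedDeriv N f)) : MemHardy s (iteratedDeriv j f) := by
  induction N, hj using Nat.le_induction with
  | base => exact h
  | succ N _ ih =>
    rw [iteratedDeriv_succ] at h
    exact ih (memHardy_of_memHardy_deriv hs (differentiableOn_iteratedDeriv hf N) h)

/-- Hölder with exponents s/P and s, whose reciprocals add up to (P+1)/s. With P = p - 2 this is the
origin of the exponent s/(p-1). -/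
lemma eLpNorm_rpow_mul_le {X : Type*} [MeasurableSpace X] {μ : Measure X} {a b : X → ℝ}
    (ha : AEStronglyMeasurable a μ) (ha0 : ∀ x, 0 ≤ a x) (hb : AEStronglyMeasurable b μ) {P : ℝ}
    (hP : 0 ≤ P) (s : ℝ≥0∞) :
    eLpNorm (fun x => a x ^ P * b x) (s / ENNReal.ofReal (P + 1)) μ ≤
      eLpNorm a s μ ^ P * eLpNorm b s μ := by
  rcases hP.eq_or_lt with rfl | hP
  · simp
  have hPne : ENNReal.ofReal P ≠ 0 := (ENNReal.ofReal_pos.2 hP).ne'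
  have hP1 : ENNReal.ofReal (P + 1) ≠ 0 := (ENNReal.ofReal_pos.2 (by linarith)).ne'
  have hT : ENNReal.HolderTriple (s / ENNReal.ofReal P) s (s / ENNReal.ofReal (P + 1)) := by
    constructor
    rw [ENNReal.inv_div (Or.inl ENNReal.ofReal_ne_top) (Or.inl hPne),
      ENNReal.inv_div (Or.inl ENNReal.ofReal_ne_top) (Or.inl hP1),
      ENNReal.ofReal_add hP.le zero_le_one, ENNReal.add_div, ENNReal.ofReal_one, one_div]
  have hm : AEStronglyMeasurable (fun x => a x ^ P) μ :=
    (ha.aemeasurable.pow_const _).aestronglyMeasurable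
  have h1 := eLpNorm_smul_le_mul_eLpNorm (p := s / ENNReal.ofReal P) (q := s)
    (r := s / ENNReal.ofReal (P + 1)) hb hm
  have h2 : eLpNorm (fun x => a x ^ P) (s / ENNReal.ofReal P) μ = eLpNorm a s μ ^ P := by
    have h3 := eLpNorm_norm_rpow (μ := μ) (p := s / ENNReal.ofReal P) a hP
    rw [ENNReal.div_mul_cancel hPne ENNReal.ofReal_ne_top] at h3
    rw [← h3]
    congr 1
    ext x
    rw [Real.norm_of_nonneg (ha0 x)]
  rw [h2] at h1
  exact h1

/-- The sum of the absolute values of the first `n` derivatives. -/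
def jetNorm (n : ℕ) (f : ℂ → ℂ) (w : ℂ) : ℝ := ∑ j ∈ Finset.range n, ‖iteratedDeriv j f w‖

lemma jetNorm_nonneg (n : ℕ) (f : ℂ → ℂ) (w : ℂ) : 0 ≤ jetNorm n f w :=
  Finset.sum_nonneg fun _ _ => norm_nonneg _

lemma jetNorm_mono {m n : ℕ} (h : m ≤ n) (f : ℂ → ℂ) (w : ℂ) : jetNorm m f w ≤ jetNorm n f w :=
  Finset.sum_le_sum_of_subset_of_nonneg (Finset.range_mono h) fun _ _ _ => norm_nonneg _

lemma continuous_jetNorm_circle {f : ℂ → ℂ} (hf : DifferentiableOn ℂ f disc) (n : ℕ) {ρ : ℝ}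
    (hρ : ρ ∈ Ico (0 : ℝ) 1) :
    Continuous fun θ : ℝ => jetNorm n f (ρ * Complex.exp (θ * Complex.I)) := by
  unfold jetNorm
  exact continuous_finsetSum _ fun j _ =>
    (continuous_comp_circle (differentiableOn_iteratedDeriv hf j).continuousOn hρ.1 hρ.2).norm

lemma exists_eLpNorm_jetNorm_le {s : ℝ≥0∞} (hs : 1 ≤ s) {f : ℂ → ℂ}
    (hf : DifferentiableOn ℂ f disc) {n : ℕ}
    (h : ∀ j < n, MemHardy s (iteratedDeriv j f)) :
    ∃ M : ℝ, 0 ≤ M ∧ ∀ ρ ∈ Ico (0 : ℝ) 1,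
      eLpNorm (fun θ : ℝ => jetNorm n f (ρ * Complex.exp (θ * Complex.I))) s angleMeasure ≤
        ENNReal.ofReal M := by
  set S : ℝ≥0∞ := ∑ j ∈ Finset.range n, ⨆ r ∈ Ico (0 : ℝ) 1, integralMean s r (iteratedDeriv j f)
    with hS
  have hSt : S ≠ ∞ := by
    rw [hS]
    exact (ENNReal.sum_lt_top.2 fun j hj => (h j (Finset.mem_range.1 hj)).2).ne
  refine ⟨S.toReal, ENNReal.toReal_nonneg, fun ρ hρ => ?_⟩
  rw [ENNReal.ofReal_toReal hSt]
  have h1 : (fun θ : ℝ => jetNorm n f (ρ * Complex.exp (θ * Complex.I))) =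
      ∑ j ∈ Finset.range n, fun θ : ℝ => ‖iteratedDeriv j f (ρ * Complex.exp (θ * Complex.I))‖ := by
    ext θ
    simp [jetNorm]
  rw [h1]
  refine (eLpNorm_sum_le (fun j _ => (continuous_comp_circle (differentiableOn_iteratedDeriv hf
    j).continuousOn hρ.1 hρ.2).norm.aestronglyMeasurable) hs).trans ?_
  refine Finset.sum_le_sum fun j _ => ?_
  rw [eLpNorm_norm]
  exact le_iSup₂_of_le (f := fun r (_ : r ∈ Ico (0 : ℝ) 1) => integralMean s r (iteratedDeriv j f))
    ρ hρ le_rfl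

lemma exists_norm_iteratedDeriv_circle_le (n : ℕ) : ∃ K : ℝ, 1 ≤ K ∧ ∀ f : ℂ → ℂ,
    DifferentiableOn ℂ f disc → ∀ ρ ∈ Ico (0 : ℝ) 1, ∀ θ : ℝ, ∀ i ≤ n,
      ‖iteratedDeriv i (fun θ : ℝ => f (ρ * Complex.exp (θ * Complex.I))) θ‖ ≤
        K * jetNorm (i + 1) f (ρ * Complex.exp (θ * Complex.I)) := by
  choose c hc using exists_iteratedDeriv_circle_eq
  refine ⟨1 + ∑ i ∈ Finset.range (n + 1), ∑ j ∈ Finset.range (n + 1), ‖c i j‖,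
    le_add_of_nonneg_right (by positivity), fun f hf ρ hρ θ i hi => ?_⟩
  rw [hc i f hf ρ hρ θ, jetNorm, Finset.mul_sum]
  refine (norm_sum_le _ _).trans (Finset.sum_le_sum fun j hj => ?_)
  rw [Finset.mem_range] at hj
  rw [norm_mul, norm_mul, norm_pow, norm_mul_exp hρ.1]
  have hρ0 := hρ.1
  have h1 : ‖c i j‖ ≤ 1 + ∑ i ∈ Finset.range (n + 1), ∑ j ∈ Finset.range (n + 1), ‖c i j‖ := by
    have e1 := Finset.single_le_sum (f := fun j => ‖c i j‖) (s := Finset.range (n + 1))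
      (fun _ _ => norm_nonneg _) (Finset.mem_range.2 (show j < n + 1 by omega))
    have e2 := Finset.single_le_sum (f := fun i => ∑ j ∈ Finset.range (n + 1), ‖c i j‖)
      (s := Finset.range (n + 1)) (fun _ _ => Finset.sum_nonneg fun _ _ => norm_nonneg _)
      (Finset.mem_range.2 (show i < n + 1 by omega))
    linarith
  gcongr
  exact mul_le_of_le_one_left (norm_nonneg _) (pow_le_one₀ hρ.1 hρ.2.le)

/-! ### The density v: size, integrability and moments. -/

/-- The points of the disc at which `f` does not vanish. -/
def nonzeroSet (f : ℂ → ℂ) : Set ℂ := disc ∩ f ⁻¹' {0}ᶜ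

lemma isOpen_nonzeroSet {f : ℂ → ℂ} (hf : DifferentiableOn ℂ f disc) : IsOpen (nonzeroSet f) :=
  hf.continuousOn.isOpen_inter_preimage isOpen_disc isOpen_compl_singleton

lemma contDiffOn_real_of_differentiableOn {f : ℂ → ℂ} (hf : DifferentiableOn ℂ f disc) :
    ContDiffOn ℝ (⊤ : ℕ∞) f disc :=
  (hf.contDiffOn isOpen_disc).restrict_scalars ℝ

lemma contDiffOn_dualFunction_comp (p : ℝ) {f : ℂ → ℂ} (hf : DifferentiableOn ℂ f disc) :
    ContDiffOn ℝ (⊤ : ℕ∞) (fun w => dualFunction p (f w)) (nonzeroSet f) :=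
  (contDiffOn_dualFunction p).comp
    ((contDiffOn_real_of_differentiableOn hf).mono inter_subset_left) fun _ hw => hw.2

/-- The function with moments `∫ w̄^m v dσ = m(m-1)⋯(m-n+1) ∫ w̄^m |f|^{p-2} f dσ`. -/
def dualDeriv (p : ℝ) (n : ℕ) (f : ℂ → ℂ) : ℂ → ℂ :=
  (nonzeroSet f).indicator (fallingRotDeriv n fun w => dualFunction p (f w))

lemma measurable_dualDeriv (p : ℝ) (n : ℕ) {f : ℂ → ℂ} (hf : DifferentiableOn ℂ f disc) :
    Measurable (dualDeriv p n f) := by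
  have hΩ := isOpen_nonzeroSet hf
  have hc : ContinuousOn (fallingRotDeriv n fun w => dualFunction p (f w)) (nonzeroSet f) := by
    unfold fallingRotDeriv
    exact continuousOn_finsetSum _ fun i _ => continuousOn_const.mul
      (contDiffOn_rotDeriv_iterate hΩ (contDiffOn_dualFunction_comp p hf) i).continuousOn
  classical
  have := hc.measurable_piecewise (g := (0 : ℂ → ℂ)) continuousOn_const hΩ.measurableSet
  rwa [piecewise_eq_indicator] at this

lemma dualDeriv_circle (p : ℝ) (n : ℕ) {f : ℂ → ℂ} {ρ : ℝ} (hρ : ρ ∈ Ioo (0 : ℝ) 1)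
    (hne : ∀ θ : ℝ, f (ρ * Complex.exp (θ * Complex.I)) ≠ 0) (θ : ℝ) :
    dualDeriv p n f (ρ * Complex.exp (θ * Complex.I)) =
      fallingRotDeriv n (fun w => dualFunction p (f w)) (ρ * Complex.exp (θ * Complex.I)) := by
  have hmem : (ρ : ℂ) * Complex.exp (θ * Complex.I) ∈ nonzeroSet f :=
    ⟨mul_exp_mem_disc hρ.1.le hρ.2 θ, hne θ⟩
  exact indicator_of_mem hmem _

/-- Apply the composition estimate with A and B multiples of the jets of length n and n + 1. What
matters later is that f^{(n)}, the only derivative not known to be in H^s, occurs to the first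
power. -/
lemma exists_norm_dualDeriv_le {n : ℕ} (hn : 1 ≤ n) {p : ℝ} (hp : (n : ℝ) + 1 ≤ p) :
    ∃ K : ℝ, 0 ≤ K ∧ ∀ f : ℂ → ℂ, DifferentiableOn ℂ f disc → ∀ ρ ∈ Ioo (0 : ℝ) 1,
      (∀ θ : ℝ, f (ρ * Complex.exp (θ * Complex.I)) ≠ 0) → ∀ θ : ℝ,
        ‖dualDeriv p n f (ρ * Complex.exp (θ * Complex.I))‖ ≤
          K * (jetNorm n f (ρ * Complex.exp (θ * Complex.I)) ^ (p - 2) *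
            jetNorm (n + 1) f (ρ * Complex.exp (θ * Complex.I))) := by
  obtain ⟨C, hC0, hC⟩ := exists_norm_iteratedDeriv_dualFunction_comp_le hn hp
  obtain ⟨K, hK1, hK⟩ := exists_norm_iteratedDeriv_circle_le n
  have hK0 : 0 ≤ K := by linarith
  set S : ℝ := ∑ i ∈ Finset.range (n + 1), ‖(descPochhammer ℂ n).coeff i * (-Complex.I) ^ i‖ with hS
  refine ⟨S * (C * (K ^ (p - 2) * K)), by positivity, fun f hf ρ hρ hne θ => ?_⟩
  have hρ' : ρ ∈ Ico (0 : ℝ) 1 := ⟨hρ.1.le, hρ.2⟩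
  have hΩ := isOpen_nonzeroSet hf
  have hmem : ∀ θ : ℝ, (ρ : ℂ) * Complex.exp (θ * Complex.I) ∈ nonzeroSet f := fun θ =>
    ⟨mul_exp_mem_disc hρ.1.le hρ.2 θ, hne θ⟩
  set w : ℂ := ρ * Complex.exp (θ * Complex.I) with hw
  have hF : ContDiff ℝ (⊤ : ℕ∞) fun θ : ℝ => f (ρ * Complex.exp (θ * Complex.I)) := by
    rw [← contDiffOn_univ]
    refine (contDiffOn_real_of_differentiableOn hf).comp (ContDiff.contDiffOn ?_)
      fun θ _ => (hmem θ).1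
    exact contDiff_const.mul ((Complex.ofRealCLM.contDiff.mul contDiff_const).cexp)
  have hbd : ∀ i ≤ n, ‖rotDeriv^[i] (fun w => dualFunction p (f w)) w‖ ≤
      C * ((K * jetNorm n f w) ^ (p - 2) * (K * jetNorm (n + 1) f w)) := by
    intro i hi
    have h1 := hC _ hF hne θ (K * jetNorm n f w) (K * jetNorm (n + 1) f w) (fun j hj => ?_) ?_
      (hK f hf ρ hρ' θ n le_rfl) i hi
    · rwa [iteratedDeriv_comp_circle (g := fun w => dualFunction p (f w)) hΩ
        (contDiffOn_dualFunction_comp p hf) hmem i] at h1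
    · refine (hK f hf ρ hρ' θ j hj.le).trans ?_
      gcongr
      exact jetNorm_mono hj f _
    · gcongr
      exact jetNorm_mono (by omega) f _
  rw [dualDeriv_circle p n hρ hne, fallingRotDeriv]
  calc _ ≤ ∑ i ∈ Finset.range (n + 1), ‖(descPochhammer ℂ n).coeff i * (-Complex.I) ^ i‖ *
        (C * ((K * jetNorm n f w) ^ (p - 2) * (K * jetNorm (n + 1) f w))) := by
        refine (norm_sum_le _ _).trans (Finset.sum_le_sum fun i hi => ?_)
        rw [norm_mul]
        gcongr
        exact hbd i (by rw [Finset.mem_range] at hi; omega)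
    _ = S * (C * ((K * jetNorm n f w) ^ (p - 2) * (K * jetNorm (n + 1) f w))) := by
        rw [← Finset.sum_mul]
    _ = _ := by
        rw [Real.mul_rpow hK0 (jetNorm_nonneg _ _ _)]
        ring

/-- The p - 2 lower-order factors have bounded means of order s, and the last factor grows like
(1-ρ)^{α-1} by Hardy–Littlewood. Hölder combines them. Bounded terms are absorbed because
(1-ρ)^{α-1} ≥ 1. -/
lemma exists_integralMean_dualDeriv_le {n : ℕ} (hn : 1 ≤ n) {p : ℝ} (hp : (n : ℝ) + 1 ≤ p)
    {α : ℝ} (hα0 : 0 < α) (hα1 : α < 1) {s : ℝ≥0∞} (hs : 1 < s) {f : ℂ → ℂ}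
    (hf : DifferentiableOn ℂ f disc) (hH : MemHardy s (iteratedDeriv (n - 1) f))
    (hb : BoundaryValuesInLipschitz α s (iteratedDeriv (n - 1) f)) :
    ∃ C : ℝ, 0 < C ∧ ∀ ρ ∈ Ioo (0 : ℝ) 1,
      (∀ θ : ℝ, f (ρ * Complex.exp (θ * Complex.I)) ≠ 0) →
        integralMean (s / ENNReal.ofReal (p - 1)) ρ (dualDeriv p n f) ≤
          ENNReal.ofReal (C * (1 - ρ) ^ (α - 1)) := by
  have hn1 : (1 : ℝ) ≤ n := by exact_mod_cast hn
  have hP : 0 ≤ p - 2 := by linarith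
  obtain ⟨K, hK0, hK⟩ := exists_norm_dualDeriv_le hn hp
  obtain ⟨M, hM0, hM⟩ := exists_eLpNorm_jetNorm_le hs.le hf (n := n) fun j hj =>
    memHardy_iteratedDeriv_of_le hs.le hf (by omega) hH
  obtain ⟨C, hC0, hC⟩ := exists_integralMean_deriv_le hα0 hα1 hs hH hb
  refine ⟨K * (M ^ (p - 2) * (M + C)) + 1, by positivity, fun ρ hρ hne => ?_⟩
  have hρ' : ρ ∈ Ico (0 : ℝ) 1 := ⟨hρ.1.le, hρ.2⟩
  have hδ : 0 < 1 - ρ := by linarith [hρ.2]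
  have hδ1 : 1 ≤ (1 - ρ) ^ (α - 1) :=
    Real.one_le_rpow_of_pos_of_le_one_of_nonpos hδ (by linarith [hρ.1]) (by linarith)
  set a : ℝ → ℝ := fun θ => jetNorm n f (ρ * Complex.exp (θ * Complex.I)) with ha
  set b : ℝ → ℝ := fun θ => jetNorm (n + 1) f (ρ * Complex.exp (θ * Complex.I)) with hbdef
  have hac : Continuous a := continuous_jetNorm_circle hf n hρ'
  have hbc : Continuous b := continuous_jetNorm_circle hf (n + 1) hρ'
  have hdn : deriv (iteratedDeriv (n - 1) f) = iteratedDeriv n f := by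
    rw [← iteratedDeriv_succ, Nat.sub_add_cancel hn]
  have hbn : eLpNorm b s angleMeasure ≤ ENNReal.ofReal ((M + C) * (1 - ρ) ^ (α - 1)) := by
    have h1 : b = a + fun θ : ℝ => ‖iteratedDeriv n f (ρ * Complex.exp (θ * Complex.I))‖ := by
      ext θ
      simp only [hbdef, ha, jetNorm, Pi.add_apply, Finset.sum_range_succ]
    have h2 := hC ρ hρ'
    rw [hdn] at h2
    rw [h1]
    refine (eLpNorm_add_le hac.aestronglyMeasurable (continuous_comp_circle
      (differentiableOn_iteratedDeriv hf n).continuousOn hρ'.1 hρ'.2).norm.aestronglyMeasurable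
      hs.le).trans ?_
    rw [eLpNorm_norm]
    refine (add_le_add (hM ρ hρ') h2).trans ?_
    rw [← ENNReal.ofReal_add hM0 (by positivity)]
    refine ENNReal.ofReal_le_ofReal ?_
    nlinarith
  have h1 : integralMean (s / ENNReal.ofReal (p - 1)) ρ (dualDeriv p n f) ≤
      ENNReal.ofReal K *
        eLpNorm (fun θ => a θ ^ (p - 2) * b θ) (s / ENNReal.ofReal (p - 1)) angleMeasure := by
    refine eLpNorm_le_mul_eLpNorm_of_ae_le_mul (ae_of_all _ fun θ => ?_) _
    refine (hK f hf ρ hρ hne θ).trans (le_of_eq ?_)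
    have h0 : 0 ≤ a θ ^ (p - 2) * b θ :=
      mul_nonneg (Real.rpow_nonneg (jetNorm_nonneg _ _ _) _) (jetNorm_nonneg _ _ _)
    rw [Real.norm_of_nonneg h0]
  have h2 := eLpNorm_rpow_mul_le (μ := angleMeasure) hac.aestronglyMeasurable
    (fun θ => jetNorm_nonneg _ _ _) hbc.aestronglyMeasurable hP s
  rw [show p - 2 + 1 = p - 1 by ring] at h2
  calc _ ≤ _ := h1
    _ ≤ ENNReal.ofReal K * (ENNReal.ofReal M ^ (p - 2) *
        ENNReal.ofReal ((M + C) * (1 - ρ) ^ (α - 1))) := by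
      gcongr
      refine h2.trans ?_
      gcongr
      exact hM ρ hρ'
    _ = ENNReal.ofReal (K * (M ^ (p - 2) * (M + C)) * (1 - ρ) ^ (α - 1)) := by
      rw [ENNReal.ofReal_rpow_of_nonneg hM0 hP, ← ENNReal.ofReal_mul (by positivity),
        ← ENNReal.ofReal_mul hK0]
      congr 1
      ring
    _ ≤ _ := by
      refine ENNReal.ofReal_le_ofReal ?_
      gcongr
      linarith

lemma integrable_of_integralMean_le {v : ℂ → ℂ} (hv : Measurable v) {α : ℝ} (hα0 : 0 < α)
    {s : ℝ≥0∞} (hs : 1 ≤ s) {C : ℝ} (hC : 0 ≤ C)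
    (h : ∀ᵐ ρ ∂radialMeasure, integralMean s ρ v ≤ ENNReal.ofReal (C * (1 - ρ) ^ (α - 1))) :
    Integrable v areaMeasure := by
  refine ⟨hv.aestronglyMeasurable, ?_⟩
  rw [hasFiniteIntegral_iff_enorm, lintegral_areaMeasure_polar hv.enorm]
  calc _ ≤ ∫⁻ ρ, ENNReal.ofReal (C * (1 - ρ) ^ (α - 1)) ∂radialMeasure := by
        refine lintegral_mono_ae ?_
        filter_upwards [h] with ρ hρ
        refine le_trans ?_ hρ
        rw [← eLpNorm_one_eq_lintegral_enorm]
        refine eLpNorm_le_eLpNorm_of_exponent_le hs ?_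
        exact (hv.comp (by fun_prop)).aestronglyMeasurable
    _ ≤ 2 * ∫⁻ ρ in Ioo (0 : ℝ) 1, ENNReal.ofReal (C * (1 - ρ) ^ (α - 1)) := by
        rw [lintegral_radialMeasure, ← lintegral_const_mul' _ _ ENNReal.ofNat_ne_top]
        refine setLIntegral_mono' measurableSet_Ioo fun ρ hρ => ?_
        gcongr
        rw [show (2 : ℝ≥0∞) = ENNReal.ofReal 2 by simp]
        exact ENNReal.ofReal_le_ofReal (by linarith [hρ.2])
    _ < ∞ := by
        refine ENNReal.mul_lt_top (by simp) ?_
        have h1 := setLIntegral_tail_le hα0 hC zero_le_one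
        rw [sub_self] at h1
        exact ((lintegral_mono_set Ioo_subset_Ico_self).trans h1).trans_lt ENNReal.ofReal_lt_top

lemma integrable_conj_pow_mul {v : ℂ → ℂ} (hv : Integrable v areaMeasure) (m : ℕ) :
    Integrable (fun w => (starRingEnd ℂ) w ^ m * v w) areaMeasure := by
  refine hv.bdd_mul (c := 1) (Complex.continuous_conj.pow m).aestronglyMeasurable ?_
  filter_upwards [ae_areaMeasure_mem_disc] with w hw
  rw [norm_pow, Complex.norm_conj]
  exact pow_le_one₀ (norm_nonneg _) (mem_ball_zero_iff.1 hw).le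

lemma integral_conj_pow_mul_dualDeriv {p : ℝ} (n : ℕ) {f : ℂ → ℂ}
    (hf : DifferentiableOn ℂ f disc) (hne : ∃ w ∈ disc, f w ≠ 0)
    (hv : Integrable (dualDeriv p n f) areaMeasure)
    (hu : Integrable (fun w => dualFunction p (f w)) areaMeasure) (m : ℕ) :
    ∫ w, (starRingEnd ℂ) w ^ m * dualDeriv p n f w ∂areaMeasure =
      m.descFactorial n * ∫ w, (starRingEnd ℂ) w ^ m * dualFunction p (f w) ∂areaMeasure := by
  rw [integral_areaMeasure_polar (integrable_conj_pow_mul hv m),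
    integral_areaMeasure_polar (integrable_conj_pow_mul hu m), ← integral_const_mul]
  refine integral_congr_ae ?_
  filter_upwards [ae_radialMeasure_ne_zero hf hne] with ρ ⟨hρ, hρ0⟩
  simp only [dualDeriv_circle p n hρ hρ0]
  exact integral_conj_pow_mul_fallingRotDeriv (isOpen_nonzeroSet hf)
    (contDiffOn_dualFunction_comp p hf) (fun θ => ⟨mul_exp_mem_disc hρ.1.le hρ.2 θ, hρ0 θ⟩) m n

/-! ### The Bergman integral for the n-th derivative. -/

/-- Shift the Taylor series of the n-th derivative by n; the terms with m < n are harmless because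
their falling factorial vanishes. -/
lemma hasSum_falling_taylor {k : ℂ → ℂ} (hk : DifferentiableOn ℂ k disc) (n : ℕ) {z : ℂ}
    (hz : z ∈ disc) :
    HasSum (fun m : ℕ => (m.descFactorial n : ℂ) *
      ((m.factorial : ℂ)⁻¹ * iteratedDeriv m k 0) * z ^ m) (z ^ n * iteratedDeriv n k z) := by
  have h1 := (Complex.hasSum_taylorSeries_on_ball (differentiableOn_iteratedDeriv hk n)
    hz).mul_left (z ^ n)
  have h0 : ∑ m ∈ Finset.range n, (m.descFactorial n : ℂ) *
      ((m.factorial : ℂ)⁻¹ * iteratedDeriv m k 0) * z ^ m = 0 := by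
    refine Finset.sum_eq_zero fun m hm => ?_
    rw [Nat.descFactorial_eq_zero_iff_lt.2 (Finset.mem_range.1 hm)]
    simp
  rw [← hasSum_nat_add_iff' n, h0, sub_zero]
  refine h1.congr_fun (fun m => ?_)
  have h2 : iteratedDeriv m (iteratedDeriv n k) = iteratedDeriv (m + n) k := by
    rw [iteratedDeriv_eq_iterate, iteratedDeriv_eq_iterate, iteratedDeriv_eq_iterate,
      Function.iterate_add_apply]
  have h3 : ((m + n).factorial : ℂ) = m.factorial * (m + n).descFactorial n := by
    have := Nat.factorial_mul_descFactorial (show n ≤ m + n by omega)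
    rw [Nat.add_sub_cancel] at this
    exact_mod_cast this.symm
  have h4 : ((m + n).descFactorial n : ℂ) ≠ 0 := by
    have : (m + n).descFactorial n ≠ 0 := by
      rw [Ne, Nat.descFactorial_eq_zero_iff_lt]; omega
    exact_mod_cast this
  have h5 : (m.factorial : ℂ) ≠ 0 := by exact_mod_cast m.factorial_ne_zero
  rw [h2, h3]
  simp only [smul_eq_mul, sub_zero]
  field_simp
  ring

lemma hasSum_bergmanKernel {ζ : ℂ} (hζ : ‖ζ‖ < 1) :
    HasSum (fun m : ℕ => ((m : ℂ) + 1) * ζ ^ m) ((1 - ζ) ^ 2)⁻¹ := by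
  have h := hasSum_choose_mul_geometric_of_norm_lt_one 1 hζ
  simpa using h

/-- Expansion of a Bergman type integral in a power series. -/
lemma hasSum_integral_bergmanKernel {v : ℂ → ℂ} (hv : Integrable v areaMeasure) {z : ℂ}
    (hz : z ∈ disc) :
    HasSum (fun m : ℕ => ((m : ℂ) + 1) * z ^ m * ∫ w, (starRingEnd ℂ) w ^ m * v w ∂areaMeasure)
      (∫ w, v w * ((1 - (starRingEnd ℂ) w * z) ^ 2)⁻¹ ∂areaMeasure) := by
  have hz1 : ‖z‖ < 1 := mem_ball_zero_iff.1 hz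
  have hFi : ∀ m : ℕ, Integrable (fun w => ((m : ℂ) + 1) * z ^ m *
      ((starRingEnd ℂ) w ^ m * v w)) areaMeasure := fun m =>
    (integrable_conj_pow_mul hv m).const_mul _
  have hbd : ∀ m : ℕ, ∫ w, ‖((m : ℂ) + 1) * z ^ m * ((starRingEnd ℂ) w ^ m * v w)‖ ∂areaMeasure ≤
      ((m : ℝ) + 1) * ‖z‖ ^ m * ∫ w, ‖v w‖ ∂areaMeasure := by
    intro m
    rw [← integral_const_mul]
    refine integral_mono_ae (hFi m).norm (hv.norm.const_mul _) ?_
    filter_upwards [ae_areaMeasure_mem_disc] with w hw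
    have hm : ‖(m : ℂ) + 1‖ = (m : ℝ) + 1 := by
      have : ((m : ℂ) + 1) = ((m + 1 : ℕ) : ℂ) := by push_cast; rfl
      rw [this, Complex.norm_natCast]
      push_cast
      rfl
    simp only [norm_mul, norm_pow, Complex.norm_conj, hm]
    gcongr
    exact mul_le_of_le_one_left (norm_nonneg _)
      (pow_le_one₀ (norm_nonneg _) (mem_ball_zero_iff.1 hw).le)
  have hgeo : Summable fun m : ℕ => ((m : ℝ) + 1) * ‖z‖ ^ m := by
    have h := (hasSum_choose_mul_geometric_of_norm_lt_one (𝕜 := ℝ) 1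
      (r := ‖z‖) (by rwa [norm_norm])).summable
    simpa using h
  have hS := hasSum_integral_of_summable_integral_norm hFi
    (Summable.of_nonneg_of_le (fun m => by positivity) hbd (hgeo.mul_right _))
  simp only [integral_const_mul] at hS
  suffices heq : ∫ w, v w * ((1 - (starRingEnd ℂ) w * z) ^ 2)⁻¹ ∂areaMeasure =
      ∫ w, ∑' m : ℕ, ((m : ℂ) + 1) * z ^ m * ((starRingEnd ℂ) w ^ m * v w) ∂areaMeasure by
    rw [heq]
    exact hS
  refine integral_congr_ae ?_
  filter_upwards [ae_areaMeasure_mem_disc] with w hw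
  have hζ : ‖(starRingEnd ℂ) w * z‖ < 1 := by
    rw [norm_mul, Complex.norm_conj]
    have := mem_ball_zero_iff.1 hw
    nlinarith [norm_nonneg w, norm_nonneg z]
  rw [← ((hasSum_bergmanKernel hζ).mul_left (v w)).tsum_eq]
  refine tsum_congr fun m => ?_
  ring

/-- The integral representation of the derivatives of an extremal kernel. -/
lemma IsExtremal.pow_mul_iteratedDeriv_eq {p q : ℝ} (hpq : p.HolderConjugate q) {k f : ℂ → ℂ}
    (hk : MemBergman q k) (hext : IsExtremal p k f) (hne : ∃ w ∈ disc, f w ≠ 0) {n : ℕ}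
    (hv : Integrable (dualDeriv p n f) areaMeasure) {z : ℂ} (hz : z ∈ disc) :
    z ^ n * iteratedDeriv n k z =
      ((∫ z, f z * (starRingEnd ℂ) (k z) ∂areaMeasure).re : ℂ) *
        ∫ w, dualDeriv p n f w * ((1 - (starRingEnd ℂ) w * z) ^ 2)⁻¹ ∂areaMeasure := by
  have hu : Integrable (fun w => dualFunction p (f w)) areaMeasure :=
    (memLp_dualFunction hpq hext.1).integrable
      (by rw [ENNReal.one_le_ofReal]; exact hpq.symm.lt.le)
  -- Both sides are sums of the same series: the coefficient formula for k and the moments of v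
  -- agree term by term.
  refine (hasSum_falling_taylor hk.1 n hz).unique ?_
  have h := (hasSum_integral_bergmanKernel hv hz).mul_left
    ((∫ z, f z * (starRingEnd ℂ) (k z) ∂areaMeasure).re : ℂ)
  refine h.congr_fun (fun m => ?_)
  rw [hext.taylor_coeff_eq hpq hk m, integral_conj_pow_mul_dualDeriv n hext.1.1 hne hv hu]
  ring

/-! ### Growth of Bergman integrals. -/

lemma measurable_bergmanKernel_polar (r : ℝ) :
    Measurable fun y : ℝ × ℝ => ((1 - (y.1 * r : ℝ) * Complex.exp (y.2 * Complex.I)) ^ 2)⁻¹ := by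
  fun_prop

/-- Radial growth of Bergman type integrals. -/
lemma exists_integralMean_bergmanIntegral_le {α : ℝ} (hα0 : 0 < α) (hα1 : α < 1) {s : ℝ≥0∞}
    (hs : 1 ≤ s) {v : ℂ → ℂ} (hv : Measurable v) {C : ℝ} (hC : 0 < C)
    (h : ∀ᵐ ρ ∂radialMeasure, integralMean s ρ v ≤ ENNReal.ofReal (C * (1 - ρ) ^ (α - 1))) :
    ∃ K : ℝ, 0 ≤ K ∧ ∀ r ∈ Ico (0 : ℝ) 1,
      integralMean s r (fun z => ∫ w, v w * ((1 - (starRingEnd ℂ) w * z) ^ 2)⁻¹ ∂areaMeasure) ≤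
        ENNReal.ofReal (K * (1 - r) ^ (α - 1)) := by
  obtain ⟨C₁, hC₁0, hC₁⟩ := exists_setLIntegral_kernel_le (β := 0) le_rfl zero_lt_one
  obtain ⟨C₂, hC₂0, hC₂⟩ := exists_setLIntegral_radial_le hα0 hα1
  refine ⟨2 * (C * C₁) * C₂, by positivity, fun r hr => ?_⟩
  have hne : ∀ ρ ∈ Ioo (0 : ℝ) 1, ∀ θ : ℝ,
      0 < ‖1 - (ρ * r : ℝ) * Complex.exp (θ * Complex.I)‖ := fun ρ hρ θ => by
    have h1 := norm_sub_norm_le (1 : ℂ) ((ρ * r : ℝ) * Complex.exp (θ * Complex.I))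
    rw [norm_mul_exp (mul_nonneg hρ.1.le hr.1), norm_one] at h1
    have : ρ * r < 1 := by nlinarith [hρ.1, hρ.2, hr.1, hr.2]
    linarith
  have hmem : ∀ᵐ y ∂(radialMeasure.prod angleMeasure), y.1 ∈ Ioo (0 : ℝ) 1 :=
    Measure.quasiMeasurePreserving_fst.ae ae_radialMeasure_mem
  have hmean : ∀ᵐ y ∂(radialMeasure.prod angleMeasure),
      integralMean s y.1 v ≤ ENNReal.ofReal (C * (1 - y.1) ^ (α - 1)) :=
    Measure.quasiMeasurePreserving_fst.ae h
  have hG : Measurable (Function.uncurry fun (φ : ℝ) (y : ℝ × ℝ) =>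
      v (y.1 * Complex.exp ((y.2 + φ : ℝ) * Complex.I)) *
        ((1 - (y.1 * r : ℝ) * Complex.exp (y.2 * Complex.I)) ^ 2)⁻¹) := by
    refine (hv.comp ?_).mul ((measurable_bergmanKernel_polar r).comp measurable_snd)
    fun_prop
  -- Rotating the variable w by φ leaves φ only in the argument of v and makes the modulus of the
  -- kernel independent of φ, so that Minkowski applies over (ρ, θ).
  have hpt : ∀ φ : ℝ, ‖∫ w, v w * ((1 - (starRingEnd ℂ) w *
      (r * Complex.exp (φ * Complex.I))) ^ 2)⁻¹ ∂areaMeasure‖ₑ ≤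
      ∫⁻ y, ‖v (y.1 * Complex.exp ((y.2 + φ : ℝ) * Complex.I)) *
        ((1 - (y.1 * r : ℝ) * Complex.exp (y.2 * Complex.I)) ^ 2)⁻¹‖ₑ
          ∂(radialMeasure.prod angleMeasure) := by
    intro φ
    refine (enorm_integral_le_lintegral_enorm _).trans (le_of_eq ?_)
    rw [lintegral_areaMeasure_polar, lintegral_prod]
    · refine lintegral_congr fun ρ => ?_
      rw [← lintegral_angleMeasure_add (comp_exp_periodic (fun w => ‖v w * ((1 - (starRingEnd ℂ) w *
        (r * Complex.exp (φ * Complex.I))) ^ 2)⁻¹‖ₑ) ρ) φ]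
      refine lintegral_congr fun θ => ?_
      rw [enorm_eq_iff_norm_eq, norm_mul, norm_mul, norm_inv, norm_inv, norm_pow, norm_pow,
        ← Complex.norm_conj (1 - (ρ * r : ℝ) * Complex.exp (θ * Complex.I))]
      congr 4
      simp only [map_sub, map_one, map_mul, Complex.conj_ofReal, ← Complex.exp_conj,
        Complex.conj_I]
      push_cast
      rw [mul_mul_mul_comm, ← Complex.exp_add]
      ring_nf
    · exact (hG.comp measurable_prodMk_left).enorm.aemeasurable
    · have : Measurable fun w : ℂ => (starRingEnd ℂ) w := Complex.continuous_conj.measurable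
      fun_prop
  have key := eLpNorm_le_lintegral (μ := angleMeasure) (ν := radialMeasure.prod angleMeasure) hs
    (f := fun φ : ℝ => ∫ w, v w * ((1 - (starRingEnd ℂ) w *
      (r * Complex.exp (φ * Complex.I))) ^ 2)⁻¹ ∂areaMeasure) hG.aestronglyMeasurable
    (N := fun y => ENNReal.ofReal (C * (1 - y.1) ^ (α - 1)) *
      ENNReal.ofReal (1 / ‖1 - (y.1 * r : ℝ) * Complex.exp (y.2 * Complex.I)‖ ^ 2))
    (by fun_prop) ?_ ?_ (ae_of_all _ hpt)
  · refine key.trans ?_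
    rw [lintegral_prod _ (by fun_prop), lintegral_radialMeasure]
    -- The angular integral of |1 - ρr e^{iθ}|^{-2} is O((1 - ρr)^{-1}); the radial estimate then
    -- restores the exponent α - 1.
    calc _ ≤ ∫⁻ ρ in Ioo (0 : ℝ) 1, ENNReal.ofReal (2 * (C * C₁)) *
          ENNReal.ofReal ((1 - ρ) ^ (α - 1) * (1 - ρ * r)⁻¹) := by
          refine setLIntegral_mono' measurableSet_Ioo fun ρ hρ => ?_
          have hδ : 0 < 1 - ρ := by linarith [hρ.2]
          have hρr : ρ * r ∈ Ico (0 : ℝ) 1 :=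
            ⟨mul_nonneg hρ.1.le hr.1, by nlinarith [hρ.1, hρ.2, hr.1, hr.2]⟩
          have hδ' : 0 < 1 - ρ * r := by linarith [hρr.2]
          dsimp only
          rw [lintegral_const_mul' _ _ ENNReal.ofReal_ne_top]
          have h1 : ∫⁻ θ, ENNReal.ofReal (1 / ‖1 - (ρ * r : ℝ) *
              Complex.exp (θ * Complex.I)‖ ^ 2) ∂angleMeasure ≤
              ENNReal.ofReal (C₁ * (1 - ρ * r)⁻¹) := by
            rw [lintegral_angleMeasure_eq_symm (comp_exp_periodic
              (fun w => ENNReal.ofReal (1 / ‖1 - w‖ ^ 2)) (ρ * r))]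
            have hle : (ENNReal.ofReal (2 * Real.pi))⁻¹ ≤ 1 := by
              rw [ENNReal.inv_le_one, ENNReal.one_le_ofReal]
              linarith [Real.pi_gt_three]
            refine (mul_le_of_le_one_left' hle).trans ?_
            have := hC₁ (ρ * r) hρr
            simpa [Real.rpow_neg_one] using this
          calc _ ≤ ENNReal.ofReal (2 * ρ) * (ENNReal.ofReal (C * (1 - ρ) ^ (α - 1)) *
                ENNReal.ofReal (C₁ * (1 - ρ * r)⁻¹)) := by gcongr
            _ = ENNReal.ofReal (2 * ρ * (C * (1 - ρ) ^ (α - 1) * (C₁ * (1 - ρ * r)⁻¹))) := by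
                rw [← ENNReal.ofReal_mul (by positivity),
                  ← ENNReal.ofReal_mul (by linarith [hρ.1])]
            _ ≤ ENNReal.ofReal (2 * 1 * (C * (1 - ρ) ^ (α - 1) * (C₁ * (1 - ρ * r)⁻¹))) := by
                gcongr
                exact hρ.2.le
            _ = _ := by
                rw [← ENNReal.ofReal_mul (by positivity)]
                congr 1
                ring
      _ ≤ ENNReal.ofReal (2 * (C * C₁)) * ENNReal.ofReal (C₂ * (1 - r) ^ (α - 1)) := by
          rw [lintegral_const_mul' _ _ ENNReal.ofReal_ne_top]
          gcongr
          exact hC₂ r hr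
      _ = _ := by
          rw [← ENNReal.ofReal_mul (by positivity)]
          congr 1
          ring
  · filter_upwards [hmem] with y hy
    have hδ : 0 < 1 - y.1 := by linarith [hy.2]
    have h2 := hne y.1 hy y.2
    exact mul_ne_zero (ENNReal.ofReal_pos.2 (by positivity)).ne'
      (ENNReal.ofReal_pos.2 (by positivity)).ne'
  · filter_upwards [hmean] with y hy
    have h1 : (fun φ : ℝ => v (y.1 * Complex.exp ((y.2 + φ : ℝ) * Complex.I)) *
        ((1 - (y.1 * r : ℝ) * Complex.exp (y.2 * Complex.I)) ^ 2)⁻¹) =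
        ((1 - (y.1 * r : ℝ) * Complex.exp (y.2 * Complex.I)) ^ 2)⁻¹ •
          fun φ : ℝ => v (y.1 * Complex.exp ((φ + y.2 : ℝ) * Complex.I)) := by
      ext φ
      simp only [Pi.smul_apply, smul_eq_mul, add_comm y.2]
      ring
    rw [h1, eLpNorm_const_smul, eLpNorm_angleMeasure_add
      (G := fun φ : ℝ => v (y.1 * Complex.exp (φ * Complex.I))) (comp_exp_periodic v y.1), mul_comm]
    gcongr
    · exact hy
    · rw [← ofReal_norm, norm_inv, norm_pow, one_div]

lemma integralMean_le_of_norm_le {s : ℝ≥0∞} (hs : s ≠ 0) {r : ℝ} {G : ℂ → ℂ} {M : ℝ}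
    (h : ∀ θ : ℝ, ‖G (r * Complex.exp (θ * Complex.I))‖ ≤ M) :
    integralMean s r G ≤ ENNReal.ofReal M := by
  have hM : 0 ≤ M := (norm_nonneg _).trans (h 0)
  have h1 : integralMean s r G ≤ eLpNorm (fun _ : ℝ => (M : ℂ)) s angleMeasure := by
    refine eLpNorm_mono fun θ => ?_
    rw [Complex.norm_real, Real.norm_of_nonneg hM]
    exact h θ
  rwa [integralMean_const s hs, ← ofReal_norm, Complex.norm_real, Real.norm_of_nonneg hM] at h1

/-- Growth of the `n`-th derivative from growth of `z ^ n` times that derivative. -/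
lemma exists_integralMean_le_of_pow_mul {α : ℝ} (hα1 : α < 1) {s : ℝ≥0∞} (hs : s ≠ 0)
    {G : ℂ → ℂ} (hG : DifferentiableOn ℂ G disc) (n : ℕ) {K : ℝ} (hK : 0 ≤ K)
    (h : ∀ r ∈ Ico (0 : ℝ) 1,
      integralMean s r (fun z => z ^ n * G z) ≤ ENNReal.ofReal (K * (1 - r) ^ (α - 1))) :
    ∃ C : ℝ, 0 < C ∧ ∀ r ∈ Ico (0 : ℝ) 1,
      integralMean s r G ≤ ENNReal.ofReal (C * (1 - r) ^ (α - 1)) := by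
  have hsub : Metric.closedBall (0 : ℂ) (1 / 2) ⊆ disc :=
    Metric.closedBall_subset_ball (by norm_num)
  obtain ⟨M, hM⟩ := (isCompact_closedBall (0 : ℂ) (1 / 2)).exists_bound_of_continuousOn
    (hG.continuousOn.mono hsub)
  have hM0 : 0 ≤ M := (norm_nonneg _).trans (hM 0 (by simp))
  refine ⟨2 ^ n * K + M + 1, by positivity, fun r hr => ?_⟩
  have hδ : 0 < 1 - r := by linarith [hr.2]
  have hδ1 : 1 ≤ (1 - r) ^ (α - 1) :=
    Real.one_le_rpow_of_pos_of_le_one_of_nonpos hδ (by linarith [hr.1]) (by linarith)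
  -- Near the origin G is bounded by compactness; for r ≥ 1/2, dividing by z^n costs at most 2^n.
  rcases le_total r (1 / 2) with hr2 | hr2
  · refine (integralMean_le_of_norm_le hs (M := M) fun θ => hM _ ?_).trans
      (ENNReal.ofReal_le_ofReal ?_)
    · rw [mem_closedBall_zero_iff, norm_mul_exp hr.1]
      exact hr2
    · have : 0 ≤ 2 ^ n * K := by positivity
      nlinarith
  · have h1 : integralMean s r G ≤
        ENNReal.ofReal (2 ^ n) * integralMean s r (fun z => z ^ n * G z) := by
      refine eLpNorm_le_mul_eLpNorm_of_ae_le_mul (ae_of_all _ fun θ => ?_) _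
      rw [norm_mul, norm_pow, norm_mul_exp hr.1, ← mul_assoc, ← mul_pow]
      exact le_mul_of_one_le_left (norm_nonneg _) (one_le_pow₀ (by linarith))
    refine h1.trans ?_
    calc _ ≤ ENNReal.ofReal (2 ^ n) * ENNReal.ofReal (K * (1 - r) ^ (α - 1)) := by
          gcongr; exact h r hr
      _ ≤ _ := by
          rw [← ENNReal.ofReal_mul (by positivity), ← mul_assoc]
          refine ENNReal.ofReal_le_ofReal ?_
          gcongr
          linarith

/-! ### Nontriviality of f and the linear case p = 2. -/

lemma exists_ne_zero_of_bergmanNorm_eq_one {p : ℝ} {f : ℂ → ℂ} (h : bergmanNorm p f = 1) :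
    ∃ w ∈ disc, f w ≠ 0 := by
  by_contra! hcon
  have h1 : bergmanNorm p f = 0 := by
    rw [bergmanNorm, eLpNorm_congr_ae (g := 0)]
    · simp
    · filter_upwards [ae_areaMeasure_mem_disc] with w hw using hcon w hw
  rw [h1] at h
  exact zero_ne_one h

/-- For `p = 2` an extremal function is a multiple of its kernel. -/
lemma IsExtremal.eqOn_const_mul {q : ℝ} (hpq : (2 : ℝ).HolderConjugate q) {k f : ℂ → ℂ}
    (hk : MemBergman q k) (hext : IsExtremal 2 k f) :
    EqOn k (fun z => ((∫ z, f z * (starRingEnd ℂ) (k z) ∂areaMeasure).re : ℂ) * f z) disc := by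
  intro z hz
  have hf := hext.1
  have hfi : Integrable f areaMeasure :=
    hf.memLp.integrable (by rw [ENNReal.one_le_ofReal]; norm_num)
  have h1 := hasSum_falling_taylor hk.1 0 hz
  have h2 := (hasSum_falling_taylor hf.1 0 hz).mul_left
    ((∫ z, f z * (starRingEnd ℂ) (k z) ∂areaMeasure).re : ℂ)
  simp only [pow_zero, one_mul, iteratedDeriv_zero, Nat.descFactorial_zero, Nat.cast_one] at h1 h2
  refine h1.unique (h2.congr_fun (fun m => ?_))
  have hdual : ∀ w, dualFunction 2 (f w) = f w := fun w => by simp [dualFunction]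
  have hm : (m : ℂ) + 1 ≠ 0 := by exact_mod_cast m.succ_ne_zero
  rw [hext.taylor_coeff_eq hpq hk m]
  simp only [hdual]
  rw [integral_conj_pow_mul hf.1 hfi]
  field_simp

lemma MemHardy.of_eqOn_const_mul {s : ℝ≥0∞} {F G : ℂ → ℂ} (hF : MemHardy s F) (c : ℂ)
    (h : EqOn G (fun z => c * F z) disc) : MemHardy s G := by
  refine ⟨(hF.1.const_mul c).congr h, ?_⟩
  refine lt_of_le_of_lt (b := ‖c‖ₑ * ⨆ r ∈ Ico (0 : ℝ) 1, integralMean s r F)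
    (iSup₂_le fun r hr => ?_) (ENNReal.mul_lt_top (by simp) hF.2)
  have h1 : integralMean s r G = ‖c‖ₑ * integralMean s r F := by
    unfold integralMean
    rw [← eLpNorm_const_smul]
    congr 1
    ext θ
    exact h (mul_exp_mem_disc hr.1 hr.2 θ)
  rw [h1]
  gcongr
  exact le_iSup₂_of_le (f := fun r (_ : r ∈ Ico (0 : ℝ) 1) => integralMean s r F) r hr le_rfl

lemma BoundaryValuesInLipschitz.of_eqOn_const_mul {α : ℝ} {s : ℝ≥0∞} (hs : s ≠ ∞) {F G : ℂ → ℂ}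
    (hF : BoundaryValuesInLipschitz α s F) (c : ℂ) (h : EqOn G (fun z => c * F z) disc) :
    BoundaryValuesInLipschitz α s G := by
  obtain ⟨u, hu, huL⟩ := hF
  rcases huL with ⟨h1, -⟩ | ⟨-, hLp, C, hC⟩
  · exact absurd h1 hs
  refine ⟨fun ζ => c * u ζ, ?_, Or.inr ⟨hs, hLp.const_mul c, ‖c‖₊ * C, ?_⟩⟩
  · filter_upwards [hu] with θ hθ
    refine (hθ.const_mul c).congr' ?_
    filter_upwards [Ioo_mem_nhdsLT (show (0 : ℝ) < 1 by norm_num)] with r hr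
    exact (h (mul_exp_mem_disc hr.1.le hr.2 θ)).symm
  · filter_upwards [hC] with t ht
    refine iSup₂_le fun τ hτ => ?_
    have h1 : (fun x : ℝ => c * u (Circle.exp (x + τ)) - c * u (Circle.exp x)) =
        c • fun x : ℝ => u (Circle.exp (x + τ)) - u (Circle.exp x) := by
      ext x
      simp [mul_sub]
    rw [h1, eLpNorm_const_smul, ENNReal.coe_mul, mul_assoc]
    gcongr
    · rfl
    · refine le_trans ?_ ht
      exact le_iSup₂_of_le (f := fun h (_ : h ∈ Ioc (0 : ℝ) t) =>
        eLpNorm (fun x : ℝ => u (Circle.exp (x + h)) - u (Circle.exp x)) s angleMeasure) τ hτ le_rfl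

end Bergman

end

/-! ### The main theorem. -/

theorem mainTheorem7 (n : ℕ) (hn : 1 ≤ n) (p q α : ℝ) (s : ℝ≥0∞)
    (hp : (n : ℝ) + 1 ≤ p) (hpq : p.HolderConjugate q)
    (hs : ENNReal.ofReal (p - 1) ≤ s) (hα₀ : 0 < α) (hα₁ : α < 1)
    (f k : ℂ → ℂ)
    (hf : Bergman.MemBergman p f) (hf_norm : Bergman.bergmanNorm p f = 1)
    (hf_hardy : Bergman.MemHardy s (iteratedDeriv (n - 1) f))
    (hf_lip : Bergman.BoundaryValuesInLipschitz α s (iteratedDeriv (n - 1) f))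
    (hk : Bergman.MemBergman q k) (hext : Bergman.IsExtremal p k f) :
    Bergman.MemHardy (s / ENNReal.ofReal (p - 1)) (iteratedDeriv (n - 1) k) ∧
    Bergman.BoundaryValuesInLipschitz α (s / ENNReal.ofReal (p - 1))
      (iteratedDeriv (n - 1) k) := by
  have hn1 : (1 : ℝ) ≤ n := by exact_mod_cast hn
  -- If s ≤ 1, then p - 1 ≤ s together with p ≥ n + 1 ≥ 2 leaves only p = 2 and n = 1. There the
  -- dual function is the identity, and k inherits everything from f as a constant multiple.
  rcases le_or_gt s 1 with hs1 | hs1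
  · have hp1 : p - 1 ≤ 1 := ENNReal.ofReal_le_one.1 (hs.trans hs1)
    obtain rfl : p = 2 := by linarith
    obtain rfl : n = 1 := by
      have : (n : ℝ) ≤ 1 := by linarith
      have : n ≤ 1 := by exact_mod_cast this
      omega
    have hc := hext.eqOn_const_mul hpq hk
    norm_num at hf_hardy hf_lip ⊢
    exact ⟨hf_hardy.of_eqOn_const_mul _ hc,
      hf_lip.of_eqOn_const_mul (hs1.trans_lt ENNReal.one_lt_top).ne _ hc⟩
  have hP0 : ENNReal.ofReal (p - 1) ≠ 0 := (ENNReal.ofReal_pos.2 (by linarith)).ne'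
  have hs' : 1 ≤ s / ENNReal.ofReal (p - 1) := by
    rwa [ENNReal.le_div_iff_mul_le (Or.inl hP0) (Or.inl ENNReal.ofReal_ne_top), one_mul]
  have hne := Bergman.exists_ne_zero_of_bergmanNorm_eq_one hf_norm
  obtain ⟨C, hC0, hC⟩ := Bergman.exists_integralMean_dualDeriv_le hn hp hα₀ hα₁ hs1 hf.1 hf_hardy
    hf_lip
  have hvm := Bergman.measurable_dualDeriv p n hf.1
  have hmean : ∀ᵐ ρ ∂Bergman.radialMeasure,
      Bergman.integralMean (s / ENNReal.ofReal (p - 1)) ρ (Bergman.dualDeriv p n f) ≤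
        ENNReal.ofReal (C * (1 - ρ) ^ (α - 1)) := by
    filter_upwards [Bergman.ae_radialMeasure_ne_zero hf.1 hne] with ρ hρ using hC ρ hρ.1 hρ.2
  have hvi := Bergman.integrable_of_integralMean_le hvm hα₀ hs' hC0.le hmean
  obtain ⟨K, hK0, hK⟩ := Bergman.exists_integralMean_bergmanIntegral_le hα₀ hα₁ hs' hvm hC0 hmean
  set L : ℝ := (∫ z, f z * (starRingEnd ℂ) (k z) ∂Bergman.areaMeasure).re with hL
  obtain ⟨C', hC'0, hC'⟩ := Bergman.exists_integralMean_le_of_pow_mul hα₁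
    (zero_lt_one.trans_le hs').ne' (Bergman.differentiableOn_iteratedDeriv hk.1 n) n
    (K := |L| * K) (by positivity) fun r hr => by
      have h1 : Bergman.integralMean (s / ENNReal.ofReal (p - 1)) r
          (fun z => z ^ n * iteratedDeriv n k z) ≤ ENNReal.ofReal |L| *
          Bergman.integralMean (s / ENNReal.ofReal (p - 1)) r (fun z => ∫ w,
            Bergman.dualDeriv p n f w * ((1 - (starRingEnd ℂ) w * z) ^ 2)⁻¹
              ∂Bergman.areaMeasure) := by
        refine eLpNorm_le_mul_eLpNorm_of_ae_le_mul (ae_of_all _ fun θ => ?_) _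
        beta_reduce
        rw [hext.pow_mul_iteratedDeriv_eq hpq hk hne hvi (Bergman.mul_exp_mem_disc hr.1 hr.2 θ),
          norm_mul, Complex.norm_real, Real.norm_eq_abs]
      refine h1.trans ?_
      rw [mul_assoc, ENNReal.ofReal_mul (abs_nonneg _)]
      gcongr
      exact hK r hr
  -- The derivative of k^{(n-1)} is k^{(n)}, whose means now have the growth required by the
  -- converse theorem.
  refine Bergman.memHardy_and_lipschitz_of_integralMean_deriv_le hα₀ hs'
    (Bergman.differentiableOn_iteratedDeriv hk.1 (n - 1)) hC'0 fun r hr => ?_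
  rw [← iteratedDeriv_succ, Nat.sub_add_cancel hn]
  exact hC' r hr
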